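/- Let $\mathfrak g$ be a finite-dimensional simple complex Lie algebra with a non-degenerate symmetric invariant bilinear form $\kappa_0$ (e.g. the Killing form). Let $\mathfrak d=\mathfrak g[\epsilon]/\epsilon^2\mathfrak g[\epsilon]$ be its cotangent Lie algebra, graded by $\deg\mathfrak g=0$, $\deg\epsilon\mathfrak g=2$, with the form $\kappa(a_1+\epsilon b_1,a_2+\epsilon b_2)=\kappa_0(a_1,b_2)+\kappa_0(b_1,a_2)$. Put $\mathcal O=\mathbb C[\![t]\!]$, $\mathcal K=\mathbb C(\!(t)\!)$; tensor products of spaces of power series are completed, so $\mathfrak d(\mathcal O)\otimes\mathfrak d(\mathcal O)=(\mathfrak d\otimes\mathfrak d)[\![t_1,t_2]\!]$, and $\tau$ is the tensor flip. For $(\mathfrak p,\beta)\in\{(\mathfrak g,\kappa_0),(\mathfrak d,\kappa)\}$ let $C_{\mathfrak p}\in\mathfrak p\otimes\mathfrak p$ be the Casimir element of $\beta$. A *generalized $r$-matrix* with coefficients in $\mathfrak p$ is a series $r(t_1,t_2)=\frac{C_{\mathfrak p}}{t_1-t_2}+g(t_1,t_2)$ with $g\in(\mathfrak p\otimes\mathfrak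 p)[\![t_1,t_2]\!]$ such that $$[r^{12}(t_1,t_2),r^{13}(t_1,t_3)]+[r^{12}(t_1,t_2),r^{23}(t_2,t_3)]+[r^{32}(t_3,t_2),r^{13}(t_1,t_3)]=0 .$$ It is *rational* if $g\in(\mathfrak p\otimes\mathfrak p)[t_1,t_2]$, and an *$r$-matrix* if $r(t_1,t_2)=-\tau(r(t_2,t_1))$; an $r$-matrix satisfies the classical Yang–Baxter equation $[r^{12}(t_1,t_2),r^{13}(t_1,t_3)]+[r^{12}(t_1,t_2),r^{23}(t_2,t_3)]+[r^{13}(t_1,t_3),r^{23}(t_2,t_3)]=0$. These equations are read over the fraction fields of $\mathbb C[\![t_1,t_2]\!]$ and $\mathbb C[\![t_1,t_2,t_3]\!]$. A *topological Lie bialgebra structure* on $\mathfrak d(\mathcal O)$ is a skew-symmetric linear map $\delta:\mathfrak d(\mathcal O)\to\mathfrak d(\mathcal O)\otimes\mathfrak d(\mathcal O)$ with $\delta([x,y])=[x\otimes1+1\otimes x,\delta(y)]-[y\otimes1+1\otimes y,\delta(x)]$ and $(\delta\otimes1)\delta-(1\otimes\delta)\delta+(\tau\otimes1)(1\otimes\delta)\delta=0$.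 It is *$\epsilon$-graded with topological double $\mathfrak d(\mathcal K)$* if there is a Lie subalgebra $V\subseteq\mathfrak d(\mathcal K)$ with $\mathfrak d(\mathcal K)=\mathfrak d(\mathcal O)\oplus V$, equal to its own orthogonal complement for $\operatorname{res}_{t=0}\kappa(\cdot,\cdot)$, with $V=(V\cap\mathfrak g(\mathcal K))\oplus(V\cap\epsilon\mathfrak g(\mathcal K))$, and such that $$\operatorname{res}_{t_1=0}\operatorname{res}_{t_2=0}\,(\kappa\otimes\kappa)\big(\delta(x),w_1\otimes w_2\big)=\operatorname{res}_{t=0}\kappa(x,[w_1,w_2])\qquad(x\in\mathfrak d(\mathcal O),\ w_1,w_2\in V).$$ *$\epsilon$-graded Lie bialgebra structures on $\mathfrak d[t]$ with double $\mathfrak d(\!(t^{-1})\!)$* are defined in the same way, with $\mathfrak d[t]$, the algebraic tensor product $\mathfrak d[t]\otimes\mathfrak d[t]$, $\mathfrak d(\!(t^{-1})\!)$ and the coefficient of $t^{-1}$ in place of $\mathfrak d(\mathcal O)$, $\mathfrak d(\mathcal O)\otimes\mathfrak d(\mathcal O)$, $\mathfrak d(\mathcal K)$ and the residue. **Proposition.**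 (a) For every generalized $r$-matrix $r$ with coefficients in $\mathfrak g$, the series $$\rho=(1\otimes\epsilon)\,r(t_1,t_2)-(\epsilon\otimes1)\,\tau(r(t_2,t_1))$$ is an $r$-matrix with coefficients in $\mathfrak d$. (b) The map $r\mapsto\delta_\rho$, $\delta_\rho(x)=[\rho(t_1,t_2),x(t_1)\otimes1+1\otimes x(t_2)]$, is a well-defined bijection from the set of generalized $r$-matrices with coefficients in $\mathfrak g$ onto the set of $\epsilon$-graded topological Lie bialgebra structures on $\mathfrak d(\mathcal O)$ with topological double $\mathfrak d(\mathcal K)$. (c) For rational $r$ the map $\delta_\rho$ restricts to a map $\mathfrak d[t]\to\mathfrak d[t]\otimes\mathfrak d[t]$, and $r\mapsto\delta_\rho|_{\mathfrak d[t]}$ is a bijection from the set of rational generalized $r$-matrices with coefficients in $\mathfrak g$ onto the set of $\epsilon$-graded Lie bialgebra structures on $\mathfrak d[t]$ with double $\mathfrak d(\!(t^{-1})\!)$. -/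

import Mathlib

open scoped TensorProduct

noncomputable section

namespace LoopBialgebra

/-! ### The cotangent Lie algebra -/

/-- The cotangent Lie algebra `𝔡 = 𝔤[ε]/ε²𝔤[ε]`; the pair `(a, b)` stands for `a + ε b`. -/
def Cotangent (𝔤 : Type*) : Type _ := 𝔤 × 𝔤

namespace Cotangent

@[ext] theorem ext {𝔤 : Type*} {x y : Cotangent 𝔤} (h₁ : x.1 = y.1) (h₂ : x.2 = y.2) : x = y :=
  Prod.ext h₁ h₂

variable {𝔤 : Type*} [LieRing 𝔤]

instance : AddCommGroup (Cotangent 𝔤) := inferInstanceAs (AddCommGroup (𝔤 × 𝔤))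

instance [LieAlgebra ℂ 𝔤] : Module ℂ (Cotangent 𝔤) := inferInstanceAs (Module ℂ (𝔤 × 𝔤))

instance [LieAlgebra ℂ 𝔤] [FiniteDimensional ℂ 𝔤] : FiniteDimensional ℂ (Cotangent 𝔤) :=
  inferInstanceAs (FiniteDimensional ℂ (𝔤 × 𝔤))

@[simp] theorem fst_add (x y : Cotangent 𝔤) : (x + y).1 = x.1 + y.1 := rfl
@[simp] theorem snd_add (x y : Cotangent 𝔤) : (x + y).2 = x.2 + y.2 := rfl
@[simp] theorem fst_zero : (0 : Cotangent 𝔤).1 = 0 := rfl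
@[simp] theorem snd_zero : (0 : Cotangent 𝔤).2 = 0 := rfl
@[simp] theorem fst_smul [LieAlgebra ℂ 𝔤] (c : ℂ) (x : Cotangent 𝔤) : (c • x).1 = c • x.1 := rfl
@[simp] theorem snd_smul [LieAlgebra ℂ 𝔤] (c : ℂ) (x : Cotangent 𝔤) : (c • x).2 = c • x.2 := rfl

/-- `[a₁ + ε b₁, a₂ + ε b₂] = [a₁, a₂] + ε ([a₁, b₂] + [b₁, a₂])`. -/
instance : Bracket (Cotangent 𝔤) (Cotangent 𝔤) :=
  ⟨fun x y => (⁅x.1, y.1⁆, ⁅x.1, y.2⁆ + ⁅x.2, y.1⁆)⟩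

@[simp] theorem fst_lie (x y : Cotangent 𝔤) : ⁅x, y⁆.1 = ⁅x.1, y.1⁆ := rfl
@[simp] theorem snd_lie (x y : Cotangent 𝔤) : ⁅x, y⁆.2 = ⁅x.1, y.2⁆ + ⁅x.2, y.1⁆ := rfl

instance : LieRing (Cotangent 𝔤) where
  add_lie x y z := by ext <;> (simp; try abel)
  lie_add x y z := by ext <;> (simp; try abel)
  lie_self x := by
    ext
    · simp
    · rw [snd_lie, ← lie_skew x.2 x.1, add_neg_cancel, snd_zero]
  leibniz_lie x y z := by
    ext
    · simp
    · simp only [fst_lie, snd_lie, snd_add, lie_add, add_lie]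
      rw [leibniz_lie x.1 y.1 z.2, leibniz_lie x.1 y.2 z.1, leibniz_lie x.2 y.1 z.1]
      abel

instance [LieAlgebra ℂ 𝔤] : LieAlgebra ℂ (Cotangent 𝔤) where
  lie_smul c x y := by ext <;> simp

variable (𝔤) [LieAlgebra ℂ 𝔤]

/-- The inclusion `a ↦ a` of `𝔤` into `𝔡`. -/
def incl : 𝔤 →ₗ[ℂ] Cotangent 𝔤 := LinearMap.inl ℂ 𝔤 𝔤

/-- The map `a ↦ ε a` from `𝔤` to `𝔡`. -/
def eps : 𝔤 →ₗ[ℂ] Cotangent 𝔤 := LinearMap.inr ℂ 𝔤 𝔤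

@[simp] theorem fst_incl (a : 𝔤) : (incl 𝔤 a).1 = a := rfl
@[simp] theorem snd_incl (a : 𝔤) : (incl 𝔤 a).2 = 0 := rfl
@[simp] theorem fst_eps (a : 𝔤) : (eps 𝔤 a).1 = 0 := rfl
@[simp] theorem snd_eps (a : 𝔤) : (eps 𝔤 a).2 = a := rfl

/-- The projection `a + ε b ↦ a` of `𝔡` onto its part of `ε`-degree `0`. -/
def degZero : Cotangent 𝔤 →ₗ[ℂ] Cotangent 𝔤 := incl 𝔤 ∘ₗ LinearMap.fst ℂ 𝔤 𝔤

/-- The projection `a + ε b ↦ ε b` of `𝔡` onto its part of `ε`-degree `2`. -/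
def degTwo : Cotangent 𝔤 →ₗ[ℂ] Cotangent 𝔤 := eps 𝔤 ∘ₗ LinearMap.snd ℂ 𝔤 𝔤

variable {𝔤}

/-- The form `κ(a₁ + ε b₁, a₂ + ε b₂) = κ₀(a₁, b₂) + κ₀(b₁, a₂)` on `𝔡`. -/
def form (κ₀ : LinearMap.BilinForm ℂ 𝔤) : LinearMap.BilinForm ℂ (Cotangent 𝔤) :=
  κ₀.compl₁₂ (LinearMap.fst ℂ 𝔤 𝔤) (LinearMap.snd ℂ 𝔤 𝔤) +
    κ₀.compl₁₂ (LinearMap.snd ℂ 𝔤 𝔤) (LinearMap.fst ℂ 𝔤 𝔤)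

theorem form_apply (κ₀ : LinearMap.BilinForm ℂ 𝔤) (x y : Cotangent 𝔤) :
    form κ₀ x y = κ₀ x.1 y.2 + κ₀ x.2 y.1 := rfl

theorem form_nondegenerate {κ₀ : LinearMap.BilinForm ℂ 𝔤} (h : κ₀.Nondegenerate) :
    (form κ₀).Nondegenerate := by
  refine ⟨fun x hx => ?_, fun y hy => ?_⟩
  · refine ext (h.1 _ fun b => ?_) (h.1 _ fun a => ?_)
    · have h := hx (eps 𝔤 b)
      simpa [form_apply] using h
    · have h := hx (incl 𝔤 a)
      simpa [form_apply] using h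
  · refine ext (h.2 _ fun b => ?_) (h.2 _ fun a => ?_)
    · have h := hy (eps 𝔤 b)
      simpa [form_apply] using h
    · have h := hy (incl 𝔤 a)
      simpa [form_apply] using h

end Cotangent

/-! ### Coefficient rings

For a `ℂ`-algebra `A`, the Lie algebra `𝔭(A) = 𝔭 ⊗ A` is `A ⊗[ℂ] 𝔭` with its bracket from Mathlib,
`⁅f ⊗ a, g ⊗ b⁆ = (f * g) ⊗ ⁅a, b⁆`. Series in several variables with coefficients in a
finite-dimensional space `V` are elements of `A ⊗[ℂ] V`. The variables `t₁, t₂, t₃` are numbered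
`0, 1, 2`. -/

/-- `ℂ[[t₁, …, tₙ]]`. -/
abbrev Ser (n : ℕ) : Type := MvPowerSeries (Fin n) ℂ

/-- The field of fractions of `ℂ[[t₁, …, tₙ]]`. -/
abbrev Fld (n : ℕ) : Type := FractionRing (Ser n)

/-- `𝒪 = ℂ[[t]]`. -/
abbrev O : Type := PowerSeries ℂ

/-- The field of Laurent series in one variable. It is used both for `𝒦 = ℂ((t))` and, with
`t⁻¹` as the variable, for `ℂ((t⁻¹))`. -/
def K : Type := LaurentSeries ℂ

instance : CommRing K := inferInstanceAs (CommRing (LaurentSeries ℂ))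

instance : Algebra ℂ K := HahnSeries.instAlgebra

/-- The coefficient of the `k`-th power of the variable. -/
def laurentCoeff (k : ℤ) : K →ₗ[ℂ] ℂ := HahnSeries.coeff.linearMap (R := ℂ) (V := ℂ) k

/-- The `k`-th power of the variable. -/
def laurentPow (k : ℤ) : K := HahnSeries.single k (1 : ℂ)

/-- The embedding `ℂ[[t]] → ℂ((t))`. -/
def powToLaurent : O →ₐ[ℂ] K := HahnSeries.ofPowerSeriesAlg ℤ ℂ

/-- The embedding `ℂ[t] → ℂ((t⁻¹))`: with `s = t⁻¹` the variable of `K`, it sends `t` to `s⁻¹`. -/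
def polyToLaurentInv : Polynomial ℂ →ₐ[ℂ] K := Polynomial.aeval (laurentPow (-1))

/-- The embedding `ℂ[t] → ℂ[[t]]`. -/
def polyToPow : Polynomial ℂ →ₐ[ℂ] O := Polynomial.coeToPowerSeries.algHom ℂ

/-- The embedding of `ℂ[[t₁, …, tₙ]]` into its field of fractions. -/
def serToFld (n : ℕ) : Ser n →ₐ[ℂ] Fld n := IsScalarTower.toAlgHom ℂ (Ser n) (Fld n)

/-- The substitution `f(t₁, …, tₘ) ↦ f(t_{e 1}, …, t_{e m})` on fractions of power series. -/
def rename {m n : ℕ} (e : Fin m ↪ Fin n) : Fld m →ₐ[ℂ] Fld n :=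
  IsFractionRing.liftAlgHom (g := (serToFld n).comp (MvPowerSeries.rename e))
    ((IsFractionRing.injective (Ser n) (Fld n)).comp (MvPowerSeries.rename_injective e))

/-- The variable `tᵢ` as an element of the field of fractions. -/
def var {n : ℕ} (i : Fin n) : Fld n := serToFld n (MvPowerSeries.X i)

/-- The injection `0 ↦ i`, `1 ↦ j`. -/
def pair {n : ℕ} (i j : Fin n) (h : i ≠ j) : Fin 2 ↪ Fin n where
  toFun := ![i, j]
  inj' := by
    intro a b hab
    fin_cases a <;> fin_cases b <;> simp_all

/-- Change of coefficients `A ⊗ V → B ⊗ V`. -/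
def coef {A B : Type*} [CommRing A] [Algebra ℂ A] [CommRing B] [Algebra ℂ B]
    (V : Type*) [AddCommGroup V] [Module ℂ V] (f : A →ₐ[ℂ] B) : A ⊗[ℂ] V →ₗ[ℂ] B ⊗[ℂ] V :=
  f.toLinearMap.rTensor V

/-- The coefficient of `t₁ᵐ t₂ⁿ` of an element of `V[[t₁, t₂]]`. -/
def coeffTwo (V : Type*) [AddCommGroup V] [Module ℂ V] (m n : ℕ) : Ser 2 ⊗[ℂ] V →ₗ[ℂ] V :=
  TensorProduct.lid ℂ V ∘ₗ
    (MvPowerSeries.coeff (R := ℂ) (Finsupp.single 0 m + Finsupp.single 1 n)).rTensor V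

/-- The coefficient of the `k`-th power of the variable of an element of `V ⊗ K`. -/
def coeffLaurent (V : Type*) [AddCommGroup V] [Module ℂ V] (k : ℤ) : K ⊗[ℂ] V →ₗ[ℂ] V :=
  TensorProduct.lid ℂ V ∘ₗ (laurentCoeff k).rTensor V

/-- The coefficient of `t₁ᵐ` of `f(t₁, t₂)`, a power series in the second variable. -/
def row (m : ℕ) : Ser 2 →ₗ[ℂ] O where
  toFun f := PowerSeries.mk fun n =>
    MvPowerSeries.coeff (Finsupp.single 0 m + Finsupp.single 1 n) f
  map_add' f g := by ext; simp
  map_smul' c f := by ext; simp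

/-- The coefficient of `t₂ⁿ` of `f(t₁, t₂)`, a power series in the first variable. -/
def col (n : ℕ) : Ser 2 →ₗ[ℂ] O where
  toFun f := PowerSeries.mk fun m =>
    MvPowerSeries.coeff (Finsupp.single 0 m + Finsupp.single 1 n) f
  map_add' f g := by ext; simp
  map_smul' c f := by ext; simp

section General

variable {𝔭 : Type*} [LieRing 𝔭] [LieAlgebra ℂ 𝔭]

/-! ### Brackets of tensors -/

/-- The bracket `𝔭 × 𝔭 → 𝔭` as a bilinear map. -/
def brack (𝔭 : Type*) [LieRing 𝔭] [LieAlgebra ℂ 𝔭] : 𝔭 →ₗ[ℂ] 𝔭 →ₗ[ℂ] 𝔭 :=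
  (LieAlgebra.ad ℂ 𝔭 : 𝔭 →ₗ[ℂ] Module.End ℂ 𝔭)

/-- `[a ⊗ 1, b ⊗ c] = [a, b] ⊗ c`. -/
def legOne (𝔭 : Type*) [LieRing 𝔭] [LieAlgebra ℂ 𝔭] : 𝔭 →ₗ[ℂ] 𝔭 ⊗[ℂ] 𝔭 →ₗ[ℂ] 𝔭 ⊗[ℂ] 𝔭 :=
  LinearMap.rTensorHom 𝔭 ∘ₗ brack 𝔭

/-- `[1 ⊗ a, b ⊗ c] = b ⊗ [a, c]`. -/
def legTwo (𝔭 : Type*) [LieRing 𝔭] [LieAlgebra ℂ 𝔭] : 𝔭 →ₗ[ℂ] 𝔭 ⊗[ℂ] 𝔭 →ₗ[ℂ] 𝔭 ⊗[ℂ] 𝔭 :=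
  LinearMap.lTensorHom 𝔭 ∘ₗ brack 𝔭

theorem legOne_apply (a b c : 𝔭) : legOne 𝔭 a (b ⊗ₜ c) = ⁅a, b⁆ ⊗ₜ c := rfl
theorem legTwo_apply (a b c : 𝔭) : legTwo 𝔭 a (b ⊗ₜ c) = b ⊗ₜ ⁅a, c⁆ := rfl

/-- `[a¹², b¹³]`. -/
def br1213 (𝔭 : Type*) [LieRing 𝔭] [LieAlgebra ℂ 𝔭] :
    𝔭 ⊗[ℂ] 𝔭 →ₗ[ℂ] 𝔭 ⊗[ℂ] 𝔭 →ₗ[ℂ] 𝔭 ⊗[ℂ] (𝔭 ⊗[ℂ] 𝔭) :=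
  TensorProduct.map₂ (brack 𝔭) (TensorProduct.mk ℂ 𝔭 𝔭)

/-- `[a¹², b²³]`. -/
def br1223 (𝔭 : Type*) [LieRing 𝔭] [LieAlgebra ℂ 𝔭] :
    𝔭 ⊗[ℂ] 𝔭 →ₗ[ℂ] 𝔭 ⊗[ℂ] 𝔭 →ₗ[ℂ] 𝔭 ⊗[ℂ] (𝔭 ⊗[ℂ] 𝔭) :=
  ((br1213 𝔭).comp (TensorProduct.comm ℂ 𝔭 𝔭).toLinearMap).compr₂
    (TensorProduct.leftComm ℂ 𝔭 𝔭 𝔭).toLinearMap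

/-- `[a¹³, b²³]`. -/
def br1323 (𝔭 : Type*) [LieRing 𝔭] [LieAlgebra ℂ 𝔭] :
    𝔭 ⊗[ℂ] 𝔭 →ₗ[ℂ] 𝔭 ⊗[ℂ] 𝔭 →ₗ[ℂ] 𝔭 ⊗[ℂ] (𝔭 ⊗[ℂ] 𝔭) :=
  ((br1213 𝔭).compl₁₂ (TensorProduct.comm ℂ 𝔭 𝔭).toLinearMap
    (TensorProduct.comm ℂ 𝔭 𝔭).toLinearMap).compr₂
    ((TensorProduct.comm ℂ 𝔭 (𝔭 ⊗[ℂ] 𝔭)).trans (TensorProduct.assoc ℂ 𝔭 𝔭 𝔭)).toLinearMap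

/-- `[a³², b¹³]`, where the first leg of `a` is in position `3` and the second in position `2`. -/
def br3213 (𝔭 : Type*) [LieRing 𝔭] [LieAlgebra ℂ 𝔭] :
    𝔭 ⊗[ℂ] 𝔭 →ₗ[ℂ] 𝔭 ⊗[ℂ] 𝔭 →ₗ[ℂ] 𝔭 ⊗[ℂ] (𝔭 ⊗[ℂ] 𝔭) :=
  ((br1213 𝔭).compl₁₂ LinearMap.id (TensorProduct.comm ℂ 𝔭 𝔭).toLinearMap).compr₂
    ((TensorProduct.comm ℂ 𝔭 (𝔭 ⊗[ℂ] 𝔭)).trans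
      ((TensorProduct.assoc ℂ 𝔭 𝔭 𝔭).trans (TensorProduct.leftComm ℂ 𝔭 𝔭 𝔭))).toLinearMap

theorem br1213_apply (a₁ a₂ b₁ b₃ : 𝔭) :
    br1213 𝔭 (a₁ ⊗ₜ a₂) (b₁ ⊗ₜ b₃) = ⁅a₁, b₁⁆ ⊗ₜ (a₂ ⊗ₜ b₃) := rfl
theorem br1223_apply (a₁ a₂ b₂ b₃ : 𝔭) :
    br1223 𝔭 (a₁ ⊗ₜ a₂) (b₂ ⊗ₜ b₃) = a₁ ⊗ₜ (⁅a₂, b₂⁆ ⊗ₜ b₃) := rfl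
theorem br1323_apply (a₁ a₃ b₂ b₃ : 𝔭) :
    br1323 𝔭 (a₁ ⊗ₜ a₃) (b₂ ⊗ₜ b₃) = a₁ ⊗ₜ (b₂ ⊗ₜ ⁅a₃, b₃⁆) := rfl
theorem br3213_apply (a₃ a₂ b₁ b₃ : 𝔭) :
    br3213 𝔭 (a₃ ⊗ₜ a₂) (b₁ ⊗ₜ b₃) = b₁ ⊗ₜ (a₂ ⊗ₜ ⁅a₃, b₃⁆) := rfl

/-- The `A`-bilinear extension `(f ⊗ x, g ⊗ y) ↦ (f * g) ⊗ B x y` of a bilinear map `B`. -/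
def ext (A : Type*) [CommRing A] [Algebra ℂ A] {X Y Z : Type*} [AddCommGroup X] [Module ℂ X]
    [AddCommGroup Y] [Module ℂ Y] [AddCommGroup Z] [Module ℂ Z] (B : X →ₗ[ℂ] Y →ₗ[ℂ] Z) :
    A ⊗[ℂ] X →ₗ[ℂ] A ⊗[ℂ] Y →ₗ[ℂ] A ⊗[ℂ] Z :=
  TensorProduct.map₂ (LinearMap.mul ℂ A) B

/-- `[x ⊗ 1 + 1 ⊗ y, s]` for `x, y ∈ 𝔭(A)` and a tensor `s ∈ A ⊗ (𝔭 ⊗ 𝔭)`. -/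
def act {A : Type*} [CommRing A] [Algebra ℂ A] (x y : A ⊗[ℂ] 𝔭) (s : A ⊗[ℂ] (𝔭 ⊗[ℂ] 𝔭)) :
    A ⊗[ℂ] (𝔭 ⊗[ℂ] 𝔭) :=
  ext A (legOne 𝔭) x s + ext A (legTwo 𝔭) y s

/-! ### Generalized `r`-matrices -/

/-- The Casimir element `∑ᵢ bᵢ ⊗ bⁱ` of a nondegenerate form, where `(bⁱ)` is the basis dual to
`(bᵢ)`; it does not depend on the basis. -/
def casimir [FiniteDimensional ℂ 𝔭] (β : LinearMap.BilinForm ℂ 𝔭) (hβ : β.Nondegenerate) :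
    𝔭 ⊗[ℂ] 𝔭 :=
  ∑ i, Module.finBasis ℂ 𝔭 i ⊗ₜ β.dualBasis hβ (Module.finBasis ℂ 𝔭) i

/-- Yang's `r`-matrix `C / (t₁ - t₂)`. -/
def yang [FiniteDimensional ℂ 𝔭] (β : LinearMap.BilinForm ℂ 𝔭) (hβ : β.Nondegenerate) :
    Fld 2 ⊗[ℂ] (𝔭 ⊗[ℂ] 𝔭) :=
  (var 0 - var 1)⁻¹ ⊗ₜ casimir β hβ

/-- The substitution `r ↦ r(tᵢ, tⱼ)`. -/
def argsAt {n : ℕ} (i j : Fin n) (h : i ≠ j) :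
    Fld 2 ⊗[ℂ] (𝔭 ⊗[ℂ] 𝔭) →ₗ[ℂ] Fld n ⊗[ℂ] (𝔭 ⊗[ℂ] 𝔭) :=
  coef (𝔭 ⊗[ℂ] 𝔭) (rename (pair i j h))

/-- `τ(r(t₂, t₁))`: both the variables and the tensor factors are exchanged. -/
def flip : Fld 2 ⊗[ℂ] (𝔭 ⊗[ℂ] 𝔭) →ₗ[ℂ] Fld 2 ⊗[ℂ] (𝔭 ⊗[ℂ] 𝔭) :=
  (TensorProduct.comm ℂ 𝔭 𝔭).toLinearMap.lTensor (Fld 2) ∘ₗ argsAt 1 0 (by decide)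

/-- The generalized classical Yang-Baxter equation. -/
def GCYBE (r : Fld 2 ⊗[ℂ] (𝔭 ⊗[ℂ] 𝔭)) : Prop :=
  ext (Fld 3) (br1213 𝔭) (argsAt 0 1 (by decide) r) (argsAt 0 2 (by decide) r) +
    ext (Fld 3) (br1223 𝔭) (argsAt 0 1 (by decide) r) (argsAt 1 2 (by decide) r) +
    ext (Fld 3) (br3213 𝔭) (argsAt 2 1 (by decide) r) (argsAt 0 2 (by decide) r) = 0

/-- The classical Yang-Baxter equation. -/
def CYBE (r : Fld 2 ⊗[ℂ] (𝔭 ⊗[ℂ] 𝔭)) : Prop :=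
  ext (Fld 3) (br1213 𝔭) (argsAt 0 1 (by decide) r) (argsAt 0 2 (by decide) r) +
    ext (Fld 3) (br1223 𝔭) (argsAt 0 1 (by decide) r) (argsAt 1 2 (by decide) r) +
    ext (Fld 3) (br1323 𝔭) (argsAt 0 2 (by decide) r) (argsAt 1 2 (by decide) r) = 0

/-- Generalized `r`-matrices with coefficients in `(𝔭, β)`: solutions of the generalized classical
Yang-Baxter equation of the form `C / (t₁ - t₂) + g` with `g ∈ (𝔭 ⊗ 𝔭)[[t₁, t₂]]`. -/
structure IsGeneralizedRMatrix [FiniteDimensional ℂ 𝔭] (β : LinearMap.BilinForm ℂ 𝔭)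
    (hβ : β.Nondegenerate) (r : Fld 2 ⊗[ℂ] (𝔭 ⊗[ℂ] 𝔭)) : Prop where
  normal_form : ∃ g : Ser 2 ⊗[ℂ] (𝔭 ⊗[ℂ] 𝔭), r = yang β hβ + coef (𝔭 ⊗[ℂ] 𝔭) (serToFld 2) g
  gcybe : GCYBE r

/-- `r`-matrices with coefficients in `(𝔭, β)`: the generalized ones that are skew-symmetric, and
hence solve the classical Yang-Baxter equation. -/
structure IsRMatrix [FiniteDimensional ℂ 𝔭] (β : LinearMap.BilinForm ℂ 𝔭)
    (hβ : β.Nondegenerate) (r : Fld 2 ⊗[ℂ] (𝔭 ⊗[ℂ] 𝔭)) : Prop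
    extends IsGeneralizedRMatrix β hβ r where
  skew : r = -flip r
  cybe : CYBE r

/-- `r` is rational: it lies in `C / (t₁ - t₂) + (𝔭 ⊗ 𝔭)[t₁, t₂]`. -/
def IsRational [FiniteDimensional ℂ 𝔭] (β : LinearMap.BilinForm ℂ 𝔭) (hβ : β.Nondegenerate)
    (r : Fld 2 ⊗[ℂ] (𝔭 ⊗[ℂ] 𝔭)) : Prop :=
  ∃ g : MvPolynomial (Fin 2) ℂ ⊗[ℂ] (𝔭 ⊗[ℂ] 𝔭), r = yang β hβ +
    coef (𝔭 ⊗[ℂ] 𝔭) ((serToFld 2).comp (MvPolynomial.coeToMvPowerSeries.algHom ℂ)) g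

/-! ### Residue forms -/

/-- The form `(f ⊗ a, g ⊗ b) ↦ res (f * g) β(a, b)` on `𝔭(A)`. -/
def resForm {A : Type*} [CommRing A] [Algebra ℂ A] (res : A →ₗ[ℂ] ℂ)
    (β : LinearMap.BilinForm ℂ 𝔭) : LinearMap.BilinForm ℂ (A ⊗[ℂ] 𝔭) :=
  (ext A β).compr₂ (res ∘ₗ (TensorProduct.rid ℂ A).toLinearMap)

theorem resForm_apply {A : Type*} [CommRing A] [Algebra ℂ A] (res : A →ₗ[ℂ] ℂ)
    (β : LinearMap.BilinForm ℂ 𝔭) (f g : A) (a b : 𝔭) :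
    resForm res β (f ⊗ₜ a) (g ⊗ₜ b) = res (f * g) * β a b := by
  simp [resForm, ext, mul_comm]

/-- The coefficient of `t⁻¹` of an element of `ℂ((t))`. -/
def res : K →ₗ[ℂ] ℂ := laurentCoeff (-1)

/-- The coefficient of `t⁻¹` of an element of `ℂ((t⁻¹))`. -/
def resInv : K →ₗ[ℂ] ℂ := laurentCoeff 1

/-- The pairing `res_{t₁ = 0} res_{t₂ = 0} (β ⊗ β)(s, w₁(t₁) ⊗ w₂(t₂))` of
`s ∈ (𝔭 ⊗ 𝔭)[[t₁, t₂]]` with `w₁ ⊗ w₂`, for `w₁, w₂ ∈ 𝔭((t))`. Only finitely many summands are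
nonzero. -/
def resTwo (β : LinearMap.BilinForm ℂ 𝔭) (s : Ser 2 ⊗[ℂ] (𝔭 ⊗[ℂ] 𝔭)) (w₁ w₂ : K ⊗[ℂ] 𝔭) : ℂ :=
  ∑ᶠ p : ℕ × ℕ, (LinearMap.BilinForm.tmul β β) (coeffTwo (𝔭 ⊗[ℂ] 𝔭) p.1 p.2 s)
    (coeffLaurent 𝔭 (-(p.1 : ℤ) - 1) w₁ ⊗ₜ coeffLaurent 𝔭 (-(p.2 : ℤ) - 1) w₂)

/-! ### Topological Lie bialgebra structures on `𝔭(𝒪)`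

The completed tensor products `𝔭(𝒪) ⊗ 𝔭(𝒪)` and `𝔭(𝒪) ⊗ 𝔭(𝒪) ⊗ 𝔭(𝒪)` are `(𝔭 ⊗ 𝔭)[[t₁, t₂]]` and
`(𝔭 ⊗ 𝔭 ⊗ 𝔭)[[t₁, t₂, t₃]]`. Elements of the latter are given by their coefficients. -/

/-- `x(tᵢ) ∈ 𝔭[[t₁, …, tₙ]]` for `x ∈ 𝔭[[t]]`. -/
def atVar {n : ℕ} (i : Fin n) : O ⊗[ℂ] 𝔭 →ₗ[ℂ] Ser n ⊗[ℂ] 𝔭 :=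
  coef 𝔭 (PowerSeries.toMvPowerSeries i)

/-- The tensor flip on the completed tensor product: `s(t₁, t₂) ↦ τ(s(t₂, t₁))`. -/
def flipSer : Ser 2 ⊗[ℂ] (𝔭 ⊗[ℂ] 𝔭) →ₗ[ℂ] Ser 2 ⊗[ℂ] (𝔭 ⊗[ℂ] 𝔭) :=
  (TensorProduct.comm ℂ 𝔭 𝔭).toLinearMap.lTensor (Ser 2) ∘ₗ
    coef (𝔭 ⊗[ℂ] 𝔭) (MvPowerSeries.rename (pair (n := 2) 1 0 (by decide)))

/-- The coefficient of `t₁ᵐ t₂ᵏ t₃ˡ` of `(1 ⊗ δ) s`: the coefficient of `t₁ᵐ` of `s` is an element of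
`𝔭 ⊗ 𝔭(𝒪)`, to which `1 ⊗ δ` is applied. -/
def oneTensor (δ : O ⊗[ℂ] 𝔭 →ₗ[ℂ] Ser 2 ⊗[ℂ] (𝔭 ⊗[ℂ] 𝔭)) (m k l : ℕ) :
    Ser 2 ⊗[ℂ] (𝔭 ⊗[ℂ] 𝔭) →ₗ[ℂ] 𝔭 ⊗[ℂ] (𝔭 ⊗[ℂ] 𝔭) :=
  (coeffTwo (𝔭 ⊗[ℂ] 𝔭) k l ∘ₗ δ).lTensor 𝔭 ∘ₗ
    (TensorProduct.leftComm ℂ O 𝔭 𝔭).toLinearMap ∘ₗ (row m).rTensor (𝔭 ⊗[ℂ] 𝔭)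

/-- The coefficient of `t₁ᵐ t₂ᵏ t₃ˡ` of `(δ ⊗ 1) s`: the coefficient of `t₂ˡ` of `s` is an element of
`𝔭(𝒪) ⊗ 𝔭`, to which `δ ⊗ 1` is applied. -/
def tensorOne (δ : O ⊗[ℂ] 𝔭 →ₗ[ℂ] Ser 2 ⊗[ℂ] (𝔭 ⊗[ℂ] 𝔭)) (m k l : ℕ) :
    Ser 2 ⊗[ℂ] (𝔭 ⊗[ℂ] 𝔭) →ₗ[ℂ] 𝔭 ⊗[ℂ] (𝔭 ⊗[ℂ] 𝔭) :=
  (TensorProduct.assoc ℂ 𝔭 𝔭 𝔭).toLinearMap ∘ₗ (coeffTwo (𝔭 ⊗[ℂ] 𝔭) m k ∘ₗ δ).rTensor 𝔭 ∘ₗ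
    (TensorProduct.assoc ℂ O 𝔭 𝔭).symm.toLinearMap ∘ₗ (col l).rTensor (𝔭 ⊗[ℂ] 𝔭)

/-- Topological Lie bialgebra structures on `𝔭(𝒪)`. -/
structure IsTopLieBialgebra (δ : O ⊗[ℂ] 𝔭 →ₗ[ℂ] Ser 2 ⊗[ℂ] (𝔭 ⊗[ℂ] 𝔭)) : Prop where
  skew : ∀ x, flipSer (δ x) = -δ x
  cocycle : ∀ x y, δ ⁅x, y⁆ =
    act (atVar 0 x) (atVar 1 x) (δ y) - act (atVar 0 y) (atVar 1 y) (δ x)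
  /-- `(δ ⊗ 1) δ - (1 ⊗ δ) δ + (τ ⊗ 1) (1 ⊗ δ) δ = 0`, coefficient by coefficient. -/
  coJacobi : ∀ x m k l, tensorOne δ m k l (δ x) - oneTensor δ m k l (δ x) +
    TensorProduct.leftComm ℂ 𝔭 𝔭 𝔭 (oneTensor δ k m l (δ x)) = 0

/-! ### Lie bialgebra structures -/

/-- Lie bialgebra structures on a Lie algebra `L`. -/
structure IsLieBialgebra {L : Type*} [LieRing L] [LieAlgebra ℂ L] (δ : L →ₗ[ℂ] L ⊗[ℂ] L) :
    Prop where
  skew : ∀ x, TensorProduct.comm ℂ L L (δ x) = -δ x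
  cocycle : ∀ x y, δ ⁅x, y⁆ =
    legOne L x (δ y) + legTwo L x (δ y) - (legOne L y (δ x) + legTwo L y (δ x))
  coJacobi : ∀ x, TensorProduct.assoc ℂ L L L (δ.rTensor L (δ x)) - δ.lTensor L (δ x) +
    TensorProduct.leftComm ℂ L L L (δ.lTensor L (δ x)) = 0

end General

/-! ### Graded structures with prescribed double -/

variable {𝔤 : Type*} [LieRing 𝔤] [LieAlgebra ℂ 𝔤]

/-- `V` is an `ε`-graded Lagrangian Lie subalgebra of `𝔡(A)`, with respect to the form
`res κ(·, ·)`, that is complementary to `P`. -/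
structure IsGradedLagrangianComplement {A : Type*} [CommRing A] [Algebra ℂ A] (res : A →ₗ[ℂ] ℂ)
    (κ₀ : LinearMap.BilinForm ℂ 𝔤) (P V : Submodule ℂ (A ⊗[ℂ] Cotangent 𝔤)) : Prop where
  lie_mem : ∀ v ∈ V, ∀ w ∈ V, ⁅v, w⁆ ∈ V
  lagrangian : ∀ v, v ∈ V ↔ ∀ w ∈ V, resForm res (Cotangent.form κ₀) v w = 0
  isCompl : IsCompl P V
  graded : ∀ v ∈ V, (Cotangent.degZero 𝔤).lTensor A v ∈ V ∧ (Cotangent.degTwo 𝔤).lTensor A v ∈ V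

/-- `ε`-graded topological Lie bialgebra structures on `𝔡(𝒪)` with topological double `𝔡(𝒦)`: there
is a Manin triple `𝔡(𝒦) = 𝔡(𝒪) ⊕ V` with `V` an `ε`-graded subalgebra such that `δ` is dual to the
bracket of `V`. -/
structure IsGradedTopLieBialgebra (κ₀ : LinearMap.BilinForm ℂ 𝔤)
    (δ : O ⊗[ℂ] Cotangent 𝔤 →ₗ[ℂ] Ser 2 ⊗[ℂ] (Cotangent 𝔤 ⊗[ℂ] Cotangent 𝔤)) : Prop
    extends IsTopLieBialgebra δ where
  double : ∃ V : Submodule ℂ (K ⊗[ℂ] Cotangent 𝔤),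
    IsGradedLagrangianComplement res κ₀ (LinearMap.range (coef (Cotangent 𝔤) powToLaurent)) V ∧
    ∀ x, ∀ w₁ ∈ V, ∀ w₂ ∈ V, resTwo (Cotangent.form κ₀) (δ x) w₁ w₂ =
      resForm res (Cotangent.form κ₀) (coef (Cotangent 𝔤) powToLaurent x) ⁅w₁, w₂⁆

/-- `ε`-graded Lie bialgebra structures on `𝔡[t]` with double `𝔡((t⁻¹))`: there is a Manin triple
`𝔡((t⁻¹)) = 𝔡[t] ⊕ V` with `V` an `ε`-graded subalgebra such that `δ` is dual to the bracket
of `V`. -/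
structure IsGradedPolyLieBialgebra (κ₀ : LinearMap.BilinForm ℂ 𝔤)
    (δ : Polynomial ℂ ⊗[ℂ] Cotangent 𝔤 →ₗ[ℂ]
      (Polynomial ℂ ⊗[ℂ] Cotangent 𝔤) ⊗[ℂ] (Polynomial ℂ ⊗[ℂ] Cotangent 𝔤)) : Prop
    extends IsLieBialgebra δ where
  double : ∃ V : Submodule ℂ (K ⊗[ℂ] Cotangent 𝔤),
    IsGradedLagrangianComplement resInv κ₀
      (LinearMap.range (coef (Cotangent 𝔤) polyToLaurentInv)) V ∧
    ∀ x, ∀ w₁ ∈ V, ∀ w₂ ∈ V,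
      (LinearMap.BilinForm.tmul (resForm resInv (Cotangent.form κ₀))
        (resForm resInv (Cotangent.form κ₀)))
        (TensorProduct.map (coef (Cotangent 𝔤) polyToLaurentInv)
          (coef (Cotangent 𝔤) polyToLaurentInv) (δ x)) (w₁ ⊗ₜ w₂) =
      resForm resInv (Cotangent.form κ₀) (coef (Cotangent 𝔤) polyToLaurentInv x) ⁅w₁, w₂⁆

/-- The inclusion of the algebraic tensor product `𝔭[t] ⊗ 𝔭[t]` into `(𝔭 ⊗ 𝔭)[[t₁, t₂]]`,
`(f ⊗ a) ⊗ (g ⊗ b) ↦ f(t₁) g(t₂) ⊗ (a ⊗ b)`. -/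
def polyTensorToSer (𝔭 : Type*) [LieRing 𝔭] [LieAlgebra ℂ 𝔭] :
    (Polynomial ℂ ⊗[ℂ] 𝔭) ⊗[ℂ] (Polynomial ℂ ⊗[ℂ] 𝔭) →ₗ[ℂ] Ser 2 ⊗[ℂ] (𝔭 ⊗[ℂ] 𝔭) :=
  (LinearMap.mul' ℂ (Ser 2) ∘ₗ
    TensorProduct.map ((PowerSeries.toMvPowerSeries 0).comp polyToPow).toLinearMap
      ((PowerSeries.toMvPowerSeries 1).comp polyToPow).toLinearMap).rTensor (𝔭 ⊗[ℂ] 𝔭) ∘ₗ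
  (TensorProduct.tensorTensorTensorComm ℂ (Polynomial ℂ) 𝔭 (Polynomial ℂ) 𝔭).toLinearMap

/-- `ρ = (1 ⊗ ε) r(t₁, t₂) - (ε ⊗ 1) τ(r(t₂, t₁))`. -/
def rho (r : Fld 2 ⊗[ℂ] (𝔤 ⊗[ℂ] 𝔤)) : Fld 2 ⊗[ℂ] (Cotangent 𝔤 ⊗[ℂ] Cotangent 𝔤) :=
  (TensorProduct.map (Cotangent.incl 𝔤) (Cotangent.eps 𝔤)).lTensor (Fld 2) r -
    (TensorProduct.map (Cotangent.eps 𝔤) (Cotangent.incl 𝔤)).lTensor (Fld 2) (flip r)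

end LoopBialgebra

end

/-! Everything rests on reading tensors as operators. A form β turns x ⊗ y into the operator a ↦
β(y, a) x (`op`). The Casimir element becomes the identity, and a power series g becomes an array of
operators G m k (`opCoeff`). This array defines the basic Laurent series u(m, a) = t^(-m-1) a + ∑ tⁱ
G i m a (`IsBasic`). If G is skew, the basic series are pairwise orthogonal for the residue form,
and their orthogonal complement `lagr` is a Lagrangian complement of the series without negative
powers (`isCompl_posPart_lagr`, `mem_lagr_iff`). Conversely, projecting the monomials t^(-m-1) a
onto a Lagrangian complement recovers such an array (`exists_eq_lagr`).

The Yang-Baxter equation enters through `resForm_lie_isBasic`: the residue pairing of [u(j, a), u(l,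
b)] with u(i, c) is the pairing of c with a coefficient of the generalized equation for C / (t₁ -
t₂) + g (`gcybe_yang_add_iff`). Hence `lagr` is a subalgebra exactly when the equation holds.

A generalized r-matrix in 𝔤 need not be skew, and passing to 𝔡 repairs this. The array of ρ is that
of r on 𝔤 and minus its adjoint on ε𝔤, and every skew array on 𝔡 that preserves the ε-degree has
this shape (`exists_opCoeff_rhoSer_eq`). The pairing of three basic series is cyclic, so the
equation for ρ follows from its component of degree 0, which is the equation for r
(`yangBaxterCoeff_eq_zero_of_incl`).

The cobracket is regular because C is invariant. It is a cocycle because it is a coboundary over the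
fraction field, and it is dual to the bracket of `lagr` (`tmul_coeffTwo_cobracket`), so skewness and
co-Jacobi are dual to antisymmetry and Jacobi. Duality also determines δ from the complement, which
gives surjectivity. Injectivity uses that 𝔤 has trivial center (`eq_of_cobracket_eq`).

For 𝔡[t] the same argument runs with t⁻¹ as variable. Series may now have infinitely many negative
powers of t, so the array must be finitely supported, that is, g must be a polynomial. For a
Lagrangian complement this is automatic, by a Baire category argument (`exists_finite_support`). -/

noncomputable section

namespace LoopBialgebra

open Finset.HasAntidiagonal (antidiagonal mem_antidiagonal)

/-! ### Tensors over a space of series, coefficient by coefficient -/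

section Coefficients

variable {A V : Type*} [AddCommGroup A] [Module ℂ A] [AddCommGroup V] [Module ℂ V]

/-- The extension `f ⊗ v ↦ c f • v` of a functional `c`. -/
def evalCoef (V : Type*) [AddCommGroup V] [Module ℂ V] (c : A →ₗ[ℂ] ℂ) : A ⊗[ℂ] V →ₗ[ℂ] V :=
  TensorProduct.lid ℂ V ∘ₗ c.rTensor V

theorem evalCoef_tmul (c : A →ₗ[ℂ] ℂ) (f : A) (v : V) : evalCoef V c (f ⊗ₜ v) = c f • v := by
  simp [evalCoef]

theorem evalCoef_sum_basis {ι : Type*} [Fintype ι] (b : Module.Basis ι ℂ V)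
    (c : A →ₗ[ℂ] ℂ) (f : ι → A) : evalCoef V c (∑ j, f j ⊗ₜ b j) = ∑ j, c (f j) • b j := by
  simp [evalCoef_tmul]

theorem exists_sum_tmul_basis {ι : Type*} [Fintype ι] (b : Module.Basis ι ℂ V) (x : A ⊗[ℂ] V) :
    ∃ f : ι → A, x = ∑ j, f j ⊗ₜ b j := by
  induction x with
  | zero => exact ⟨0, by simp⟩
  | tmul f v =>
    refine ⟨fun j => b.repr v j • f, ?_⟩
    conv_lhs => rw [← b.sum_repr v, TensorProduct.tmul_sum]
    simp [TensorProduct.smul_tmul]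
  | add x y hx hy =>
    obtain ⟨f, rfl⟩ := hx
    obtain ⟨g, rfl⟩ := hy
    exact ⟨f + g, by simp [TensorProduct.add_tmul, Finset.sum_add_distrib]⟩

/-- Elements of `A ⊗ V` are determined by coefficients if elements of `A` are. -/
theorem ext_of_evalCoef [FiniteDimensional ℂ V] {I : Type*} {c : I → A →ₗ[ℂ] ℂ}
    (hc : ∀ f g, (∀ i, c i f = c i g) → f = g) {x y : A ⊗[ℂ] V}
    (h : ∀ i, evalCoef V (c i) x = evalCoef V (c i) y) : x = y := by
  obtain ⟨f, rfl⟩ := exists_sum_tmul_basis (Module.finBasis ℂ V) x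
  obtain ⟨g, rfl⟩ := exists_sum_tmul_basis (Module.finBasis ℂ V) y
  have : f = g := by
    funext j
    refine hc _ _ fun i => ?_
    have := h i
    rw [evalCoef_sum_basis, evalCoef_sum_basis] at this
    simpa [map_sum, Finsupp.single_apply] using
      DFunLike.congr_fun (congrArg (Module.finBasis ℂ V).repr this) j
  rw [this]

/-- A family of vectors is the family of coefficients of an element of `A ⊗ V` if its coordinates
are coefficients of elements of `A`. -/
theorem exists_evalCoef [FiniteDimensional ℂ V] {I : Type*} (c : I → A →ₗ[ℂ] ℂ) (F : I → V)
    (h : ∀ φ : V →ₗ[ℂ] ℂ, ∃ f, ∀ i, c i f = φ (F i)) :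
    ∃ x : A ⊗[ℂ] V, ∀ i, evalCoef V (c i) x = F i := by
  choose f hf using fun j => h ((Module.finBasis ℂ V).coord j)
  refine ⟨∑ j, f j ⊗ₜ Module.finBasis ℂ V j, fun i => ?_⟩
  rw [evalCoef_sum_basis]
  simp_rw [hf]
  exact (Module.finBasis ℂ V).sum_repr _

theorem evalCoef_rTensor {B : Type*} [AddCommGroup B] [Module ℂ B] (c : B →ₗ[ℂ] ℂ)
    (f : A →ₗ[ℂ] B) (x : A ⊗[ℂ] V) : evalCoef V c (f.rTensor V x) = evalCoef V (c ∘ₗ f) x := by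
  simp [evalCoef, LinearMap.rTensor_comp]

theorem evalCoef_lTensor {W : Type*} [AddCommGroup W] [Module ℂ W] (c : A →ₗ[ℂ] ℂ)
    (f : V →ₗ[ℂ] W) (x : A ⊗[ℂ] V) : evalCoef W c (f.lTensor A x) = f (evalCoef V c x) := by
  induction x with
  | zero => simp
  | tmul a v => simp [evalCoef_tmul]
  | add x y hx hy => simp [hx, hy]

theorem coeffTwo_eq (m n : ℕ) : coeffTwo V m n =
    evalCoef V (MvPowerSeries.coeff (R := ℂ) (Finsupp.single 0 m + Finsupp.single 1 n)) := rfl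

theorem coeffLaurent_eq (k : ℤ) : coeffLaurent V k = evalCoef V (laurentCoeff k) := rfl

end Coefficients

/-! ### Bilinear maps under extension and change of coefficients. -/

section Extension

variable {A B X Y Z : Type*} [CommRing A] [Algebra ℂ A] [CommRing B] [Algebra ℂ B]
  [AddCommGroup X] [Module ℂ X] [AddCommGroup Y] [Module ℂ Y] [AddCommGroup Z] [Module ℂ Z]

theorem ext_tmul (β : X →ₗ[ℂ] Y →ₗ[ℂ] Z) (f g : A) (x : X) (y : Y) :
    ext A β (f ⊗ₜ x) (g ⊗ₜ y) = (f * g) ⊗ₜ β x y := rfl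

theorem lie_eq_ext {𝔭 : Type*} [LieRing 𝔭] [LieAlgebra ℂ 𝔭] (x y : A ⊗[ℂ] 𝔭) :
    ⁅x, y⁆ = ext A (brack 𝔭) x y := by
  induction x with
  | zero => simp
  | tmul f a =>
    induction y with
    | zero => simp
    | tmul g b => rfl
    | add x y hx hy => rw [lie_add, hx, hy, map_add]
  | add x y hx hy => rw [add_lie, hx, hy, map_add, LinearMap.add_apply]

theorem coef_tmul (φ : A →ₐ[ℂ] B) (f : A) (x : X) : coef X φ (f ⊗ₜ x) = φ f ⊗ₜ x := rfl

theorem coef_ext (φ : A →ₐ[ℂ] B) (β : X →ₗ[ℂ] Y →ₗ[ℂ] Z) (x : A ⊗[ℂ] X) (y : A ⊗[ℂ] Y) :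
    coef Z φ (ext A β x y) = ext B β (coef X φ x) (coef Y φ y) := by
  induction x with
  | zero => simp
  | tmul f a =>
    induction y with
    | zero => simp
    | tmul g b => simp [ext_tmul, coef_tmul]
    | add x y hx hy => simp only [map_add, hx, hy]
  | add x y hx hy => simp only [map_add, LinearMap.add_apply, hx, hy]

theorem coef_comp {C : Type*} [CommRing C] [Algebra ℂ C] (φ : A →ₐ[ℂ] B) (ψ : B →ₐ[ℂ] C)
    (x : A ⊗[ℂ] X) : coef X ψ (coef X φ x) = coef X (ψ.comp φ) x := by
  simp [coef, LinearMap.rTensor_comp]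

theorem coef_injective {φ : A →ₐ[ℂ] B} (hφ : Function.Injective φ) :
    Function.Injective (coef X φ) :=
  Module.Flat.rTensor_preserves_injective_linearMap φ.toLinearMap hφ

theorem coef_smul (φ : A →ₐ[ℂ] B) (f : A) (x : A ⊗[ℂ] X) :
    coef X φ (f • x) = φ f • coef X φ x := by
  induction x with
  | zero => simp
  | tmul g a => simp [coef_tmul, TensorProduct.smul_tmul']
  | add x y hx hy => simp only [map_add, smul_add, hx, hy]

theorem lTensor_coef (φ : A →ₐ[ℂ] B) (f : X →ₗ[ℂ] Y) (x : A ⊗[ℂ] X) :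
    f.lTensor B (coef X φ x) = coef Y φ (f.lTensor A x) := by
  induction x with
  | zero => simp
  | tmul g a => simp [coef_tmul]
  | add x y hx hy => simp only [map_add, hx, hy]

theorem lTensor_smul_eq (f : X →ₗ[ℂ] Y) (c : A) (x : A ⊗[ℂ] X) :
    f.lTensor A (c • x) = c • f.lTensor A x := by
  induction x with
  | zero => simp
  | tmul g a => simp [TensorProduct.smul_tmul']
  | add x y hx hy => simp only [map_add, smul_add, hx, hy]

theorem ext_tmul_left (β : X →ₗ[ℂ] Y →ₗ[ℂ] Z) (f : A) (x : X) (y : A ⊗[ℂ] Y) :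
    ext A β (f ⊗ₜ x) y = f • (β x).lTensor A y := by
  induction y with
  | zero => simp
  | tmul g b => simp [ext_tmul, TensorProduct.smul_tmul']
  | add x y hx hy => simp only [map_add, smul_add, hx, hy]

theorem ext_tmul_right (β : X →ₗ[ℂ] Y →ₗ[ℂ] Z) (f : A) (x : A ⊗[ℂ] X) (y : Y) :
    ext A β x (f ⊗ₜ y) = f • (β.flip y).lTensor A x := by
  induction x with
  | zero => simp
  | tmul g b => simp [ext_tmul, TensorProduct.smul_tmul', mul_comm]
  | add x y hx hy => simp only [map_add, smul_add, LinearMap.add_apply, hx, hy]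

/-- Coefficients of `ext` for convolution products of coefficients. -/
theorem evalCoef_ext {I : Type*} (β : X →ₗ[ℂ] Y →ₗ[ℂ] Z) (c : A →ₗ[ℂ] ℂ) (S : Finset I)
    (c₁ c₂ : I → A →ₗ[ℂ] ℂ) (h : ∀ f g, c (f * g) = ∑ i ∈ S, c₁ i f * c₂ i g)
    (x : A ⊗[ℂ] X) (y : A ⊗[ℂ] Y) :
    evalCoef Z c (ext A β x y) = ∑ i ∈ S, β (evalCoef X (c₁ i) x) (evalCoef Y (c₂ i) y) := by
  induction x with
  | zero => simp
  | tmul f a =>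
    induction y with
    | zero => simp
    | tmul g b =>
      simp only [ext_tmul, evalCoef_tmul, h, Finset.sum_smul, map_smul, LinearMap.smul_apply,
        smul_smul]
      simp [mul_comm]
    | add x y hx hy => simp only [map_add, hx, hy, Finset.sum_add_distrib]
  | add x y hx hy => simp only [map_add, LinearMap.add_apply, hx, hy, Finset.sum_add_distrib]

end Extension

/-! ### Tensors as operators -/

section Operators

variable {𝔭 : Type*} [LieRing 𝔭] [LieAlgebra ℂ 𝔭]

/-- The operator `a ↦ β(y, a) x` attached to the tensor `x ⊗ y`. -/
def op (β : LinearMap.BilinForm ℂ 𝔭) : 𝔭 ⊗[ℂ] 𝔭 →ₗ[ℂ] Module.End ℂ 𝔭 :=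
  TensorProduct.lift (((LinearMap.smulRightₗ (R := ℂ) (M := 𝔭) (M₂ := 𝔭)).flip).compl₂ β)

@[simp] theorem op_tmul (β : LinearMap.BilinForm ℂ 𝔭) (x y a : 𝔭) :
    op β (x ⊗ₜ y) a = β y a • x := rfl

variable {β : LinearMap.BilinForm ℂ 𝔭}

theorem op_rTensor (T : Module.End ℂ 𝔭) (s : 𝔭 ⊗[ℂ] 𝔭) : op β (T.rTensor 𝔭 s) = T ∘ₗ op β s := by
  induction s with
  | zero => simp
  | tmul x y => ext a; simp
  | add x y hx hy => simp only [map_add, hx, hy, LinearMap.comp_add]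

/-- Exchanging the tensor factors passes to the adjoint operator. This is how skew-symmetry of a
series becomes skewness of its array of operators. -/
theorem form_op_comm (hs : β.IsSymm) (s : 𝔭 ⊗[ℂ] 𝔭) (a b : 𝔭) :
    β (op β (TensorProduct.comm ℂ 𝔭 𝔭 s) a) b = β a (op β s b) := by
  induction s with
  | zero => simp
  | tmul x y => simp [hs.eq x a, mul_comm]
  | add x y hx hy => simp only [map_add, LinearMap.add_apply, hx, hy]

theorem form_ext_left (hβ : β.Nondegenerate) {x y : 𝔭} (h : ∀ b, β x b = β y b) : x = y := by
  rw [← sub_eq_zero]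
  exact hβ.1 _ fun b => by simp [h]

theorem tmul_tmul (s : 𝔭 ⊗[ℂ] 𝔭) (a b : 𝔭) :
    LinearMap.BilinForm.tmul β β s (a ⊗ₜ b) = β (op β s b) a := by
  induction s with
  | zero => simp
  | tmul x y => simp [LinearMap.BilinForm.tmul]
  | add x y hx hy => simp only [map_add, LinearMap.add_apply, hx, hy]

/-- The contraction `x ⊗ y ⊗ z ↦ β(y, a) β(z, b) x`. -/
def contract (β : LinearMap.BilinForm ℂ 𝔭) (a b : 𝔭) : 𝔭 ⊗[ℂ] (𝔭 ⊗[ℂ] 𝔭) →ₗ[ℂ] 𝔭 :=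
  TensorProduct.rid ℂ 𝔭 ∘ₗ (LinearMap.mul' ℂ ℂ ∘ₗ
    TensorProduct.map (β.flip a) (β.flip b)).lTensor 𝔭

@[simp] theorem contract_tmul (a b x y z : 𝔭) :
    contract β a b (x ⊗ₜ (y ⊗ₜ z)) = (β y a * β z b) • x := by
  simp [contract]

theorem contract_br1213 (s t : 𝔭 ⊗[ℂ] 𝔭) (a b : 𝔭) :
    contract β a b (br1213 𝔭 s t) = ⁅op β s a, op β t b⁆ := by
  induction s with
  | zero => simp
  | tmul x y =>
    induction t with
    | zero => simp
    | tmul z w => simp [br1213_apply, smul_smul, mul_comm]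
    | add x y hx hy => simp only [map_add, LinearMap.add_apply, lie_add, hx, hy]
  | add x y hx hy => simp only [map_add, LinearMap.add_apply, add_lie, hx, hy]

/-- Invariance of a form, with the bracket moved across the comma. -/
theorem form_lie_assoc (hi : β.lieInvariant 𝔭) (x y z : 𝔭) : β ⁅x, y⁆ z = β x ⁅y, z⁆ := by
  rw [← lie_skew, map_neg, LinearMap.neg_apply, hi, neg_neg]

/-- The bracket sits in the leg that is contracted with `a`; invariance moves it onto `a`, after
which both tensors act as operators. -/
theorem contract_br1223 (hi : β.lieInvariant 𝔭) (s t : 𝔭 ⊗[ℂ] 𝔭) (a b : 𝔭) :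
    contract β a b (br1223 𝔭 s t) = op β s ⁅op β t b, a⁆ := by
  induction s with
  | zero => simp
  | tmul x y =>
    induction t with
    | zero => simp
    | tmul z w =>
      simp [br1223_apply, form_lie_assoc hi, smul_smul, mul_comm]
    | add x y hx hy => simp only [map_add, LinearMap.add_apply, add_lie, hx, hy]
  | add x y hx hy => simp only [map_add, LinearMap.add_apply, hx, hy]

theorem contract_br3213 (hi : β.lieInvariant 𝔭) (s t : 𝔭 ⊗[ℂ] 𝔭) (a b : 𝔭) :
    contract β a b (br3213 𝔭 s t) = op β t ⁅b, op β s a⁆ := by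
  induction s with
  | zero => simp
  | tmul x y =>
    induction t with
    | zero => simp
    | tmul z w =>
      have : β w ⁅b, x⁆ = β ⁅x, w⁆ b := by
        rw [hi, ← lie_skew x b, map_neg, neg_neg]
      simp [br3213_apply, this, smul_smul]
    | add x y hx hy => simp only [map_add, LinearMap.add_apply, hx, hy]
  | add x y hx hy => simp only [map_add, LinearMap.add_apply, lie_add, hx, hy]

theorem op_legOne (x : 𝔭) (s : 𝔭 ⊗[ℂ] 𝔭) (b : 𝔭) : op β (legOne 𝔭 x s) b = ⁅x, op β s b⁆ := by
  induction s with
  | zero => simp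
  | tmul y z => simp [legOne_apply]
  | add x y hx hy => simp only [map_add, LinearMap.add_apply, lie_add, hx, hy]

theorem op_legTwo (hi : β.lieInvariant 𝔭) (x : 𝔭) (s : 𝔭 ⊗[ℂ] 𝔭) (b : 𝔭) :
    op β (legTwo 𝔭 x s) b = op β s ⁅b, x⁆ := by
  induction s with
  | zero => simp
  | tmul y z =>
    simp only [legTwo_apply, op_tmul]
    rw [hi, ← lie_skew, map_neg, neg_neg]
  | add x y hx hy => simp only [map_add, LinearMap.add_apply, hx, hy]

variable [FiniteDimensional ℂ 𝔭] (hβ : β.Nondegenerate)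

/-- The dual basis reads off coordinates, so this is the expansion of a vector in a basis. It makes
the pole of an r-matrix act by bare brackets. -/
theorem op_casimir : op β (casimir β hβ) = LinearMap.id := by
  refine (Module.finBasis ℂ 𝔭).ext fun j => ?_
  simp only [casimir, map_sum, LinearMap.sum_apply, op_tmul,
    LinearMap.BilinForm.apply_dualBasis_left]
  simp

-- With second legs expanded in the dual basis, evaluation at the `j`-th basis vector isolates the
-- `j`-th first leg.
include hβ in
theorem op_injective : Function.Injective (op β) := by
  rw [← LinearMap.ker_eq_bot, LinearMap.ker_eq_bot']
  intro s hs
  obtain ⟨f, rfl⟩ := exists_sum_tmul_basis (β.dualBasis hβ (Module.finBasis ℂ 𝔭)) s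
  refine Finset.sum_eq_zero fun j _ => ?_
  have := LinearMap.congr_fun hs (Module.finBasis ℂ 𝔭 j)
  simp only [map_sum, LinearMap.sum_apply, op_tmul, LinearMap.BilinForm.apply_dualBasis_left] at this
  simp at this
  simp [this]

theorem op_rTensor_casimir (T : Module.End ℂ 𝔭) : op β (T.rTensor 𝔭 (casimir β hβ)) = T := by
  rw [op_rTensor, op_casimir, LinearMap.comp_id]

theorem comm_casimir (hs : β.IsSymm) :
    TensorProduct.comm ℂ 𝔭 𝔭 (casimir β hβ) = casimir β hβ := by
  refine op_injective hβ (LinearMap.ext fun a => form_ext_left hβ fun b => ?_)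
  rw [form_op_comm hs, op_casimir]
  rfl

include hβ in
theorem eq_of_contract {s t : 𝔭 ⊗[ℂ] (𝔭 ⊗[ℂ] 𝔭)} (h : ∀ a b, contract β a b s = contract β a b t) :
    s = t := by
  classical
  rw [← sub_eq_zero]
  replace h : ∀ a b, contract β a b (s - t) = 0 := fun a b => by rw [map_sub, h, sub_self]
  generalize s - t = s at h
  set d := β.dualBasis hβ (Module.finBasis ℂ 𝔭)
  obtain ⟨f, rfl⟩ := exists_sum_tmul_basis (d.tensorProduct d) s
  refine Finset.sum_eq_zero fun j _ => ?_
  have := h (Module.finBasis ℂ 𝔭 j.1) (Module.finBasis ℂ 𝔭 j.2)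
  simp only [map_sum, Module.Basis.tensorProduct_apply', contract_tmul, d,
    LinearMap.BilinForm.apply_dualBasis_left] at this
  rw [Finset.sum_eq_single j] at this
  · simp at this
    simp [this]
  · intro k _ hk
    by_cases h1 : j.1 = k.1
    · have h2 : j.2 ≠ k.2 := fun h2 => hk (Prod.ext h1.symm h2.symm)
      simp [h2]
    · simp [h1]
  · simp

/-- Invariance of the Casimir element: as operators, both sides are b ↦ [b, x]. This is why the
cobracket has no pole. -/
theorem legTwo_casimir (hi : β.lieInvariant 𝔭) (x : 𝔭) :
    legTwo 𝔭 x (casimir β hβ) = -legOne 𝔭 x (casimir β hβ) := by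
  refine op_injective hβ (LinearMap.ext fun b => ?_)
  rw [op_legTwo hi, map_neg, LinearMap.neg_apply, op_legOne, op_casimir]
  simp

end Operators

/-! ### The generalized classical Yang-Baxter equation in coefficients -/

section Series

variable {V : Type*} [AddCommGroup V] [Module ℂ V]

/-- The coefficient of a monomial of an element of `V[[t₁, …, tₙ]]`. -/
def serCoeff (V : Type*) [AddCommGroup V] [Module ℂ V] {n : ℕ} (d : Fin n →₀ ℕ) :
    Ser n ⊗[ℂ] V →ₗ[ℂ] V := evalCoef V (MvPowerSeries.coeff (R := ℂ) d)

theorem ext_serCoeff [FiniteDimensional ℂ V] {n : ℕ} {x y : Ser n ⊗[ℂ] V}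
    (h : ∀ d, serCoeff V d x = serCoeff V d y) : x = y :=
  ext_of_evalCoef (c := fun d => MvPowerSeries.coeff (R := ℂ) d)
    (fun _ _ h => MvPowerSeries.ext h) h

theorem serCoeff_coeffTwo (d : Fin 2 →₀ ℕ) : serCoeff V d = coeffTwo V (d 0) (d 1) := by
  rw [coeffTwo_eq, serCoeff]
  congr 2
  ext i
  fin_cases i <;> simp

theorem ext_coeffTwo [FiniteDimensional ℂ V] {x y : Ser 2 ⊗[ℂ] V}
    (h : ∀ m k, coeffTwo V m k x = coeffTwo V m k y) : x = y :=
  ext_serCoeff fun d => by rw [serCoeff_coeffTwo, h]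

theorem exists_coeffTwo [FiniteDimensional ℂ V] (F : ℕ → ℕ → V) :
    ∃ x : Ser 2 ⊗[ℂ] V, ∀ m k, coeffTwo V m k x = F m k := by
  obtain ⟨x, hx⟩ := exists_evalCoef (A := Ser 2) (fun d => MvPowerSeries.coeff (R := ℂ) d)
    (fun d => F (d 0) (d 1)) fun φ => ⟨fun d => φ (F (d 0) (d 1)), fun d => rfl⟩
  refine ⟨x, fun m k => ?_⟩
  rw [coeffTwo_eq, hx]
  simp

theorem serCoeff_ext {n : ℕ} {X Y Z : Type*} [AddCommGroup X] [Module ℂ X] [AddCommGroup Y]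
    [Module ℂ Y] [AddCommGroup Z] [Module ℂ Z] (B : X →ₗ[ℂ] Y →ₗ[ℂ] Z) (d : Fin n →₀ ℕ)
    (x : Ser n ⊗[ℂ] X) (y : Ser n ⊗[ℂ] Y) :
    serCoeff Z d (ext (Ser n) B x y) =
      ∑ u ∈ antidiagonal d, B (serCoeff X u.1 x) (serCoeff Y u.2 y) := by
  unfold serCoeff
  exact evalCoef_ext (A := Ser n) B (MvPowerSeries.coeff d) (antidiagonal d)
    (fun u => MvPowerSeries.coeff u.1) (fun u => MvPowerSeries.coeff u.2)
    (fun f g => MvPowerSeries.coeff_mul d f g) x y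

/-- `r ↦ r(tᵢ, tⱼ)` on power series. -/
def argsSer {n : ℕ} (i j : Fin n) (h : i ≠ j) : Ser 2 ⊗[ℂ] V →ₗ[ℂ] Ser n ⊗[ℂ] V :=
  coef V (MvPowerSeries.rename (pair i j h))

theorem pair_zero {n : ℕ} {i j : Fin n} (h : i ≠ j) : pair i j h 0 = i := rfl

theorem pair_one {n : ℕ} {i j : Fin n} (h : i ≠ j) : pair i j h 1 = j := rfl

/-- The index `k` is that of the variable missing from f(tᵢ, tⱼ), whence the condition on `d k`. -/
theorem coeff_rename_pair {i j k : Fin 3} (hij : i ≠ j) (hik : i ≠ k) (hjk : j ≠ k)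
    (f : Ser 2) (d : Fin 3 →₀ ℕ) :
    MvPowerSeries.coeff d (MvPowerSeries.rename (pair i j hij) f) =
      if d k = 0 then MvPowerSeries.coeff (Finsupp.single 0 (d i) + Finsupp.single 1 (d j)) f
      else 0 := by
  have hcover : ∀ x : Fin 3, x = i ∨ x = j ∨ x = k := by omega
  split_ifs with h
  · rw [← MvPowerSeries.coeff_embDomain_rename (pair i j hij)]
    congr 2
    rw [Finsupp.embDomain_eq_mapDomain]
    ext x
    rw [Finsupp.mapDomain_add, Finsupp.mapDomain_single, Finsupp.mapDomain_single]
    rcases hcover x with rfl | rfl | rfl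
    · simp [pair_zero, pair_one, hij]
    · simp [pair_zero, pair_one, hij.symm]
    · simp [pair_zero, pair_one, hik.symm, hjk.symm, h]
  · refine MvPowerSeries.coeff_rename_eq_zero _ _ ?_
    rintro ⟨e, rfl⟩
    refine h (Finsupp.mapDomain_of_notMem_range _ _ ?_)
    rintro ⟨x, hx⟩
    fin_cases x <;> simp [pair] at hx
    · exact hik hx
    · exact hjk hx

theorem serCoeff_argsSer {i j k : Fin 3} (hij : i ≠ j) (hik : i ≠ k) (hjk : j ≠ k)
    (x : Ser 2 ⊗[ℂ] V) (d : Fin 3 →₀ ℕ) :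
    serCoeff V d (argsSer i j hij x) = if d k = 0 then coeffTwo V (d i) (d j) x else 0 := by
  induction x with
  | zero => simp
  | tmul f v =>
    rw [argsSer, coef_tmul, serCoeff, evalCoef_tmul, coeff_rename_pair hij hik hjk, coeffTwo_eq,
      evalCoef_tmul]
    simp
  | add x y hx hy =>
    rw [map_add, map_add, hx, hy]
    split_ifs <;> simp

/-- The first factor omits tₖ and the second omits tⱼ. A contributing splitting of `d` therefore
gives all of tⱼ to the first and all of tₖ to the second, and only the exponent of the shared
variable tᵢ is really split. -/
theorem sum_antidiagonal_three {X Y Z : Type*} [AddCommGroup X] [Module ℂ X] [AddCommGroup Y]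
    [Module ℂ Y] [AddCommGroup Z] [Module ℂ Z] (B : X →ₗ[ℂ] Y →ₗ[ℂ] Z) {i j k : Fin 3}
    (hij : i ≠ j) (hik : i ≠ k) (hjk : j ≠ k) (F : ℕ → ℕ → X) (G : ℕ → ℕ → Y)
    (d : Fin 3 →₀ ℕ) :
    ∑ u ∈ antidiagonal d, B (if u.1 k = 0 then F (u.1 i) (u.1 j) else 0)
        (if u.2 j = 0 then G (u.2 i) (u.2 k) else 0) =
      ∑ p ∈ antidiagonal (d i), B (F p.1 (d j)) (G p.2 (d k)) := by
  have hcover : ∀ x : Fin 3, x = i ∨ x = j ∨ x = k := by omega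
  symm
  refine Finset.sum_of_injOn (fun p => (Finsupp.single i p.1 + Finsupp.single j (d j),
    Finsupp.single i p.2 + Finsupp.single k (d k))) ?_ ?_ ?_ ?_
  · rintro ⟨p, q⟩ _ ⟨p', q'⟩ _ h
    have h1 := DFunLike.congr_fun (congrArg Prod.fst h) i
    have h2 := DFunLike.congr_fun (congrArg Prod.snd h) i
    simp [hij, hik] at h1 h2
    simp [h1, h2]
  · rintro ⟨p, q⟩ h
    simp only [Finset.mem_coe,
      mem_antidiagonal] at h ⊢
    ext x
    rcases hcover x with rfl | rfl | rfl
    · simp [hij, hik, h]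
    · simp [hij.symm, hjk]
    · simp [hik.symm, hjk.symm]
  · rintro ⟨u, v⟩ h hn
    rw [mem_antidiagonal] at h
    simp only at h ⊢
    by_cases hu : u k = 0
    · by_cases hv : v j = 0
      · refine absurd ⟨(u i, v i), ?_, ?_⟩ hn
        · simp [← h]
        · ext x
          · rcases hcover x with rfl | rfl | rfl
            · simp [hij]
            · simp [hij.symm, ← h, hv]
            · simp [hik.symm, hjk.symm, hu]
          · rcases hcover x with rfl | rfl | rfl
            · simp [hik]
            · simp [hij.symm, hjk, hv]
            · simp [hik.symm, ← h, hu]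
      · simp [hv]
    · simp [hu]
  · rintro ⟨p, q⟩ _
    simp [hij, hik, hij.symm, hik.symm, hjk, hjk.symm]

/-- Division of `A(tᵢ) - A(tⱼ)` by `tᵢ - tⱼ`. -/
theorem X_sub_X_mul {i j k : Fin 3} (hij : i ≠ j) (hik : i ≠ k) (hjk : j ≠ k) (c : ℕ → ℕ → ℂ)
    {F A B : Ser 3}
    (hF : ∀ d, MvPowerSeries.coeff d F = c (d i + d j + 1) (d k))
    (hA : ∀ d, MvPowerSeries.coeff d A = if d j = 0 then c (d i) (d k) else 0)
    (hB : ∀ d, MvPowerSeries.coeff d B = if d i = 0 then c (d j) (d k) else 0) :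
    (MvPowerSeries.X i - MvPowerSeries.X j) * F = A - B := by
  classical
  have key : ∀ (x : Fin 3) (d : Fin 3 →₀ ℕ), MvPowerSeries.coeff d (MvPowerSeries.X x * F) =
      if d x = 0 then 0 else MvPowerSeries.coeff (d - Finsupp.single x 1) F := by
    intro x d
    rw [MvPowerSeries.X_def, MvPowerSeries.coeff_monomial_mul]
    simp only [Finsupp.single_le_iff, one_mul]
    split_ifs <;> first | rfl | omega
  ext d
  rw [sub_mul, map_sub, map_sub, key, key, hA, hB, hF, hF]
  by_cases hi : d i = 0 <;> by_cases hj : d j = 0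
  · simp [hi, hj]
  · have : d j - 1 + 1 = d j := by omega
    simp [hi, hj, hij, hjk, this]
  · have : d i - 1 + 1 = d i := by omega
    simp [hi, hj, hij.symm, hik, this]
  · have h1 : d i + (d j - 1) + 1 = d i + d j := by omega
    have h2 : d i - 1 + d j + 1 = d i + d j := by omega
    simp [hi, hj, hij.symm, hij, hik, hjk, h1, h2]

/-- `f ↦ (f(tᵢ, tₖ) - f(tⱼ, tₖ)) / (tᵢ - tⱼ)`. -/
def divDiffFst (i j k : Fin 3) : Ser 2 →ₗ[ℂ] Ser 3 where
  toFun f := fun d =>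
    MvPowerSeries.coeff (Finsupp.single 0 (d i + d j + 1) + Finsupp.single 1 (d k)) f
  map_add' f g := by funext d; exact map_add (MvPowerSeries.coeff _) f g
  map_smul' c f := by funext d; exact map_smul (MvPowerSeries.coeff _) c f

/-- `f ↦ (f(tₖ, tᵢ) - f(tₖ, tⱼ)) / (tᵢ - tⱼ)`. -/
def divDiffSnd (i j k : Fin 3) : Ser 2 →ₗ[ℂ] Ser 3 where
  toFun f := fun d =>
    MvPowerSeries.coeff (Finsupp.single 0 (d k) + Finsupp.single 1 (d i + d j + 1)) f
  map_add' f g := by funext d; exact map_add (MvPowerSeries.coeff _) f g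
  map_smul' c f := by funext d; exact map_smul (MvPowerSeries.coeff _) c f

theorem serCoeff_divDiffFst (i j k : Fin 3) (x : Ser 2 ⊗[ℂ] V) (d : Fin 3 →₀ ℕ) :
    serCoeff V d ((divDiffFst i j k).rTensor V x) = coeffTwo V (d i + d j + 1) (d k) x := by
  rw [serCoeff, evalCoef_rTensor]
  rfl

theorem serCoeff_divDiffSnd (i j k : Fin 3) (x : Ser 2 ⊗[ℂ] V) (d : Fin 3 →₀ ℕ) :
    serCoeff V d ((divDiffSnd i j k).rTensor V x) = coeffTwo V (d k) (d i + d j + 1) x := by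
  rw [serCoeff, evalCoef_rTensor]
  rfl

/-- This clears poles: once the invariance of C has been used, each 1 / (tᵢ - tⱼ) in the terms
linear in C multiplies such a difference. -/
theorem smul_divDiffFst {i j k : Fin 3} (hij : i ≠ j) (hik : i ≠ k) (hjk : j ≠ k)
    (x : Ser 2 ⊗[ℂ] V) :
    (MvPowerSeries.X i - MvPowerSeries.X j : Ser 3) • (divDiffFst i j k).rTensor V x =
      argsSer i k hik x - argsSer j k hjk x := by
  induction x with
  | zero => simp
  | tmul f v =>
    rw [LinearMap.rTensor_tmul, TensorProduct.smul_tmul', argsSer, argsSer, coef_tmul, coef_tmul,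
      ← TensorProduct.sub_tmul, smul_eq_mul]
    congr 1
    exact X_sub_X_mul hij hik hjk
      (fun m n => MvPowerSeries.coeff (Finsupp.single 0 m + Finsupp.single 1 n) f)
      (fun d => rfl) (coeff_rename_pair hik hij hjk.symm f)
      (coeff_rename_pair hjk hij.symm hik.symm f)
  | add x y hx hy => simp only [map_add, smul_add, hx, hy]; abel

theorem smul_divDiffSnd {i j k : Fin 3} (hij : i ≠ j) (hik : i ≠ k) (hjk : j ≠ k)
    (x : Ser 2 ⊗[ℂ] V) :
    (MvPowerSeries.X i - MvPowerSeries.X j : Ser 3) • (divDiffSnd i j k).rTensor V x =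
      argsSer k i hik.symm x - argsSer k j hjk.symm x := by
  induction x with
  | zero => simp
  | tmul f v =>
    rw [LinearMap.rTensor_tmul, TensorProduct.smul_tmul', argsSer, argsSer, coef_tmul, coef_tmul,
      ← TensorProduct.sub_tmul, smul_eq_mul]
    congr 1
    exact X_sub_X_mul hij hik hjk
      (fun m n => MvPowerSeries.coeff (Finsupp.single 0 n + Finsupp.single 1 m) f)
      (fun d => rfl) (coeff_rename_pair hik.symm hjk.symm hij f)
      (coeff_rename_pair hjk.symm hik.symm hij.symm f)
  | add x y hx hy => simp only [map_add, smul_add, hx, hy]; abel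

theorem serToFld_injective (n : ℕ) : Function.Injective (serToFld n) :=
  IsFractionRing.injective (Ser n) (Fld n)

theorem rename_serToFld {m n : ℕ} (e : Fin m ↪ Fin n) (f : Ser m) :
    rename e (serToFld m f) = serToFld n (MvPowerSeries.rename e f) := by
  exact IsFractionRing.lift_algebraMap (K := Fld m)
    (g := ((serToFld n).comp (MvPowerSeries.rename e)).toRingHom)
    ((serToFld_injective n).comp (MvPowerSeries.rename_injective e)) f

theorem var_sub_ne_zero {n : ℕ} {i j : Fin n} (h : i ≠ j) : (var i - var j : Fld n) ≠ 0 := by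
  rw [var, var, ← map_sub, map_ne_zero_iff _ (serToFld_injective n), sub_ne_zero]
  exact fun h' => h (MvPowerSeries.X_inj.1 h')

theorem rename_var {m n : ℕ} (e : Fin m ↪ Fin n) (i : Fin m) : rename e (var i) = var (e i) := by
  rw [var, rename_serToFld, MvPowerSeries.rename_X, var]

end Series

/-! ### From the equation over the fraction field to identities between operators. -/

section Equation

variable {𝔭 : Type*} [LieRing 𝔭] [LieAlgebra ℂ 𝔭]

theorem argsAt_coef {n : ℕ} {i j : Fin n} (h : i ≠ j) (x : Ser 2 ⊗[ℂ] (𝔭 ⊗[ℂ] 𝔭)) :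
    argsAt i j h (coef _ (serToFld 2) x) = coef _ (serToFld n) (argsSer i j h x) := by
  induction x with
  | zero => simp
  | tmul f v => simp only [argsAt, argsSer, coef_tmul, rename_serToFld]
  | add x y hx hy => simp only [map_add, hx, hy]

/-- The coefficients of the left-hand side of the generalized classical Yang-Baxter equation for
`C / (t₁ - t₂) + g`, contracted with `a` and `b` in the second and third tensor factor, where `G m k`
is the operator attached to the coefficient of `t₁ᵐ t₂ᵏ` of `g`. -/
def yangBaxterCoeff (G : ℕ → ℕ → Module.End ℂ 𝔭) (i j l : ℕ) (a b : 𝔭) : 𝔭 :=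
  ⁅a, G (i + j + 1) l b⁆ + ⁅G (i + l + 1) j a, b⁆ +
    ∑ p ∈ antidiagonal i, ⁅G p.1 j a, G p.2 l b⁆ -
    G i (j + l + 1) ⁅a, b⁆ -
    ∑ p ∈ antidiagonal j, G i p.1 ⁅a, G p.2 l b⁆ -
    ∑ p ∈ antidiagonal l, G i p.1 ⁅G p.2 j a, b⁆

/-- The operator attached to the coefficient of `t₁ᵐ t₂ᵏ`. -/
def opCoeff (β : LinearMap.BilinForm ℂ 𝔭) (h : Ser 2 ⊗[ℂ] (𝔭 ⊗[ℂ] 𝔭)) (m k : ℕ) :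
    Module.End ℂ 𝔭 := op β (coeffTwo _ m k h)

variable [FiniteDimensional ℂ 𝔭] {β : LinearMap.BilinForm ℂ 𝔭} (hβ : β.Nondegenerate)

theorem argsAt_yang {n : ℕ} {i j : Fin n} (h : i ≠ j) :
    argsAt i j h (yang β hβ) = (var i - var j)⁻¹ ⊗ₜ casimir β hβ := by
  rw [yang, argsAt, coef_tmul, map_inv₀, map_sub, rename_var, rename_var]
  rfl

/-- The left-hand side of the generalized classical Yang-Baxter equation for `C / (t₁ - t₂) + g`, as
a power series. -/
def yangBaxterSer (hβ : β.Nondegenerate) (g : Ser 2 ⊗[ℂ] (𝔭 ⊗[ℂ] 𝔭)) :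
    Ser 3 ⊗[ℂ] (𝔭 ⊗[ℂ] (𝔭 ⊗[ℂ] 𝔭)) :=
  -(br1223 𝔭 (casimir β hβ)).lTensor (Ser 3) ((divDiffFst 0 1 2).rTensor _ g) -
    ((br3213 𝔭).flip (casimir β hβ)).lTensor (Ser 3) ((divDiffFst 0 2 1).rTensor _ g) +
    ((br1223 𝔭).flip (casimir β hβ)).lTensor (Ser 3) ((divDiffSnd 1 2 0).rTensor _ g) +
    ext (Ser 3) (br1213 𝔭) (argsSer 0 1 (by decide) g) (argsSer 0 2 (by decide) g) +
    ext (Ser 3) (br1223 𝔭) (argsSer 0 1 (by decide) g) (argsSer 1 2 (by decide) g) +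
    ext (Ser 3) (br3213 𝔭) (argsSer 2 1 (by decide) g) (argsSer 0 2 (by decide) g)

theorem contract_yangBaxterSer (hi : β.lieInvariant 𝔭) (g : Ser 2 ⊗[ℂ] (𝔭 ⊗[ℂ] 𝔭))
    (d : Fin 3 →₀ ℕ) (a b : 𝔭) :
    contract β a b (serCoeff _ d (yangBaxterSer hβ g)) =
      yangBaxterCoeff (opCoeff β g) (d 0) (d 1) (d 2) a b := by
  have h01 : (0 : Fin 3) ≠ 1 := by decide
  have h02 : (0 : Fin 3) ≠ 2 := by decide
  have h12 : (1 : Fin 3) ≠ 2 := by decide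
  rw [yangBaxterSer]
  simp only [map_add, map_sub, map_neg, serCoeff_ext]
  simp only [serCoeff_argsSer h01 h02 h12, serCoeff_argsSer h02 h01 h12.symm,
    serCoeff_argsSer h12 h01.symm h02.symm, serCoeff_argsSer h12.symm h02.symm h01.symm]
  -- The shared variable is t₁, t₂, t₃ in turn. The indices of a coefficient are exchanged where the
  -- shared variable is the second argument of that factor.
  rw [sum_antidiagonal_three (br1213 𝔭) h01 h02 h12 (fun m n => coeffTwo _ m n g)
      (fun m n => coeffTwo _ m n g),
    sum_antidiagonal_three (br1223 𝔭) h01.symm h12 h02 (fun m n => coeffTwo _ n m g)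
      (fun m n => coeffTwo _ m n g),
    sum_antidiagonal_three (br3213 𝔭) h12.symm h02.symm h01.symm (fun m n => coeffTwo _ m n g)
      (fun m n => coeffTwo _ n m g)]
  simp only [serCoeff, evalCoef_lTensor]
  simp only [← serCoeff.eq_def, serCoeff_divDiffFst, serCoeff_divDiffSnd, map_sum,
    LinearMap.flip_apply, contract_br1213, contract_br1223 hi, contract_br3213 hi,
    op_casimir, LinearMap.id_apply, yangBaxterCoeff, opCoeff]
  -- Only antisymmetry is left: the brackets are put in the order used by `yangBaxterCoeff`, and the
  -- last convolution is reversed.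
  have h1 : ∀ (T : Module.End ℂ 𝔭) (x y : 𝔭), T ⁅x, y⁆ = -T ⁅y, x⁆ := fun T x y => by
    rw [← lie_skew, map_neg]
  rw [← lie_skew a, ← lie_skew _ b, h1 _ a b,
    Finset.sum_congr (s₁ := antidiagonal (d 1)) rfl fun p _ => h1 (op β _) _ a,
    Finset.sum_congr (s₁ := antidiagonal (d 2)) rfl fun p _ => h1 (op β _) b _,
    ← Finset.Nat.sum_antidiagonal_swap (n := d 2)]
  simp only [Finset.sum_neg_distrib, Prod.fst_swap, Prod.snd_swap]
  abel

/-- The identity [C¹², s¹³ + s²³] = 0, another form of invariance. With its two companions below, it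
groups the terms linear in C into differences with a common pole. -/
theorem br1213_casimir_left (hi : β.lieInvariant 𝔭) :
    br1213 𝔭 (casimir β hβ) = -br1223 𝔭 (casimir β hβ) := by
  refine LinearMap.ext fun s => eq_of_contract hβ fun a b => ?_
  rw [LinearMap.neg_apply, map_neg, contract_br1213, contract_br1223 hi, op_casimir]
  simp

theorem br1213_casimir_right (hi : β.lieInvariant 𝔭) :
    (br1213 𝔭).flip (casimir β hβ) = -(br3213 𝔭).flip (casimir β hβ) := by
  refine LinearMap.ext fun s => eq_of_contract hβ fun a b => ?_
  rw [LinearMap.neg_apply, map_neg, LinearMap.flip_apply, LinearMap.flip_apply, contract_br1213,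
    contract_br3213 hi, op_casimir]
  simp

theorem br3213_casimir_left (hi : β.lieInvariant 𝔭) :
    br3213 𝔭 (casimir β hβ) = (br1223 𝔭).flip (casimir β hβ) := by
  refine LinearMap.ext fun s => eq_of_contract hβ fun a b => ?_
  rw [LinearMap.flip_apply, contract_br1223 hi, contract_br3213 hi, op_casimir]
  simp

theorem coef_smul_sub {i j : Fin 3} (hij : i ≠ j) {V : Type*} [AddCommGroup V] [Module ℂ V]
    {x y z : Ser 3 ⊗[ℂ] V}
    (h : (MvPowerSeries.X i - MvPowerSeries.X j : Ser 3) • x = y - z) :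
    (var i - var j : Fld 3)⁻¹ • (coef V (serToFld 3) y - coef V (serToFld 3) z) =
      coef V (serToFld 3) x := by
  rw [← map_sub, ← h, coef_smul, map_sub, smul_smul]
  exact (congrArg (· • coef V (serToFld 3) x) (inv_mul_cancel₀ (var_sub_ne_zero hij))).trans
    (one_smul _ _)

/-- Expand the equation in C and g. The part quadratic in C vanishes, the part linear in C becomes
three divided differences by invariance, and the part quadratic in g has no pole. What remains is a
power series, and power series embed in their fractions. -/
theorem gcybe_yang_add_iff_yangBaxterSer (hi : β.lieInvariant 𝔭) (g : Ser 2 ⊗[ℂ] (𝔭 ⊗[ℂ] 𝔭)) :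
    GCYBE (yang β hβ + coef _ (serToFld 2) g) ↔ yangBaxterSer hβ g = 0 := by
  have h01 : (0 : Fin 3) ≠ 1 := by decide
  have h02 : (0 : Fin 3) ≠ 2 := by decide
  have h12 : (1 : Fin 3) ≠ 2 := by decide
  rw [← (coef_injective (X := 𝔭 ⊗[ℂ] (𝔭 ⊗[ℂ] 𝔭)) (serToFld_injective 3)).eq_iff, map_zero, GCYBE]
  suffices h : ∀ x y : Fld 3 ⊗[ℂ] (𝔭 ⊗[ℂ] (𝔭 ⊗[ℂ] 𝔭)), x = y → (x = 0 ↔ y = 0) by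
    refine h _ _ ?_
    have e1 := coef_smul_sub h01 (smul_divDiffFst h01 h02 h12 g)
    have e2 := coef_smul_sub h02 (smul_divDiffFst h02 h01 h12.symm g)
    have e3 := coef_smul_sub h12 (smul_divDiffSnd h12 h01.symm h02.symm g)
    simp only [map_add, LinearMap.add_apply, argsAt_yang, argsAt_coef, yangBaxterSer, map_sub,
      map_neg, coef_ext, ← lTensor_coef, ← e1, ← e2, ← e3, ext_tmul_left, ext_tmul_right,
      lTensor_smul_eq, smul_sub]
    rw [br1213_casimir_left hβ hi, br1213_casimir_right hβ hi, br3213_casimir_left hβ hi]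
    have e4 : br1223 𝔭 (casimir β hβ) (casimir β hβ) = -br1213 𝔭 (casimir β hβ) (casimir β hβ) := by
      rw [br1213_casimir_left hβ hi, LinearMap.neg_apply, neg_neg]
    have e5 : (var 2 - var 1 : Fld 3)⁻¹ = -(var 1 - var 2)⁻¹ := by
      rw [← inv_neg, neg_sub]
    -- The three brackets of C with itself agree up to sign, so this partial fraction identity kills
    -- the part quadratic in C.
    have e6 : ((var 0 - var 1)⁻¹ * (var 0 - var 2)⁻¹ - (var 0 - var 1)⁻¹ * (var 1 - var 2)⁻¹ +
        (var 1 - var 2)⁻¹ * (var 0 - var 2)⁻¹ : Fld 3) = 0 := by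
      have := var_sub_ne_zero h01
      have := var_sub_ne_zero h02
      have := var_sub_ne_zero h12
      field_simp
      ring
    have e7 := congrArg (· ⊗ₜ[ℂ] br1223 𝔭 (casimir β hβ) (casimir β hβ)) e6
    simp only [TensorProduct.add_tmul, TensorProduct.sub_tmul, TensorProduct.zero_tmul] at e7
    have e9 : br3213 𝔭 (casimir β hβ) (casimir β hβ) =
        br1223 𝔭 (casimir β hβ) (casimir β hβ) := by
      rw [br3213_casimir_left hβ hi, LinearMap.flip_apply]
    have e8 : ∀ (c : Fld 3) (x : Fld 3 ⊗[ℂ] (𝔭 ⊗[ℂ] (𝔭 ⊗[ℂ] 𝔭))), (-c) • x = -(c • x) :=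
      fun c x => neg_smul c x
    simp only [e5, LinearMap.neg_apply, LinearMap.lTensor_neg, smul_neg, e8,
      TensorProduct.neg_tmul, map_neg, LinearMap.lTensor_tmul, LinearMap.flip_apply,
      TensorProduct.smul_tmul', smul_eq_mul, e9, e4, TensorProduct.tmul_neg] at e7 ⊢
    rw [mul_comm (var 0 - var 2)⁻¹ (var 0 - var 1)⁻¹, mul_comm (var 1 - var 2)⁻¹ (var 0 - var 1)⁻¹,
      mul_comm (var 0 - var 2)⁻¹ (var 1 - var 2)⁻¹, ← sub_eq_zero, ← neg_eq_zero, ← e7]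
    abel
  rintro x y rfl
  rfl

/-- The generalized classical Yang-Baxter equation, coefficient by coefficient. -/
theorem gcybe_yang_add_iff (hi : β.lieInvariant 𝔭) (g : Ser 2 ⊗[ℂ] (𝔭 ⊗[ℂ] 𝔭)) :
    GCYBE (yang β hβ + coef _ (serToFld 2) g) ↔
      ∀ i j l a b, yangBaxterCoeff (opCoeff β g) i j l a b = 0 := by
  rw [gcybe_yang_add_iff_yangBaxterSer hβ hi]
  constructor
  · intro h i j l a b
    have := contract_yangBaxterSer hβ hi g
      (Finsupp.single 0 i + Finsupp.single 1 j + Finsupp.single 2 l) a b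
    simpa [h] using this.symm
  · intro h
    refine ext_serCoeff fun d => eq_of_contract hβ fun a b => ?_
    rw [contract_yangBaxterSer hβ hi, h, map_zero, map_zero]

end Equation

/-! ### Laurent series in `t` or in `t⁻¹`

The two cases are treated together: `σ = 1` means that the variable of `K` is `t`, and `σ = -1` that
it is `t⁻¹`. -/

section Laurent

variable {V : Type*} [AddCommGroup V] [Module ℂ V] {σ : ℤ}

/-- The coefficient of `tⁿ`, where `t` is the `σ`-th power of the variable of `K`. -/
def tcoeff (V : Type*) [AddCommGroup V] [Module ℂ V] (σ n : ℤ) : K ⊗[ℂ] V →ₗ[ℂ] V :=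
  coeffLaurent V (σ * n)

/-- The coefficient of `t⁻¹`. -/
def tres (σ : ℤ) : K →ₗ[ℂ] ℂ := laurentCoeff (σ * (-1))

theorem laurentCoeff_apply (k : ℤ) (f : K) : laurentCoeff k f = HahnSeries.coeff f k := rfl

theorem tcoeff_tmul (n : ℤ) (f : K) (v : V) :
    tcoeff V σ n (f ⊗ₜ v) = laurentCoeff (σ * n) f • v := evalCoef_tmul _ _ _

theorem ext_tcoeff (hσ : σ * σ = 1) [FiniteDimensional ℂ V] {x y : K ⊗[ℂ] V}
    (h : ∀ n, tcoeff V σ n x = tcoeff V σ n y) : x = y := by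
  refine ext_of_evalCoef (c := laurentCoeff) (fun f g h => HahnSeries.ext (funext h)) fun n => ?_
  have := h (σ * n)
  rwa [tcoeff, ← mul_assoc, hσ, one_mul] at this

/-- The bound is on the exponent σ n of the variable of `K`: for σ = 1 it bounds the powers of t
from below, for σ = -1 from above. -/
theorem exists_lt_tcoeff_eq_zero (x : K ⊗[ℂ] V) :
    ∃ A, ∀ n, σ * n < A → tcoeff V σ n x = 0 := by
  induction x with
  | zero => exact ⟨0, by simp⟩
  | tmul f v =>
    refine ⟨HahnSeries.order (f : HahnSeries ℤ ℂ), fun n hn => ?_⟩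
    rw [tcoeff_tmul, laurentCoeff_apply, HahnSeries.coeff_eq_zero_of_lt_order hn, zero_smul]
  | add x y hx hy =>
    obtain ⟨A, hA⟩ := hx
    obtain ⟨B, hB⟩ := hy
    exact ⟨min A B, fun n hn => by
      rw [map_add, hA n (hn.trans_le (min_le_left _ _)), hB n (hn.trans_le (min_le_right _ _)),
        add_zero]⟩

theorem exists_tcoeff (hσ : σ * σ = 1) [FiniteDimensional ℂ V] (F : ℤ → V) (A : ℤ)
    (hF : ∀ n, σ * n < A → F n = 0) : ∃ x : K ⊗[ℂ] V, ∀ n, tcoeff V σ n x = F n := by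
  obtain ⟨x, hx⟩ := exists_evalCoef (A := K) laurentCoeff (fun n => F (σ * n)) fun φ =>
    ⟨HahnSeries.ofSuppBddBelow (fun n => φ (F (σ * n))) ⟨A, fun n hn => by
      by_contra h
      refine hn ?_
      simp only
      rw [hF, map_zero]
      rw [← mul_assoc, hσ, one_mul]
      omega⟩, fun n => rfl⟩
  refine ⟨x, fun n => ?_⟩
  rw [tcoeff, coeffLaurent_eq, hx, ← mul_assoc, hσ, one_mul]

/-- A convolution of Laurent series has finitely many nonzero terms. Allowing every larger finite
set lets the sums for several pairs of series be taken over a common set, so that the formula passes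
to sums of tensors. -/
theorem exists_laurentCoeff_mul (hσ : σ * σ = 1) (f g : K) (n : ℤ) : ∃ S₀ : Finset ℤ, ∀ S, S₀ ⊆ S →
    laurentCoeff (σ * n) (f * g) =
      ∑ p ∈ S, laurentCoeff (σ * p) f * laurentCoeff (σ * (n - p)) g := by
  have hinj : Function.Injective (fun p : ℤ => σ * p) := fun p q h => by
    have := congrArg (σ * ·) h
    simpa [← mul_assoc, hσ] using this
  set D := Finset.antidiagonal (HahnSeries.isPWO_support (f : HahnSeries ℤ ℂ))
    (HahnSeries.isPWO_support (g : HahnSeries ℤ ℂ)) (σ * n) with hD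
  refine ⟨D.image fun u => σ * u.1, fun S hS => ?_⟩
  have h1 : laurentCoeff (σ * n) (f * g) = ∑ u ∈ D, laurentCoeff u.1 f * laurentCoeff u.2 g :=
    HahnSeries.coeff_mul (x := (f : HahnSeries ℤ ℂ)) (y := (g : HahnSeries ℤ ℂ))
  rw [h1]
  refine Finset.sum_of_injOn (fun u => σ * u.1) ?_ ?_ ?_ ?_
  · rintro ⟨p, q⟩ hu ⟨p', q'⟩ hu' h
    rw [Finset.mem_coe, hD, Finset.mem_antidiagonal] at hu hu'
    have h2 := hinj h
    simp only at h2 hu hu'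
    ext
    · exact h2
    · simp only
      omega
  · intro u hu
    exact hS (Finset.mem_image_of_mem _ hu)
  · intro p _ hp
    by_contra hne
    refine hp ⟨(σ * p, σ * (n - p)), ?_, ?_⟩
    · rw [Finset.mem_coe, hD, Finset.mem_antidiagonal]
      exact ⟨left_ne_zero_of_mul hne, right_ne_zero_of_mul hne, by simp; ring⟩
    · simp [← mul_assoc, hσ]
  · rintro ⟨p, q⟩ hu
    rw [hD, Finset.mem_antidiagonal] at hu
    simp only at hu ⊢
    rw [mul_sub, ← mul_assoc, hσ, one_mul, ← hu.2.2, add_sub_cancel_left]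

theorem exists_tcoeff_ext (hσ : σ * σ = 1) {X Y Z : Type*} [AddCommGroup X] [Module ℂ X]
    [AddCommGroup Y] [Module ℂ Y] [AddCommGroup Z] [Module ℂ Z] (B : X →ₗ[ℂ] Y →ₗ[ℂ] Z)
    (x : K ⊗[ℂ] X) (y : K ⊗[ℂ] Y) (n : ℤ) : ∃ S₀ : Finset ℤ, ∀ S, S₀ ⊆ S →
    tcoeff Z σ n (ext K B x y) = ∑ p ∈ S, B (tcoeff X σ p x) (tcoeff Y σ (n - p) y) := by
  classical
  induction x with
  | zero => exact ⟨∅, by simp⟩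
  | tmul f a =>
    induction y with
    | zero => exact ⟨∅, by simp⟩
    | tmul g b =>
      obtain ⟨S₀, h⟩ := exists_laurentCoeff_mul hσ f g n
      refine ⟨S₀, fun S hS => ?_⟩
      rw [ext_tmul, tcoeff_tmul, h S hS, Finset.sum_smul]
      refine Finset.sum_congr rfl fun p _ => ?_
      rw [tcoeff_tmul, tcoeff_tmul, map_smul, map_smul, LinearMap.smul_apply, smul_smul, mul_comm]
    | add x y hx hy =>
      obtain ⟨S, hS⟩ := hx
      obtain ⟨T, hT⟩ := hy
      refine ⟨S ∪ T, fun U hU => ?_⟩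
      simp only [map_add, Finset.sum_add_distrib]
      rw [hS U (Finset.union_subset_left hU), hT U (Finset.union_subset_right hU)]
  | add x y hx hy =>
    obtain ⟨S, hS⟩ := hx
    obtain ⟨T, hT⟩ := hy
    refine ⟨S ∪ T, fun U hU => ?_⟩
    simp only [map_add, LinearMap.add_apply, Finset.sum_add_distrib]
    rw [hS U (Finset.union_subset_left hU), hT U (Finset.union_subset_right hU)]

theorem tcoeff_ext (hσ : σ * σ = 1) {X Y Z : Type*} [AddCommGroup X] [Module ℂ X]
    [AddCommGroup Y] [Module ℂ Y] [AddCommGroup Z] [Module ℂ Z] (B : X →ₗ[ℂ] Y →ₗ[ℂ] Z)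
    (x : K ⊗[ℂ] X) (y : K ⊗[ℂ] Y) (n : ℤ) (S : Finset ℤ)
    (hS : ∀ p, p ∉ S → B (tcoeff X σ p x) (tcoeff Y σ (n - p) y) = 0) :
    tcoeff Z σ n (ext K B x y) = ∑ p ∈ S, B (tcoeff X σ p x) (tcoeff Y σ (n - p) y) := by
  classical
  obtain ⟨S₀, h⟩ := exists_tcoeff_ext hσ B x y n
  rw [h (S₀ ∪ S) Finset.subset_union_left]
  exact (Finset.sum_subset Finset.subset_union_right fun p _ hp => hS p hp).symm

end Laurent

/-! ### The residue form and brackets of basic series. -/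

section Form

variable {𝔭 : Type*} [LieRing 𝔭] [LieAlgebra ℂ 𝔭] {σ : ℤ} {β : LinearMap.BilinForm ℂ 𝔭}

theorem tcoeff_lie (hσ : σ * σ = 1) (x y : K ⊗[ℂ] 𝔭) (n : ℤ) (S : Finset ℤ)
    (hS : ∀ p, p ∉ S → ⁅tcoeff 𝔭 σ p x, tcoeff 𝔭 σ (n - p) y⁆ = 0) :
    tcoeff 𝔭 σ n ⁅x, y⁆ = ∑ p ∈ S, ⁅tcoeff 𝔭 σ p x, tcoeff 𝔭 σ (n - p) y⁆ := by
  rw [lie_eq_ext]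
  exact tcoeff_ext hσ (brack 𝔭) x y n S hS

theorem resForm_eq_sum (hσ : σ * σ = 1) (x y : K ⊗[ℂ] 𝔭) (S : Finset ℤ)
    (hS : ∀ p, p ∉ S → β (tcoeff 𝔭 σ p x) (tcoeff 𝔭 σ (-1 - p) y) = 0) :
    resForm (tres σ) β x y = ∑ p ∈ S, β (tcoeff 𝔭 σ p x) (tcoeff 𝔭 σ (-1 - p) y) := by
  rw [← tcoeff_ext hσ β x y (-1) S hS]
  change (tres σ ∘ₗ (TensorProduct.rid ℂ K).toLinearMap) (ext K β x y) = _
  generalize ext K β x y = z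
  induction z with
  | zero => simp
  | tmul f c => simp [tcoeff_tmul, tres, mul_comm]
  | add x y hx hy => rw [map_add, map_add, hx, hy]

theorem resForm_comm (hs : β.IsSymm) (x y : K ⊗[ℂ] 𝔭) :
    resForm (tres σ) β x y = resForm (tres σ) β y x := by
  induction x with
  | zero => simp
  | tmul f a =>
    induction y with
    | zero => simp
    | tmul g b => rw [resForm_apply, resForm_apply, hs.eq, mul_comm f]
    | add x y hx hy => simp only [map_add, LinearMap.add_apply, hx, hy]
  | add x y hx hy => simp only [map_add, LinearMap.add_apply, hx, hy]

theorem resForm_lie_assoc (hi : β.lieInvariant 𝔭) (x y z : K ⊗[ℂ] 𝔭) :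
    resForm (tres σ) β ⁅x, y⁆ z = resForm (tres σ) β x ⁅y, z⁆ := by
  induction x with
  | zero => simp
  | tmul f a =>
    induction y with
    | zero => simp
    | tmul g b =>
      induction z with
      | zero => simp
      | tmul h c =>
        rw [LieAlgebra.ExtendScalars.bracket_tmul, LieAlgebra.ExtendScalars.bracket_tmul,
          resForm_apply, resForm_apply, form_lie_assoc hi, mul_assoc]
      | add x y hx hy => simp only [map_add, lie_add, hx, hy]
    | add x y hx hy => simp only [map_add, LinearMap.add_apply, lie_add, add_lie, hx, hy]
  | add x y hx hy => simp only [map_add, LinearMap.add_apply, add_lie, hx, hy]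

/-! ### Basic elements -/

/-- `u` is the series `t^(-m-1) a + ∑ᵢ tⁱ G i m a`. -/
structure IsBasic (σ : ℤ) (G : ℕ → ℕ → Module.End ℂ 𝔭) (m : ℕ) (a : 𝔭) (u : K ⊗[ℂ] 𝔭) : Prop where
  nonneg : ∀ i : ℕ, tcoeff 𝔭 σ i u = G i m a
  neg : ∀ k : ℕ, tcoeff 𝔭 σ (-(k : ℤ) - 1) u = if k = m then a else 0

theorem nonneg_or_neg (n : ℤ) : (∃ i : ℕ, n = i) ∨ ∃ k : ℕ, n = -(k : ℤ) - 1 := by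
  rcases le_or_gt 0 n with h | h
  · exact Or.inl ⟨n.toNat, by omega⟩
  · exact Or.inr ⟨(-n - 1).toNat, by omega⟩

variable {G : ℕ → ℕ → Module.End ℂ 𝔭}

/-- The single pole of `u` meets the coefficient of tᵐ of `x`, and the regular part of `u` meets the
negative powers in `x`. The hypothesis on `N` covers both reasons for the sum to be finite: few
poles in `x`, or a finite column of `G`. -/
theorem resForm_isBasic (hσ : σ * σ = 1) {m : ℕ} {a : 𝔭} {u : K ⊗[ℂ] 𝔭} (hu : IsBasic σ G m a u)
    (x : K ⊗[ℂ] 𝔭) (N : ℕ) (hN : ∀ k : ℕ, N ≤ k → β (tcoeff 𝔭 σ (-(k : ℤ) - 1) x) (G k m a) = 0) :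
    resForm (tres σ) β x u = β (tcoeff 𝔭 σ m x) a +
      ∑ k ∈ Finset.range N, β (tcoeff 𝔭 σ (-(k : ℤ) - 1) x) (G k m a) := by
  classical
  have hinj : Function.Injective (fun k : ℕ => -(k : ℤ) - 1) := fun k l h => by simpa using h
  rw [resForm_eq_sum hσ x u (insert (m : ℤ) ((Finset.range N).image fun k : ℕ => -(k : ℤ) - 1)),
    Finset.sum_insert, Finset.sum_image hinj.injOn]
  · congr 1
    · have := hu.neg m
      rw [show (-1 - m : ℤ) = -m - 1 by ring, this, if_pos rfl]
    · refine Finset.sum_congr rfl fun k _ => ?_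
      rw [show (-1 - (-k - 1) : ℤ) = k by ring, hu.nonneg]
  · simp only [Finset.mem_image, Finset.mem_range, not_exists, not_and]
    intro k _
    omega
  · intro p hp
    simp only [Finset.mem_insert, Finset.mem_image, Finset.mem_range, not_or, not_exists,
      not_and] at hp
    rcases nonneg_or_neg p with ⟨i, rfl⟩ | ⟨k, rfl⟩
    · rw [show (-1 - i : ℤ) = -i - 1 by ring, hu.neg, if_neg, map_zero]
      exact fun h => hp.1 (by simp [h])
    · rw [show (-1 - (-k - 1) : ℤ) = k by ring, hu.nonneg]
      exact hN k (not_lt.1 fun h => hp.2 k h rfl)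

theorem lie_isBasic_nonneg (hσ : σ * σ = 1) {j l : ℕ} {a b : 𝔭} {u v : K ⊗[ℂ] 𝔭}
    (hu : IsBasic σ G j a u) (hv : IsBasic σ G l b v) (i : ℕ) :
    tcoeff 𝔭 σ i ⁅u, v⁆ = ⁅a, G (i + j + 1) l b⁆ + ⁅G (i + l + 1) j a, b⁆ +
      ∑ p ∈ antidiagonal i, ⁅G p.1 j a, G p.2 l b⁆ := by
  classical
  have hinj : Function.Injective (fun k : ℕ => (k : ℤ)) := fun k l h => by simpa using h
  rw [Finset.Nat.sum_antidiagonal_eq_sum_range_succ (fun p q => ⁅G p j a, G q l b⁆),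
    -- The exponents of `u` that contribute: its pole, the exponent facing the pole of `v`, and 0,
    -- …, i, where both factors are regular.
    tcoeff_lie hσ u v i (insert (-(j : ℤ) - 1) (insert ((i + l + 1 : ℕ) : ℤ)
      ((Finset.range (i + 1)).image fun k : ℕ => (k : ℤ)))),
    Finset.sum_insert, Finset.sum_insert, Finset.sum_image hinj.injOn, ← add_assoc]
  · congr 1
    · congr 1
      · have := hv.nonneg (i + j + 1)
        rw [hu.neg, if_pos rfl, ← this]
        congr 3
        push_cast
        ring
      · have := hv.neg l
        rw [hu.nonneg, show ((i : ℤ) - (i + l + 1 : ℕ)) = -l - 1 by push_cast; ring, this,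
          if_pos rfl]
    · refine Finset.sum_congr rfl fun p hp => ?_
      rw [hu.nonneg, ← hv.nonneg, Nat.cast_sub (by simpa [Nat.lt_succ_iff] using hp)]
  · simp only [Finset.mem_image, Finset.mem_range, not_exists, not_and]
    intro k _
    omega
  · simp only [Finset.mem_insert, Finset.mem_image, Finset.mem_range, not_or, not_exists, not_and]
    exact ⟨by omega, fun k _ => by omega⟩
  · intro p hp
    simp only [Finset.mem_insert, Finset.mem_image, Finset.mem_range, not_or, not_exists,
      not_and] at hp
    rcases nonneg_or_neg p with ⟨q, rfl⟩ | ⟨k, rfl⟩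
    · have h1 : ¬ q < i + 1 := fun h => hp.2.2 q h rfl
      have h2 : q ≠ i + l + 1 := fun h => hp.2.1 (by simp [h])
      rw [show (i : ℤ) - q = -((q - i - 1 : ℕ) : ℤ) - 1 by omega, hv.neg, if_neg (by omega),
        lie_zero]
    · rw [hu.neg, if_neg (fun h => hp.1 (by rw [h])), zero_lie]

theorem lie_isBasic_neg (hσ : σ * σ = 1) {j l : ℕ} {a b : 𝔭} {u v : K ⊗[ℂ] 𝔭}
    (hu : IsBasic σ G j a u) (hv : IsBasic σ G l b v) (k : ℕ) :
    tcoeff 𝔭 σ (-(k : ℤ) - 1) ⁅u, v⁆ = (if k ≤ j then ⁅a, G (j - k) l b⁆ else 0) +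
      (if k ≤ l then ⁅G (l - k) j a, b⁆ else 0) + if k = j + l + 1 then ⁅a, b⁆ else 0 := by
  classical
  rw [tcoeff_lie hσ u v _ {-(j : ℤ) - 1, (l : ℤ) - k}]
  · have e1 : tcoeff 𝔭 σ (-(k : ℤ) - 1 - ((l : ℤ) - k)) v = b := by
      rw [show (-(k : ℤ) - 1 - ((l : ℤ) - k)) = -l - 1 by ring, hv.neg, if_pos rfl]
    have e2 : tcoeff 𝔭 σ (-(j : ℤ) - 1) u = a := by rw [hu.neg, if_pos rfl]
    -- The pole of `u` and the exponent facing the pole of `v` coincide exactly when `k = j + l +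
    -- 1`, where pole meets pole.
    by_cases hne : -(j : ℤ) - 1 = (l : ℤ) - k
    · have h1 : ¬ k ≤ j := by omega
      have h2 : ¬ k ≤ l := by omega
      have h3 : k = j + l + 1 := by omega
      rw [hne, Finset.pair_eq_singleton, Finset.sum_singleton, e1, ← hne, e2, if_neg h1,
        if_neg h2, if_pos h3]
      simp
    · have h3 : ¬ k = j + l + 1 := by omega
      rw [Finset.sum_pair hne, e1, e2, if_neg h3, add_zero]
      congr 1
      · split_ifs with h
        · rw [show (-(k : ℤ) - 1 - (-(j : ℤ) - 1)) = ((j - k : ℕ) : ℤ) by omega, hv.nonneg]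
        · rw [show (-(k : ℤ) - 1 - (-(j : ℤ) - 1)) = -((k - j - 1 : ℕ) : ℤ) - 1 by omega, hv.neg,
            if_neg (by omega), lie_zero]
      · split_ifs with h
        · rw [show ((l : ℤ) - k) = ((l - k : ℕ) : ℤ) by omega, hu.nonneg]
        · rw [show ((l : ℤ) - k) = -((k - l - 1 : ℕ) : ℤ) - 1 by omega, hu.neg,
            if_neg (by omega), zero_lie]
  · intro p hp
    simp only [Finset.mem_insert, Finset.mem_singleton, not_or] at hp
    rcases nonneg_or_neg p with ⟨q, rfl⟩ | ⟨m, rfl⟩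
    · rw [show (-(k : ℤ) - 1 - q) = -((k + q : ℕ) : ℤ) - 1 by omega, hv.neg,
        if_neg (by omega), lie_zero]
    · rw [hu.neg, if_neg (fun h => hp.1 (by rw [h])), zero_lie]

/-- Skew-symmetry of the system of operators attached to a skew-symmetric series. -/
def IsSkewSystem (β : LinearMap.BilinForm ℂ 𝔭) (G : ℕ → ℕ → Module.End ℂ 𝔭) : Prop :=
  ∀ m k a b, β (G m k a) b = -β a (G k m b)

/-- The pole of `w` picks the coefficient of tⁱ of [u, v], which gives the first three terms of
`yangBaxterCoeff`. The regular part of `w` meets the negative coefficients, and skewness moves the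
operators off `c` with a sign, which gives the last three. -/
theorem resForm_lie_isBasic (hσ : σ * σ = 1) (hG : IsSkewSystem β G) {i j l : ℕ} {a b c : 𝔭}
    {u v w : K ⊗[ℂ] 𝔭} (hu : IsBasic σ G j a u) (hv : IsBasic σ G l b v) (hw : IsBasic σ G i c w) :
    resForm (tres σ) β ⁅u, v⁆ w = β (yangBaxterCoeff G i j l a b) c := by
  -- The lowest power in [u, v] is at worst t^(-j-l-2), the product of the two poles, which is the
  -- index `k = j + l + 1`.
  have hz : ∀ k, j + l + 2 ≤ k → tcoeff 𝔭 σ (-(k : ℤ) - 1) ⁅u, v⁆ = 0 := fun k hk => by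
    rw [lie_isBasic_neg hσ hu hv, if_neg (by omega), if_neg (by omega), if_neg (by omega)]
    simp
  rw [resForm_isBasic hσ hw ⁅u, v⁆ (j + l + 2) fun k hk => by rw [hz k hk]; simp]
  have key : ∑ k ∈ Finset.range (j + l + 2), G i k (tcoeff 𝔭 σ (-(k : ℤ) - 1) ⁅u, v⁆) =
      G i (j + l + 1) ⁅a, b⁆ + ∑ p ∈ antidiagonal j, G i p.1 ⁅a, G p.2 l b⁆ +
        ∑ p ∈ antidiagonal l, G i p.1 ⁅G p.2 j a, b⁆ := by
    rw [Finset.Nat.sum_antidiagonal_eq_sum_range_succ (fun p q => G i p ⁅a, G q l b⁆),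
      Finset.Nat.sum_antidiagonal_eq_sum_range_succ (fun p q => G i p ⁅G q j a, b⁆)]
    simp only [lie_isBasic_neg hσ hu hv, map_add, Finset.sum_add_distrib, apply_ite (G i _),
      map_zero]
    rw [Finset.sum_ite_eq_of_mem' _ _ _ (by simp), ← Finset.sum_filter, ← Finset.sum_filter,
      add_comm, ← add_assoc]
    congr 1
    · congr 1
      refine Finset.sum_congr (Finset.ext fun k => ?_) fun _ _ => rfl
      simp
      omega
    · refine Finset.sum_congr (Finset.ext fun k => ?_) fun _ _ => rfl
      simp
      omega
  have h2 : ∑ k ∈ Finset.range (j + l + 2), β (tcoeff 𝔭 σ (-(k : ℤ) - 1) ⁅u, v⁆) (G k i c) =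
      -β (∑ k ∈ Finset.range (j + l + 2), G i k (tcoeff 𝔭 σ (-(k : ℤ) - 1) ⁅u, v⁆)) c := by
    rw [map_sum, LinearMap.sum_apply, ← Finset.sum_neg_distrib]
    refine Finset.sum_congr rfl fun k _ => ?_
    rw [hG, neg_neg]
  rw [h2, key, lie_isBasic_nonneg hσ hu hv, yangBaxterCoeff]
  simp only [map_add, map_sub, LinearMap.add_apply, LinearMap.sub_apply]
  ring

end Form

/-! ### Lagrangian complements -/

section Complements

variable {𝔭 : Type*} [LieRing 𝔭] [LieAlgebra ℂ 𝔭] {σ : ℤ} {β : LinearMap.BilinForm ℂ 𝔭}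
  {G : ℕ → ℕ → Module.End ℂ 𝔭}

/-- The series without negative powers of `t`. -/
def posPart (V : Type*) [AddCommGroup V] [Module ℂ V] (σ : ℤ) : Submodule ℂ (K ⊗[ℂ] V) where
  carrier := {x | ∀ k : ℕ, tcoeff V σ (-(k : ℤ) - 1) x = 0}
  add_mem' hx hy k := by rw [map_add, hx k, hy k, add_zero]
  zero_mem' k := map_zero _
  smul_mem' c x hx k := by rw [map_smul, hx k, smul_zero]

/-- The orthogonal complement of the basic elements. -/
def lagr (σ : ℤ) (β : LinearMap.BilinForm ℂ 𝔭) (G : ℕ → ℕ → Module.End ℂ 𝔭) :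
    Submodule ℂ (K ⊗[ℂ] 𝔭) where
  carrier := {x | ∀ m a u, IsBasic σ G m a u → resForm (tres σ) β x u = 0}
  add_mem' hx hy m a u hu := by
    rw [map_add, LinearMap.add_apply, hx m a u hu, hy m a u hu, add_zero]
  zero_mem' m a u hu := by rw [map_zero, LinearMap.zero_apply]
  smul_mem' c x hx m a u hu := by
    rw [map_smul, LinearMap.smul_apply, hx m a u hu, smul_zero]

/-- The condition under which all basic elements exist and span a complement. -/
def Admissible (σ : ℤ) (G : ℕ → ℕ → Module.End ℂ 𝔭) : Prop :=
  σ = 1 ∨ σ = -1 ∧ ∃ N, ∀ i k, N ≤ i ∨ N ≤ k → G i k = 0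

theorem Admissible.mul_self (h : Admissible σ G) : σ * σ = 1 := by
  rcases h with rfl | ⟨rfl, _⟩ <;> rfl

theorem resForm_posPart_isBasic (hσ : σ * σ = 1) {x u : K ⊗[ℂ] 𝔭} (hx : x ∈ posPart 𝔭 σ) {m : ℕ}
    {a : 𝔭} (hu : IsBasic σ G m a u) : resForm (tres σ) β x u = β (tcoeff 𝔭 σ m x) a := by
  rw [resForm_isBasic hσ hu x 0 fun k _ => by rw [hx k]; simp]
  simp

/-- The pairing of u(m, a) with u(k, b) is β(G k m a, b) + β(a, G m k b), so skewness of the array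
is orthogonality of the basic series. -/
theorem isBasic_mem_lagr (hσ : σ * σ = 1) (hG : IsSkewSystem β G) {m : ℕ} {a : 𝔭} {u : K ⊗[ℂ] 𝔭}
    (hu : IsBasic σ G m a u) : u ∈ lagr σ β G := by
  intro k b v hv
  rw [resForm_isBasic hσ hv u (m + 1) fun n hn => by rw [hu.neg, if_neg (by omega)]; simp,
    Finset.sum_eq_single m, hu.neg, if_pos rfl, hu.nonneg, hG, neg_add_cancel]
  · intro n _ hn
    rw [hu.neg, if_neg hn]
    simp
  · simp

theorem IsBasic.sum_neg {w : ℕ → K ⊗[ℂ] 𝔭} {c : ℕ → 𝔭} (hw : ∀ m, IsBasic σ G m (c m) (w m))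
    (N k : ℕ) : tcoeff 𝔭 σ (-(k : ℤ) - 1) (∑ m ∈ Finset.range N, w m) =
      if k < N then c k else 0 := by
  rw [map_sum, Finset.sum_congr rfl fun m _ => (hw m).neg k]
  simp

variable [FiniteDimensional ℂ 𝔭]

/-- For σ = 1 the pole bounds the support of the series; for σ = -1 it is the finite support of `G`
that does so. -/
theorem exists_isBasic (h : Admissible σ G) (m : ℕ) (a : 𝔭) : ∃ u, IsBasic σ G m a u := by
  let F : ℤ → 𝔭 := fun n => if 0 ≤ n then G n.toNat m a else if n = -m - 1 then a else 0
  obtain ⟨A, hA⟩ : ∃ A : ℤ, ∀ n, σ * n < A → F n = 0 := by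
    rcases h with rfl | ⟨rfl, N, hN⟩
    · refine ⟨-m - 1, fun n hn => ?_⟩
      simp only [F]
      rw [if_neg (by omega), if_neg (by omega)]
    · refine ⟨-N, fun n hn => ?_⟩
      simp only [F]
      rw [if_pos (by omega), hN _ _ (by omega)]
      rfl
  obtain ⟨u, hu⟩ := exists_tcoeff h.mul_self F A hA
  refine ⟨u, fun i => ?_, fun k => ?_⟩
  · rw [hu]
    simp [F]
  · rw [hu]
    simp only [F]
    rw [if_neg (by omega)]
    congr 1
    simp

/-- Pairing a regular series with basic ones reads off its coefficients. Existence of the basic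
series is a hypothesis, rather than `Admissible`, because `exists_eq_lagr` supplies them as
projections. -/
theorem eq_zero_of_mem_posPart_of_mem_lagr (hβ : β.Nondegenerate) (hσ : σ * σ = 1)
    (hex : ∀ m a, ∃ u, IsBasic σ G m a u) {x : K ⊗[ℂ] 𝔭}
    (hx : x ∈ posPart 𝔭 σ) (hx' : x ∈ lagr σ β G) : x = 0 := by
  refine ext_tcoeff hσ fun n => ?_
  rw [map_zero]
  rcases nonneg_or_neg n with ⟨m, rfl⟩ | ⟨k, rfl⟩
  · refine hβ.1 _ fun a => ?_
    obtain ⟨u, hu⟩ := hex m a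
    rw [← resForm_posPart_isBasic hσ hx hu]
    exact hx' m a u hu
  · exact hx k

/-- Elements of `lagr σ β G` are, for the purpose of pairing them with a given series, finite sums
of basic elements. -/
theorem resForm_eq_sum_isBasic (hβ : β.Nondegenerate) (h : Admissible σ G) (hG : IsSkewSystem β G)
    {x : K ⊗[ℂ] 𝔭} (hx : x ∈ lagr σ β G) (z : K ⊗[ℂ] 𝔭) :
    ∃ N₀, ∀ N, N₀ ≤ N → ∀ w : ℕ → K ⊗[ℂ] 𝔭,
      (∀ m : ℕ, IsBasic σ G m (tcoeff 𝔭 σ (-(m : ℤ) - 1) x) (w m)) →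
      resForm (tres σ) β x z = ∑ m ∈ Finset.range N, resForm (tres σ) β (w m) z := by
  have hσ := h.mul_self
  -- After subtraction of the first `N` basic series with the poles of `x`, a remainder in `lagr` is
  -- left whose negative coefficients start at index `N`.
  suffices H : ∃ N₀, ∀ N, N₀ ≤ N → ∀ y ∈ lagr σ β G,
      (∀ k : ℕ, tcoeff 𝔭 σ (-(k : ℤ) - 1) y =
        if k < N then 0 else tcoeff 𝔭 σ (-(k : ℤ) - 1) x) → resForm (tres σ) β y z = 0 by
    obtain ⟨N₀, hN₀⟩ := H
    refine ⟨N₀, fun N hN w hw => ?_⟩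
    have := hN₀ N hN (x - ∑ m ∈ Finset.range N, w m)
      (sub_mem hx (sum_mem fun m _ => isBasic_mem_lagr hσ hG (hw m))) fun k => by
        rw [map_sub, IsBasic.sum_neg hw]
        split_ifs <;> simp
    rw [map_sub, LinearMap.sub_apply, sub_eq_zero] at this
    rw [this, map_sum, LinearMap.sum_apply]
  have hex := exists_isBasic h
  rcases h with rfl | ⟨rfl, N₁, hN₁⟩
  -- For σ = 1 all poles of `x` are removed, so the remainder is regular and hence zero.
  · obtain ⟨A, hA⟩ := exists_lt_tcoeff_eq_zero (σ := 1) x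
    refine ⟨(-A).toNat, fun N hN y hy hyk => ?_⟩
    rw [eq_zero_of_mem_posPart_of_mem_lagr hβ hσ hex (fun k => ?_) hy]
    · simp
    · rw [hyk]
      split_ifs
      · rfl
      · exact hA _ (by omega)
  · obtain ⟨A, hA⟩ := exists_lt_tcoeff_eq_zero (σ := -1) z
    refine ⟨max N₁ (-A + 1).toNat, fun N hN y hy hyk => ?_⟩
    have hN' : N₁ ≤ N ∧ -A + 1 ≤ N := by omega
    -- For σ = -1 infinitely many negative powers may remain, but beyond `N₁` the operators vanish,
    -- so orthogonality to basic series kills the regular part. The powers left are too negative to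
    -- meet those of `z`.
    have hy0 : ∀ m : ℕ, tcoeff 𝔭 (-1) m y = 0 := fun m => by
      refine hβ.1 _ fun a => ?_
      obtain ⟨u, hu⟩ := hex m a
      have := hy m a u hu
      rwa [resForm_isBasic hσ hu y 0 fun k _ => ?_, Finset.range_zero, Finset.sum_empty,
        add_zero] at this
      rw [hyk]
      split_ifs with hk
      · simp
      · rw [hN₁ k m (by omega)]
        simp
    rw [resForm_eq_sum hσ y z ∅ fun p _ => ?_, Finset.sum_empty]
    rcases nonneg_or_neg p with ⟨m, rfl⟩ | ⟨k, rfl⟩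
    · rw [hy0]
      simp
    · rw [hyk]
      split_ifs with hk
      · simp
      · rw [hA (-1 - (-k - 1)) (by omega), map_zero]

/-- Expand one argument into basic series: each is orthogonal to the other argument by definition of
`lagr`. -/
theorem resForm_lagr (hβ : β.Nondegenerate) (hs : β.IsSymm) (h : Admissible σ G)
    (hG : IsSkewSystem β G) {x y : K ⊗[ℂ] 𝔭} (hx : x ∈ lagr σ β G) (hy : y ∈ lagr σ β G) :
    resForm (tres σ) β x y = 0 := by
  obtain ⟨N, hN⟩ := resForm_eq_sum_isBasic hβ h hG hx y
  choose w hw using fun m : ℕ => exists_isBasic h m (tcoeff 𝔭 σ (-(m : ℤ) - 1) x)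
  rw [hN N le_rfl w hw]
  refine Finset.sum_eq_zero fun m _ => ?_
  rw [resForm_comm hs]
  exact hy _ _ _ (hw m)

theorem mem_lagr_iff (hβ : β.Nondegenerate) (hs : β.IsSymm) (h : Admissible σ G)
    (hG : IsSkewSystem β G) (x : K ⊗[ℂ] 𝔭) :
    x ∈ lagr σ β G ↔ ∀ y ∈ lagr σ β G, resForm (tres σ) β x y = 0 :=
  ⟨fun hx _ hy => resForm_lagr hβ hs h hG hx hy,
    fun hx _ _ u hu => hx u (isBasic_mem_lagr h.mul_self hG hu)⟩

theorem isCompl_posPart_lagr (hβ : β.Nondegenerate) (h : Admissible σ G)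
    (hG : IsSkewSystem β G) : IsCompl (posPart 𝔭 σ) (lagr σ β G) := by
  have hσ := h.mul_self
  have hex := exists_isBasic h
  refine ⟨Submodule.disjoint_def.2 fun x hx hx' =>
    eq_zero_of_mem_posPart_of_mem_lagr hβ hσ hex hx hx', ?_⟩
  rw [codisjoint_iff, eq_top_iff]
  rintro x -
  choose w hw using fun m : ℕ => exists_isBasic h m (tcoeff 𝔭 σ (-(m : ℤ) - 1) x)
  have hmem : ∀ N, ∑ m ∈ Finset.range N, w m ∈ lagr σ β G := fun N =>
    sum_mem fun m _ => isBasic_mem_lagr hσ hG (hw m)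
  rcases h with rfl | ⟨rfl, N, hN⟩
  · obtain ⟨A, hA⟩ := exists_lt_tcoeff_eq_zero (σ := 1) x
    refine Submodule.mem_sup.2 ⟨x - ∑ m ∈ Finset.range (-A).toNat, w m, fun k => ?_, _,
      hmem (-A).toNat, sub_add_cancel _ _⟩
    rw [map_sub, IsBasic.sum_neg hw]
    split_ifs
    · simp
    · rw [hA _ (by omega), sub_zero]
  · set y := x - ∑ m ∈ Finset.range N, w m with hy
    have hyk : ∀ k : ℕ, k < N → tcoeff 𝔭 (-1) (-(k : ℤ) - 1) y = 0 := fun k hk => by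
      rw [hy, map_sub, IsBasic.sum_neg hw, if_pos hk, sub_self]
    -- The negative part `z` of the remainder involves only indices at which all operators vanish,
    -- so it lies in `lagr` on its own.
    obtain ⟨z, hz⟩ := exists_tcoeff (V := 𝔭) hσ
      (fun n => if 0 ≤ n then 0 else tcoeff 𝔭 (-1) n y) 0 fun n hn => if_pos (by omega)
    have hz1 : ∀ k : ℕ, tcoeff 𝔭 (-1) (-(k : ℤ) - 1) z = tcoeff 𝔭 (-1) (-(k : ℤ) - 1) y :=
      fun k => by rw [hz, if_neg (by omega)]
    have hzm : z ∈ lagr (-1) β G := fun m a u hu => by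
      rw [resForm_isBasic hσ hu z 0 fun k _ => ?_, hz, if_pos (by omega)]
      · simp
      · rw [hz1]
        rcases lt_or_ge k N with hk | hk
        · rw [hyk k hk]
          simp
        · rw [hN k m (Or.inl hk)]
          simp
    refine Submodule.mem_sup.2 ⟨y - z, fun k => ?_, _, add_mem hzm (hmem N), ?_⟩
    · rw [map_sub, hz1, sub_self]
    · rw [hy]
      abel

/-- The pairing of `z` with [x, y] is cyclic by invariance, so `x` and `y` can be expanded one after
the other against a fixed series. The lower bound `M` lets these truncations be matched with those
of another sum. -/
theorem resForm_lie_lagr_eq_sum (hβ : β.Nondegenerate) (hs : β.IsSymm) (hi : β.lieInvariant 𝔭)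
    (h : Admissible σ G) (hG : IsSkewSystem β G) {x y : K ⊗[ℂ] 𝔭} (hx : x ∈ lagr σ β G)
    (hy : y ∈ lagr σ β G) (z : K ⊗[ℂ] 𝔭) (w w' : ℕ → K ⊗[ℂ] 𝔭)
    (hw : ∀ m : ℕ, IsBasic σ G m (tcoeff 𝔭 σ (-(m : ℤ) - 1) x) (w m))
    (hw' : ∀ m : ℕ, IsBasic σ G m (tcoeff 𝔭 σ (-(m : ℤ) - 1) y) (w' m)) (M : ℕ) :
    ∃ N N', M ≤ N ∧ M ≤ N' ∧ resForm (tres σ) β z ⁅x, y⁆ = ∑ m ∈ Finset.range N,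
      ∑ k ∈ Finset.range N', resForm (tres σ) β z ⁅w m, w' k⁆ := by
  have hcyc : ∀ a b c : K ⊗[ℂ] 𝔭, resForm (tres σ) β a ⁅b, c⁆ = resForm (tres σ) β b ⁅c, a⁆ :=
    fun a b c => by rw [← resForm_lie_assoc hi b c a, resForm_comm hs]
  obtain ⟨N₀, hN₀⟩ := resForm_eq_sum_isBasic hβ h hG hx ⁅y, z⁆
  choose N' hN' using fun m => resForm_eq_sum_isBasic hβ h hG hy ⁅z, w m⁆
  set N := max N₀ M with hN
  -- The truncation of the expansion of `y` depends on `m`; a common one is taken for the finitely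
  -- many `m` involved.
  refine ⟨N, max ((Finset.range N).sup N') M, le_max_right _ _, le_max_right _ _, ?_⟩
  rw [hcyc, hN₀ N (le_max_left _ _) w hw]
  refine Finset.sum_congr rfl fun m hm => ?_
  rw [hcyc, hN' m _ ((Finset.le_sup (f := N') hm).trans (le_max_left _ _)) w' hw']
  refine Finset.sum_congr rfl fun k _ => ?_
  rw [hcyc]

theorem lie_mem_lagr (hβ : β.Nondegenerate) (hs : β.IsSymm) (hi : β.lieInvariant 𝔭)
    (h : Admissible σ G) (hG : IsSkewSystem β G)
    (hE : ∀ i j l a b, yangBaxterCoeff G i j l a b = 0) {x y : K ⊗[ℂ] 𝔭} (hx : x ∈ lagr σ β G)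
    (hy : y ∈ lagr σ β G) : ⁅x, y⁆ ∈ lagr σ β G := by
  intro i c u hu
  choose w hw using fun m : ℕ => exists_isBasic h m (tcoeff 𝔭 σ (-(m : ℤ) - 1) x)
  choose w' hw' using fun m : ℕ => exists_isBasic h m (tcoeff 𝔭 σ (-(m : ℤ) - 1) y)
  obtain ⟨N, N', -, -, hN⟩ := resForm_lie_lagr_eq_sum hβ hs hi h hG hx hy u w w' hw hw' 0
  rw [resForm_comm hs, hN]
  refine Finset.sum_eq_zero fun m _ => Finset.sum_eq_zero fun k _ => ?_
  rw [resForm_comm hs, resForm_lie_isBasic h.mul_self hG (hw m) (hw' k) hu, hE]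
  simp

theorem yangBaxterCoeff_eq_zero_of_lie_mem_lagr (hβ : β.Nondegenerate)
    (h : Admissible σ G) (hG : IsSkewSystem β G)
    (hlie : ∀ x ∈ lagr σ β G, ∀ y ∈ lagr σ β G, ⁅x, y⁆ ∈ lagr σ β G) (i j l : ℕ) (a b : 𝔭) :
    yangBaxterCoeff G i j l a b = 0 := by
  refine hβ.1 _ fun c => ?_
  obtain ⟨u, hu⟩ := exists_isBasic h j a
  obtain ⟨v, hv⟩ := exists_isBasic h l b
  obtain ⟨w, hw⟩ := exists_isBasic h i c
  rw [← resForm_lie_isBasic h.mul_self hG hu hv hw]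
  exact hlie u (isBasic_mem_lagr h.mul_self hG hu) v (isBasic_mem_lagr h.mul_self hG hv) _ _ _ hw

/-! ### The system of operators of a Lagrangian complement -/

/-- A skew-symmetric system of operators with finite columns that is bounded on every sequence
is finitely supported. -/
theorem exists_finite_support (hβ : β.Nondegenerate) (hG : IsSkewSystem β G) (D : ℕ → ℕ)
    (hD : ∀ i k, D k ≤ i → G i k = 0)
    (hb : ∀ b : ℕ → 𝔭, ∃ N, ∀ k, N ≤ k → ∀ a,
      ∑ m ∈ Finset.range (D k), β (b m) (G m k a) = 0) :
    ∃ N, ∀ i k, N ≤ i ∨ N ≤ k → G i k = 0 := by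
  classical
  have hswap : ∀ i k, G i k = 0 → G k i = 0 := fun i k h => LinearMap.ext fun a =>
    hβ.1 _ fun b => by rw [hG, h]; simp
  let e := Module.finBasis ℂ 𝔭
  let toVec : (Fin (Module.finrank ℂ 𝔭) → ℂ) →ₗ[ℂ] 𝔭 := e.equivFun.symm.toLinearMap
  -- The sequences that are bounded from index `N` on. Each condition is a finite sum, hence closed
  -- in the product topology, and by hypothesis these sets cover the whole space.
  let F : ℕ → Set (ℕ → Fin (Module.finrank ℂ 𝔭) → ℂ) := fun N =>
    {b | ∀ k, N ≤ k → ∀ a, ∑ m ∈ Finset.range (D k), β (toVec (b m)) (G m k a) = 0}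
  have hclosed : ∀ N, IsClosed (F N) := fun N => by
    simp only [F, Set.ofPred_forall]
    refine isClosed_iInter fun k => isClosed_iInter fun _ => isClosed_iInter fun a => ?_
    refine isClosed_eq (continuous_finsetSum _ fun m _ => ?_) continuous_const
    exact (LinearMap.continuous_of_finiteDimensional ((β.flip (G m k a)) ∘ₗ toVec)).comp
      (continuous_apply m)
  have hunion : ⋃ N, F N = Set.univ := Set.eq_univ_of_forall fun b => by
    obtain ⟨N, hN⟩ := hb fun m => toVec (b m)
    exact Set.mem_iUnion.2 ⟨N, hN⟩
  -- By Baire, one of these sets has an interior point; a neighbourhood of it constrains only the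
  -- coordinates in a finite set `I`.
  obtain ⟨N, b, hbN⟩ := nonempty_interior_of_iUnion_of_closed hclosed hunion
  obtain ⟨I, U, hU, hsub⟩ := isOpen_pi_iff.1 isOpen_interior b hbN
  have hzero : ∀ m k, m ∉ I → N ≤ k → G m k = 0 := by
    intro m k hm hk
    rcases le_or_gt (D k) m with hmk | hmk
    · exact hD m k hmk
    refine LinearMap.ext fun a => hβ.2 _ fun v => ?_
    -- Coordinate `m` is outside `I`, so it may be changed freely; the difference of the two
    -- conditions isolates one operator.
    have h1 : b ∈ F N := interior_subset hbN
    have h2 : Function.update b m (b m + e.equivFun v) ∈ F N :=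
      interior_subset (hsub fun i hi => by
        have : i ≠ m := fun h => hm (h ▸ hi)
        rw [Function.update_of_ne this]
        exact (hU i hi).2)
    have h3 := h1 k hk a
    have h4 := h2 k hk a
    rw [← Finset.add_sum_erase _ _ (Finset.mem_range.2 hmk)] at h3 h4
    rw [Finset.sum_congr rfl fun i hi => by
      rw [Function.update_of_ne (Finset.ne_of_mem_erase hi)], Function.update_self, map_add,
      map_add, LinearMap.add_apply, add_right_comm, h3, zero_add] at h4
    simpa [toVec] using h4
  -- The finitely many rows in `I` escape the argument, but by skewness they are adjoint to columns,
  -- which are finite.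
  obtain ⟨M, hM⟩ : ∃ M, N ≤ M ∧ ∀ i ∈ I, D i ≤ M :=
    ⟨max N (I.sup D), le_max_left _ _, fun i hi => (Finset.le_sup hi).trans (le_max_right _ _)⟩
  have hfin : ∀ i k, M ≤ k → G i k = 0 := fun i k hk => by
    by_cases hi : i ∈ I
    · exact hswap _ _ (hD k i ((hM.2 i hi).trans hk))
    · exact hzero i k hi (hM.1.trans hk)
  exact ⟨M, fun i k h => h.elim (fun h => hswap _ _ (hfin k i h)) (hfin i k)⟩

/-- Project the monomials t^(-m-1) a onto V along the regular series; the regular coefficients of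
the results define G, and the projections are its basic series. As V is isotropic, G is skew and V
lies in `lagr`. Equality holds because `lagr` contains no nonzero regular series. -/
theorem exists_eq_lagr (hβ : β.Nondegenerate) (hσ : σ = 1 ∨ σ = -1)
    (V : Submodule ℂ (K ⊗[ℂ] 𝔭)) (hV : ∀ v, v ∈ V ↔ ∀ w ∈ V, resForm (tres σ) β v w = 0)
    (hC : IsCompl (posPart 𝔭 σ) V) :
    ∃ G, IsSkewSystem β G ∧ Admissible σ G ∧ V = lagr σ β G := by
  have hσ' : σ * σ = 1 := by rcases hσ with rfl | rfl <;> rfl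
  have hmono : ∀ m : ℕ, ∃ f : 𝔭 →ₗ[ℂ] K ⊗[ℂ] 𝔭, ∀ a n, tcoeff 𝔭 σ n (f a) =
      if n = -(m : ℤ) - 1 then a else 0 := fun m => by
    refine ⟨TensorProduct.mk ℂ K 𝔭 (laurentPow (σ * (-(m : ℤ) - 1))), fun a n => ?_⟩
    rw [TensorProduct.mk_apply, tcoeff_tmul, laurentCoeff_apply, laurentPow]
    have : HahnSeries.coeff (HahnSeries.single (σ * (-(m : ℤ) - 1)) (1 : ℂ)) (σ * n) =
        if n = -(m : ℤ) - 1 then 1 else 0 := by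
      rw [HahnSeries.coeff_single]
      congr 1
      exact propext (by rcases hσ with rfl | rfl <;> constructor <;> intro h <;> omega)
    rw [this]
    split_ifs <;> simp
  choose f hf using hmono
  let π := V.projectionOnto (posPart 𝔭 σ) hC.symm
  have hπ : ∀ x, (π x : K ⊗[ℂ] 𝔭) ∈ V ∧ ∀ k : ℕ, tcoeff 𝔭 σ (-(k : ℤ) - 1) (π x) =
      tcoeff 𝔭 σ (-(k : ℤ) - 1) x := fun x => by
    refine ⟨(π x).2, fun k => ?_⟩
    obtain ⟨p, hp, v, hv, rfl⟩ := Submodule.mem_sup.1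
      ((codisjoint_iff.1 hC.codisjoint).ge (Submodule.mem_top (x := x)))
    have h1 : π (p + v) = ⟨v, hv⟩ := by
      rw [map_add, Submodule.projectionOnto_apply_of_mem_right _ hp, zero_add]
      exact Submodule.projectionOnto_apply_left hC.symm ⟨v, hv⟩
    rw [h1, map_add, hp k, zero_add]
  let G : ℕ → ℕ → Module.End ℂ 𝔭 := fun i m => tcoeff 𝔭 σ i ∘ₗ V.subtype ∘ₗ π ∘ₗ f m
  have hW : ∀ m a, IsBasic σ G m a (π (f m a)) := fun m a => ⟨fun i => rfl, fun k => by
    rw [(hπ _).2, hf]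
    congr 1
    simp⟩
  have hle : V ≤ lagr σ β G := fun v hv m a u hu => by
    have : u = π (f m a) := ext_tcoeff hσ' fun n => by
      rcases nonneg_or_neg n with ⟨i, rfl⟩ | ⟨k, rfl⟩
      · rw [hu.nonneg, (hW m a).nonneg]
      · rw [hu.neg, (hW m a).neg]
    rw [this]
    exact (hV v).1 hv _ (hπ _).1
  have hG : IsSkewSystem β G := fun m k a b => by
    have := hle (hπ (f k a)).1 m b _ (hW m b)
    rw [resForm_isBasic hσ' (hW m b) _ (k + 1) fun n hn => by
      rw [(hW k a).neg, if_neg (by omega)]; simp, Finset.sum_eq_single k, (hW k a).neg,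
      if_pos rfl, (hW k a).nonneg] at this
    · exact eq_neg_of_add_eq_zero_left this
    · intro n _ hn
      rw [(hW k a).neg, if_neg hn]
      simp
    · simp
  refine ⟨G, hG, ?_, ?_⟩
  · rcases hσ with rfl | rfl
    · exact Or.inl rfl
    · refine Or.inr ⟨rfl, ?_⟩
      have hD : ∀ k, ∃ D, ∀ i, D ≤ i → G i k = 0 := fun k => by
        choose A hA using fun j =>
          exists_lt_tcoeff_eq_zero (σ := -1) (π (f k (Module.finBasis ℂ 𝔭 j)) : K ⊗[ℂ] 𝔭)
        refine ⟨Finset.univ.sup fun j => (-A j + 1).toNat, fun i hi =>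
          (Module.finBasis ℂ 𝔭).ext fun j => hA j i ?_⟩
        have := (Finset.le_sup (f := fun j => (-A j + 1).toNat) (Finset.mem_univ j)).trans hi
        omega
      choose D hD using hD
      refine exists_finite_support hβ hG D (fun i k h => hD k i h) fun b => ?_
      -- In t⁻¹ any sequence `b` is the sequence of negative coefficients of a series. Its
      -- projection to V has bounded powers of t, so for large `k` orthogonality to the basic series
      -- of index `k` leaves only the sum over `b`.
      obtain ⟨x, hx⟩ := exists_tcoeff (V := 𝔭) hσ'
        (fun n => if 0 ≤ n then 0 else b (-n - 1).toNat) 0 fun n hn => if_pos (by omega)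
      obtain ⟨A, hA⟩ := exists_lt_tcoeff_eq_zero (σ := -1) (π x : K ⊗[ℂ] 𝔭)
      refine ⟨(-A + 1).toNat, fun k hk a => ?_⟩
      have := hle (hπ x).1 k a _ (hW k a)
      rw [resForm_isBasic hσ' (hW k a) _ (D k) fun n hn => by rw [hD k n hn]; simp,
        hA k (by omega), map_zero, LinearMap.zero_apply, zero_add] at this
      rw [← this]
      refine Finset.sum_congr rfl fun m _ => ?_
      rw [(hπ x).2, hx, if_neg (by omega)]
      congr 3
      omega
  · refine le_antisymm hle fun x hx => ?_
    obtain ⟨p, hp, v, hv, rfl⟩ := Submodule.mem_sup.1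
      ((codisjoint_iff.1 hC.codisjoint).ge (Submodule.mem_top (x := x)))
    have : p = 0 := eq_zero_of_mem_posPart_of_mem_lagr hβ hσ' (fun m a => ⟨_, hW m a⟩) hp
      (by simpa using sub_mem hx (hle hv))
    rwa [this, zero_add]

end Complements

/-! ### The cobracket of a series -/

section PowerSeriesCoefficients

variable {V : Type*} [AddCommGroup V] [Module ℂ V]

/-- The coefficient of `tⁿ` of an element of `V[[t]]`. -/
def powCoeff (V : Type*) [AddCommGroup V] [Module ℂ V] (n : ℕ) : O ⊗[ℂ] V →ₗ[ℂ] V :=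
  evalCoef V (PowerSeries.coeff (R := ℂ) n)

theorem powCoeff_tmul (n : ℕ) (f : O) (v : V) :
    powCoeff V n (f ⊗ₜ v) = PowerSeries.coeff n f • v := evalCoef_tmul _ _ _

theorem powToLaurent_apply (f : O) :
    powToLaurent f = HahnSeries.ofPowerSeries ℤ ℂ f := rfl

theorem laurentCoeff_powToLaurent (n : ℕ) (f : O) :
    laurentCoeff n (powToLaurent f) = PowerSeries.coeff n f :=
  HahnSeries.ofPowerSeries_apply_coeff f n

theorem laurentCoeff_powToLaurent_neg (k : ℕ) (f : O) :
    laurentCoeff (-(k : ℤ) - 1) (powToLaurent f) = 0 := by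
  rw [laurentCoeff_apply, powToLaurent_apply, HahnSeries.ofPowerSeries_apply]
  refine HahnSeries.embDomain_of_notMem_range ?_
  rintro ⟨n, hn⟩
  simp at hn
  omega

theorem tcoeff_powToLaurent (n : ℕ) (x : O ⊗[ℂ] V) :
    tcoeff V 1 n (coef V powToLaurent x) = powCoeff V n x := by
  induction x with
  | zero => simp
  | tmul f v => rw [coef_tmul, tcoeff_tmul, one_mul, laurentCoeff_powToLaurent, powCoeff_tmul]
  | add x y hx hy => simp only [map_add, hx, hy]

theorem tcoeff_powToLaurent_neg (k : ℕ) (x : O ⊗[ℂ] V) :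
    tcoeff V 1 (-(k : ℤ) - 1) (coef V powToLaurent x) = 0 := by
  induction x with
  | zero => simp
  | tmul f v => rw [coef_tmul, tcoeff_tmul, one_mul, laurentCoeff_powToLaurent_neg, zero_smul]
  | add x y hx hy => simp only [map_add, hx, hy, add_zero]

theorem range_powToLaurent [FiniteDimensional ℂ V] :
    LinearMap.range (coef V powToLaurent) = posPart V 1 := by
  ext x
  constructor
  · rintro ⟨y, rfl⟩ k
    exact tcoeff_powToLaurent_neg k y
  · intro hx
    obtain ⟨y, hy⟩ := exists_evalCoef (A := O) (V := V) (fun n => PowerSeries.coeff n)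
      (fun n : ℕ => tcoeff V 1 n x) fun φ =>
        ⟨PowerSeries.mk fun n => φ (tcoeff V 1 n x), fun n => PowerSeries.coeff_mk _ _⟩
    refine ⟨y, ext_tcoeff (σ := 1) rfl fun n => ?_⟩
    rcases nonneg_or_neg n with ⟨m, rfl⟩ | ⟨k, rfl⟩
    · rw [tcoeff_powToLaurent]
      exact hy m
    · rw [tcoeff_powToLaurent_neg, hx k]

theorem coeff_toMvPowerSeries {n : ℕ} (i : Fin n) (f : O) (d : Fin n →₀ ℕ) :
    MvPowerSeries.coeff d (PowerSeries.toMvPowerSeries i f) =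
      if d = Finsupp.single i (d i) then PowerSeries.coeff (d i) f else 0 := by
  let e : Unit ↪ Fin n := ⟨fun _ => i, fun _ _ _ => rfl⟩
  have he : ∀ c : Unit →₀ ℕ, Finsupp.mapDomain (fun _ : Unit => i) c = Finsupp.single i (c ()) := by
    intro c
    rw [Finsupp.unique_single c, Finsupp.mapDomain_single]
    simp
  split_ifs with h
  · have := MvPowerSeries.coeff_embDomain_rename (R := ℂ) e f (Finsupp.single () (d i))
    rw [Finsupp.embDomain_single] at this
    rw [h]
    refine this.trans ?_
    simp [PowerSeries.coeff]
  · refine MvPowerSeries.coeff_rename_eq_zero (fun _ : Unit => i) f ?_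
    rintro ⟨c, rfl⟩
    refine h ?_
    rw [he]
    simp

/-- `f ↦ (f(t₁) - f(t₂)) / (t₁ - t₂)`. -/
def divDiff : O →ₗ[ℂ] Ser 2 where
  toFun f := fun d => PowerSeries.coeff (d 0 + d 1 + 1) f
  map_add' f g := by funext d; exact map_add (PowerSeries.coeff _) f g
  map_smul' c f := by funext d; exact map_smul (PowerSeries.coeff _) c f

theorem X_sub_X_mul_divDiff (f : O) : (MvPowerSeries.X 0 - MvPowerSeries.X 1) * divDiff f =
    PowerSeries.toMvPowerSeries (0 : Fin 2) f - PowerSeries.toMvPowerSeries (1 : Fin 2) f := by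
  have key : ∀ (x : Fin 2) (d : Fin 2 →₀ ℕ), MvPowerSeries.coeff d (MvPowerSeries.X x * divDiff f) =
      if d x = 0 then 0 else PowerSeries.coeff (d 0 + d 1) f := by
    intro x d
    rw [MvPowerSeries.X_def, MvPowerSeries.coeff_monomial_mul]
    simp only [Finsupp.single_le_iff, one_mul]
    by_cases h : d x = 0
    · rw [if_neg (by omega), if_pos h]
    · rw [if_pos (by omega), if_neg h]
      change PowerSeries.coeff _ f = _
      congr 2
      fin_cases x
      · simp at h ⊢
        omega
      · simp at h ⊢
        omega
  have hs : ∀ (d : Fin 2 →₀ ℕ), (d = Finsupp.single 0 (d 0) ↔ d 1 = 0) ∧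
      (d = Finsupp.single 1 (d 1) ↔ d 0 = 0) := fun d => by
    constructor <;> constructor <;> intro h
    · rw [h]; simp
    · ext x; fin_cases x <;> simp [h]
    · rw [h]; simp
    · ext x; fin_cases x <;> simp [h]
  ext d
  rw [sub_mul, map_sub, map_sub, key, key, coeff_toMvPowerSeries, coeff_toMvPowerSeries]
  simp only [(hs d).1, (hs d).2]
  by_cases h0 : d 0 = 0 <;> by_cases h1 : d 1 = 0 <;> simp [h0, h1]

theorem powCoeff_smul_divDiff (x : O ⊗[ℂ] V) :
    (MvPowerSeries.X 0 - MvPowerSeries.X 1 : Ser 2) • divDiff.rTensor V x =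
      coef V (PowerSeries.toMvPowerSeries 0) x - coef V (PowerSeries.toMvPowerSeries 1) x := by
  induction x with
  | zero => simp
  | tmul f v =>
    rw [LinearMap.rTensor_tmul, TensorProduct.smul_tmul', coef_tmul, coef_tmul,
      ← TensorProduct.sub_tmul, smul_eq_mul, X_sub_X_mul_divDiff]
  | add x y hx hy => simp only [map_add, smul_add, hx, hy]; abel

theorem coeffTwo_divDiff (m k : ℕ) (x : O ⊗[ℂ] V) :
    coeffTwo V m k (divDiff.rTensor V x) = powCoeff V (m + k + 1) x := by
  rw [coeffTwo_eq, evalCoef_rTensor, powCoeff]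
  congr 2
  ext f
  change PowerSeries.coeff _ f = _
  simp

end PowerSeriesCoefficients

/-! ### The coboundary of C / (t₁ - t₂) + h. -/

section Cobracket

variable {𝔭 : Type*} [LieRing 𝔭] [LieAlgebra ℂ 𝔭]

theorem coef_lie {A B : Type*} [CommRing A] [Algebra ℂ A] [CommRing B] [Algebra ℂ B]
    (φ : A →ₐ[ℂ] B) (x y : A ⊗[ℂ] 𝔭) : coef 𝔭 φ ⁅x, y⁆ = ⁅coef 𝔭 φ x, coef 𝔭 φ y⁆ := by
  rw [lie_eq_ext, lie_eq_ext, coef_ext]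

theorem coef_act {A B : Type*} [CommRing A] [Algebra ℂ A] [CommRing B] [Algebra ℂ B]
    (φ : A →ₐ[ℂ] B) (x y : A ⊗[ℂ] 𝔭) (s : A ⊗[ℂ] (𝔭 ⊗[ℂ] 𝔭)) :
    coef _ φ (act x y s) = act (coef 𝔭 φ x) (coef 𝔭 φ y) (coef _ φ s) := by
  rw [act, act, map_add, coef_ext, coef_ext]

theorem legOne_lie (x y : 𝔭) (s : 𝔭 ⊗[ℂ] 𝔭) :
    legOne 𝔭 ⁅x, y⁆ s = legOne 𝔭 x (legOne 𝔭 y s) - legOne 𝔭 y (legOne 𝔭 x s) := by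
  induction s with
  | zero => simp
  | tmul a b => simp only [legOne_apply, lie_lie, TensorProduct.sub_tmul]
  | add x y hx hy => simp only [map_add, hx, hy]; abel

theorem legTwo_lie (x y : 𝔭) (s : 𝔭 ⊗[ℂ] 𝔭) :
    legTwo 𝔭 ⁅x, y⁆ s = legTwo 𝔭 x (legTwo 𝔭 y s) - legTwo 𝔭 y (legTwo 𝔭 x s) := by
  induction s with
  | zero => simp
  | tmul a b => simp only [legTwo_apply, lie_lie, TensorProduct.tmul_sub]
  | add x y hx hy => simp only [map_add, hx, hy]; abel

theorem legOne_legTwo (x y : 𝔭) (s : 𝔭 ⊗[ℂ] 𝔭) :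
    legOne 𝔭 x (legTwo 𝔭 y s) = legTwo 𝔭 y (legOne 𝔭 x s) := by
  induction s with
  | zero => simp
  | tmul a b => simp only [legTwo_apply, legOne_apply]
  | add x y hx hy => simp only [map_add, hx, hy]

section ActLie

variable {A : Type*} [CommRing A] [Algebra ℂ A]

theorem ext_legOne_lie (x y : A ⊗[ℂ] 𝔭) (s : A ⊗[ℂ] (𝔭 ⊗[ℂ] 𝔭)) :
    ext A (legOne 𝔭) ⁅x, y⁆ s = ext A (legOne 𝔭) x (ext A (legOne 𝔭) y s) -
      ext A (legOne 𝔭) y (ext A (legOne 𝔭) x s) := by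
  induction x with
  | zero => simp
  | tmul f a =>
    induction y with
    | zero => simp
    | tmul g b =>
      induction s with
      | zero => simp
      | tmul h t =>
        rw [LieAlgebra.ExtendScalars.bracket_tmul]
        simp only [ext_tmul, legOne_lie, TensorProduct.tmul_sub]
        rw [mul_assoc, mul_left_comm g f h]
      | add x y hx hy => simp only [map_add, hx, hy]; abel
    | add x y hx hy => simp only [map_add, lie_add, LinearMap.add_apply, hx, hy]; abel
  | add x y hx hy => simp only [map_add, add_lie, LinearMap.add_apply, hx, hy]; abel

theorem ext_legTwo_lie (x y : A ⊗[ℂ] 𝔭) (s : A ⊗[ℂ] (𝔭 ⊗[ℂ] 𝔭)) :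
    ext A (legTwo 𝔭) ⁅x, y⁆ s = ext A (legTwo 𝔭) x (ext A (legTwo 𝔭) y s) -
      ext A (legTwo 𝔭) y (ext A (legTwo 𝔭) x s) := by
  induction x with
  | zero => simp
  | tmul f a =>
    induction y with
    | zero => simp
    | tmul g b =>
      induction s with
      | zero => simp
      | tmul h t =>
        rw [LieAlgebra.ExtendScalars.bracket_tmul]
        simp only [ext_tmul, legTwo_lie, TensorProduct.tmul_sub]
        rw [mul_assoc, mul_left_comm g f h]
      | add x y hx hy => simp only [map_add, hx, hy]; abel
    | add x y hx hy => simp only [map_add, lie_add, LinearMap.add_apply, hx, hy]; abel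
  | add x y hx hy => simp only [map_add, add_lie, LinearMap.add_apply, hx, hy]; abel

theorem ext_legOne_legTwo (x y : A ⊗[ℂ] 𝔭) (s : A ⊗[ℂ] (𝔭 ⊗[ℂ] 𝔭)) :
    ext A (legOne 𝔭) x (ext A (legTwo 𝔭) y s) = ext A (legTwo 𝔭) y (ext A (legOne 𝔭) x s) := by
  induction x with
  | zero => simp
  | tmul f a =>
    induction y with
    | zero => simp
    | tmul g b =>
      induction s with
      | zero => simp
      | tmul h t => simp only [ext_tmul, legOne_legTwo, mul_left_comm f g h]
      | add x y hx hy => simp only [map_add, hx, hy]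
    | add x y hx hy => simp only [map_add, LinearMap.add_apply, hx, hy]
  | add x y hx hy => simp only [map_add, LinearMap.add_apply, hx, hy]

/-- The two legs act by commuting representations, so this is again a representation; it makes every
coboundary a cocycle. -/
theorem act_lie (x y x' y' : A ⊗[ℂ] 𝔭) (s : A ⊗[ℂ] (𝔭 ⊗[ℂ] 𝔭)) :
    act ⁅x, y⁆ ⁅x', y'⁆ s = act x x' (act y y' s) - act y y' (act x x' s) := by
  simp only [act, map_add, ext_legOne_lie, ext_legTwo_lie, ext_legOne_legTwo]
  abel

end ActLie

variable [FiniteDimensional ℂ 𝔭] {β : LinearMap.BilinForm ℂ 𝔭} (hβ : β.Nondegenerate)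

/-- The map `x ↦ [r, x(t₁) ⊗ 1 + 1 ⊗ x(t₂)]` for `r = C / (t₁ - t₂) + h`. -/
def cobracket (hβ : β.Nondegenerate) (h : Ser 2 ⊗[ℂ] (𝔭 ⊗[ℂ] 𝔭)) :
    O ⊗[ℂ] 𝔭 →ₗ[ℂ] Ser 2 ⊗[ℂ] (𝔭 ⊗[ℂ] 𝔭) :=
  -(((legOne 𝔭).flip (casimir β hβ)).lTensor (Ser 2) ∘ₗ divDiff.rTensor 𝔭) -
    (((ext (Ser 2) (legOne 𝔭)).flip h) ∘ₗ atVar 0 + ((ext (Ser 2) (legTwo 𝔭)).flip h) ∘ₗ atVar 1)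

theorem cobracket_apply (h : Ser 2 ⊗[ℂ] (𝔭 ⊗[ℂ] 𝔭)) (x : O ⊗[ℂ] 𝔭) :
    cobracket hβ h x = -((legOne 𝔭).flip (casimir β hβ)).lTensor (Ser 2) (divDiff.rTensor 𝔭 x) -
      act (atVar 0 x) (atVar 1 x) h := rfl

/-- Invariance turns [x(t₁) ⊗ 1 + 1 ⊗ x(t₂), C] into [(x(t₁) - x(t₂)) ⊗ 1, C], which is divisible by
t₁ - t₂. -/
theorem coef_cobracket (hi : β.lieInvariant 𝔭) (h : Ser 2 ⊗[ℂ] (𝔭 ⊗[ℂ] 𝔭)) (x : O ⊗[ℂ] 𝔭) :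
    coef _ (serToFld 2) (cobracket hβ h x) =
      -act (coef _ (serToFld 2) (atVar 0 x)) (coef _ (serToFld 2) (atVar 1 x))
        (yang β hβ + coef _ (serToFld 2) h) := by
  have hC : (legTwo 𝔭).flip (casimir β hβ) = -(legOne 𝔭).flip (casimir β hβ) :=
    LinearMap.ext fun a => legTwo_casimir hβ hi a
  have hD : (var 0 - var 1 : Fld 2)⁻¹ • (coef 𝔭 (serToFld 2) (atVar 0 x) -
      coef 𝔭 (serToFld 2) (atVar 1 x)) = coef 𝔭 (serToFld 2) (divDiff.rTensor 𝔭 x) := by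
    rw [← map_sub]
    change _ • coef 𝔭 _ (coef 𝔭 _ x - coef 𝔭 _ x) = _
    rw [← powCoeff_smul_divDiff, coef_smul, map_sub, smul_smul]
    exact (congrArg (· • coef 𝔭 (serToFld 2) _)
      (inv_mul_cancel₀ (var_sub_ne_zero (by decide)))).trans (one_smul _ _)
  rw [cobracket_apply, map_sub, map_neg, coef_act, ← lTensor_coef, ← hD]
  simp only [act, map_add, yang, ext_tmul_right, hC, LinearMap.lTensor_neg, LinearMap.neg_apply,
    smul_neg, lTensor_smul_eq, map_sub, smul_sub]
  abel

theorem cobracket_lie (hi : β.lieInvariant 𝔭) (h : Ser 2 ⊗[ℂ] (𝔭 ⊗[ℂ] 𝔭)) (x y : O ⊗[ℂ] 𝔭) :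
    cobracket hβ h ⁅x, y⁆ = act (atVar 0 x) (atVar 1 x) (cobracket hβ h y) -
      act (atVar 0 y) (atVar 1 y) (cobracket hβ h x) := by
  refine coef_injective (serToFld_injective 2) ?_
  have hneg : ∀ (u v : Fld 2 ⊗[ℂ] 𝔭) s, act u v (-s) = -act u v s := fun u v s => by
    simp only [act, map_neg]
    abel
  rw [map_sub, coef_act, coef_act, coef_cobracket hβ hi, coef_cobracket hβ hi,
    coef_cobracket hβ hi, atVar, atVar, coef_lie, coef_lie, coef_lie, coef_lie, act_lie, hneg, hneg]
  abel

theorem serCoeff_atVar {V : Type*} [AddCommGroup V] [Module ℂ V] {n : ℕ} (i : Fin n)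
    (d : Fin n →₀ ℕ) (x : O ⊗[ℂ] V) :
    serCoeff V d (coef V (PowerSeries.toMvPowerSeries i) x) =
      if d = Finsupp.single i (d i) then powCoeff V (d i) x else 0 := by
  induction x with
  | zero => simp
  | tmul f v =>
    rw [coef_tmul, serCoeff, evalCoef_tmul, coeff_toMvPowerSeries, powCoeff_tmul]
    simp
  | add x y hx hy =>
    rw [map_add, map_add, hx, hy]
    split_ifs <;> simp

theorem coeffTwo_ext_atVar_zero {X Y Z : Type*} [AddCommGroup X] [Module ℂ X] [AddCommGroup Y]
    [Module ℂ Y] [AddCommGroup Z] [Module ℂ Z] (B : X →ₗ[ℂ] Y →ₗ[ℂ] Z) (m k : ℕ)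
    (x : O ⊗[ℂ] X) (s : Ser 2 ⊗[ℂ] Y) :
    coeffTwo Z m k (ext (Ser 2) B (coef X (PowerSeries.toMvPowerSeries 0) x) s) =
      ∑ p ∈ antidiagonal m, B (powCoeff X p.1 x) (coeffTwo Y p.2 k s) := by
  have := serCoeff_ext B (Finsupp.single 0 m + Finsupp.single 1 k)
    (coef X (PowerSeries.toMvPowerSeries 0) x) s
  refine this.trans ?_
  symm
  refine Finset.sum_of_injOn (fun p => (Finsupp.single 0 p.1,
    Finsupp.single 0 p.2 + Finsupp.single 1 k)) ?_ ?_ ?_ ?_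
  · rintro ⟨p, q⟩ _ ⟨p', q'⟩ _ h
    have h1 := DFunLike.congr_fun (congrArg Prod.fst h) 0
    have h2 := DFunLike.congr_fun (congrArg Prod.snd h) 0
    simp at h1 h2
    simp [h1, h2]
  · rintro ⟨p, q⟩ h
    simp only [Finset.mem_coe, mem_antidiagonal] at h ⊢
    rw [← add_assoc, ← Finsupp.single_add, h]
  · rintro ⟨u, v⟩ h hn
    rw [mem_antidiagonal] at h
    simp only at h ⊢
    rw [serCoeff_atVar]
    split_ifs with hu
    · refine absurd ⟨(u 0, v 0), ?_, ?_⟩ hn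
      · simpa using DFunLike.congr_fun h 0
      · have h0 := DFunLike.congr_fun h 0
        have h1 := DFunLike.congr_fun h 1
        have hu1 : u 1 = 0 := by rw [hu]; simp
        simp [hu1] at h1
        refine Prod.ext hu.symm (Finsupp.ext fun z => ?_)
        fin_cases z <;> simp [h1]
    · simp
  · rintro ⟨p, q⟩ _
    simp only [serCoeff_atVar]
    rw [if_pos (by simp), serCoeff_coeffTwo]
    simp

theorem coeffTwo_ext_atVar_one {X Y Z : Type*} [AddCommGroup X] [Module ℂ X] [AddCommGroup Y]
    [Module ℂ Y] [AddCommGroup Z] [Module ℂ Z] (B : X →ₗ[ℂ] Y →ₗ[ℂ] Z) (m k : ℕ)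
    (x : O ⊗[ℂ] X) (s : Ser 2 ⊗[ℂ] Y) :
    coeffTwo Z m k (ext (Ser 2) B (coef X (PowerSeries.toMvPowerSeries 1) x) s) =
      ∑ p ∈ antidiagonal k, B (powCoeff X p.1 x) (coeffTwo Y m p.2 s) := by
  have := serCoeff_ext B (Finsupp.single 0 m + Finsupp.single 1 k)
    (coef X (PowerSeries.toMvPowerSeries 1) x) s
  refine this.trans ?_
  symm
  refine Finset.sum_of_injOn (fun p => (Finsupp.single 1 p.1,
    Finsupp.single 0 m + Finsupp.single 1 p.2)) ?_ ?_ ?_ ?_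
  · rintro ⟨p, q⟩ _ ⟨p', q'⟩ _ h
    have h1 := DFunLike.congr_fun (congrArg Prod.fst h) 1
    have h2 := DFunLike.congr_fun (congrArg Prod.snd h) 1
    simp at h1 h2
    simp [h1, h2]
  · rintro ⟨p, q⟩ h
    simp only [Finset.mem_coe, mem_antidiagonal] at h ⊢
    rw [add_left_comm, ← Finsupp.single_add, h]
  · rintro ⟨u, v⟩ h hn
    rw [mem_antidiagonal] at h
    simp only at h ⊢
    rw [serCoeff_atVar]
    split_ifs with hu
    · refine absurd ⟨(u 1, v 1), ?_, ?_⟩ hn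
      · simpa using DFunLike.congr_fun h 1
      · have h0 := DFunLike.congr_fun h 0
        have hu1 : u 0 = 0 := by rw [hu]; simp
        simp [hu1] at h0
        refine Prod.ext hu.symm (Finsupp.ext fun z => ?_)
        fin_cases z <;> simp [h0]
    · simp
  · rintro ⟨p, q⟩ _
    simp only [serCoeff_atVar]
    rw [if_pos (by simp), serCoeff_coeffTwo]
    simp

theorem coeffTwo_cobracket (h : Ser 2 ⊗[ℂ] (𝔭 ⊗[ℂ] 𝔭)) (x : O ⊗[ℂ] 𝔭) (m k : ℕ) :
    coeffTwo _ m k (cobracket hβ h x) =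
      -legOne 𝔭 (powCoeff 𝔭 (m + k + 1) x) (casimir β hβ) -
      (∑ p ∈ antidiagonal m, legOne 𝔭 (powCoeff 𝔭 p.1 x) (coeffTwo _ p.2 k h) +
        ∑ p ∈ antidiagonal k, legTwo 𝔭 (powCoeff 𝔭 p.1 x) (coeffTwo _ m p.2 h)) := by
  rw [cobracket_apply, act, map_sub, map_neg, map_add, atVar, atVar, coeffTwo_ext_atVar_zero,
    coeffTwo_ext_atVar_one, coeffTwo_eq, evalCoef_lTensor, ← coeffTwo_eq, coeffTwo_divDiff,
    LinearMap.flip_apply]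

end Cobracket

/-! ### Duality between the cobracket and the bracket -/

section Duality

variable {𝔭 : Type*} [LieRing 𝔭] [LieAlgebra ℂ 𝔭] {β : LinearMap.BilinForm ℂ 𝔭} {σ : ℤ}

theorem resForm_lie_isBasic_of_posPart (hσ : σ * σ = 1)
    {G : ℕ → ℕ → Module.End ℂ 𝔭} {m k : ℕ} {a b : 𝔭} {u v : K ⊗[ℂ] 𝔭} (hu : IsBasic σ G m a u)
    (hv : IsBasic σ G k b v) {X : K ⊗[ℂ] 𝔭} (hX : X ∈ posPart 𝔭 σ) (N : ℕ) (hN : m + k + 2 ≤ N) :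
    resForm (tres σ) β X ⁅u, v⁆ =
      ∑ n ∈ Finset.range N, β (tcoeff 𝔭 σ n X) (tcoeff 𝔭 σ (-(n : ℤ) - 1) ⁅u, v⁆) := by
  have hinj : Function.Injective (fun n : ℕ => (n : ℤ)) := fun k l h => by simpa using h
  rw [resForm_eq_sum hσ X _ ((Finset.range N).image fun n : ℕ => (n : ℤ)),
    Finset.sum_image hinj.injOn]
  · refine Finset.sum_congr rfl fun n _ => ?_
    rw [show (-1 - n : ℤ) = -n - 1 by ring]
  · intro p hp
    rcases nonneg_or_neg p with ⟨n, rfl⟩ | ⟨n, rfl⟩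
    · have : ¬ n < N := fun h => hp (Finset.mem_image_of_mem _ (Finset.mem_range.2 h))
      rw [show (-1 - n : ℤ) = -n - 1 by ring, lie_isBasic_neg hσ hu hv, if_neg (by omega),
        if_neg (by omega), if_neg (by omega)]
      simp
    · rw [hX]
      simp

theorem resTwo_eq_sum (s : Ser 2 ⊗[ℂ] (𝔭 ⊗[ℂ] 𝔭)) (w₁ w₂ : K ⊗[ℂ] 𝔭) (N N' : ℕ)
    (h₁ : ∀ k : ℕ, N ≤ k → tcoeff 𝔭 1 (-(k : ℤ) - 1) w₁ = 0)
    (h₂ : ∀ k : ℕ, N' ≤ k → tcoeff 𝔭 1 (-(k : ℤ) - 1) w₂ = 0) :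
    resTwo β s w₁ w₂ = ∑ m ∈ Finset.range N, ∑ k ∈ Finset.range N',
      LinearMap.BilinForm.tmul β β (coeffTwo _ m k s)
        (tcoeff 𝔭 1 (-(m : ℤ) - 1) w₁ ⊗ₜ tcoeff 𝔭 1 (-(k : ℤ) - 1) w₂) := by
  simp only [tcoeff, one_mul] at h₁ h₂ ⊢
  rw [resTwo, finsum_eq_sum_of_support_subset (s := Finset.range N ×ˢ Finset.range N'),
    Finset.sum_product]
  rintro ⟨m, k⟩ hne
  rw [Function.mem_support] at hne
  simp only [Finset.coe_product, Finset.coe_range, Set.mem_prod, Set.mem_Iio]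
  constructor
  · by_contra hm
    exact hne (by rw [h₁ m (not_lt.1 hm), TensorProduct.zero_tmul, map_zero])
  · by_contra hk
    exact hne (by rw [h₂ k (not_lt.1 hk), TensorProduct.tmul_zero, map_zero])

theorem powToLaurent_mem_posPart {V : Type*} [AddCommGroup V] [Module ℂ V] (x : O ⊗[ℂ] V) :
    coef V powToLaurent x ∈ posPart V 1 := fun k => tcoeff_powToLaurent_neg k x

theorem tmul_comm (s : 𝔭 ⊗[ℂ] 𝔭) (a b : 𝔭) :
    LinearMap.BilinForm.tmul β β (TensorProduct.comm ℂ 𝔭 𝔭 s) (a ⊗ₜ b) =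
      LinearMap.BilinForm.tmul β β s (b ⊗ₜ a) := by
  induction s with
  | zero => simp
  | tmul x y => simp [LinearMap.BilinForm.tmul, mul_comm]
  | add x y hx hy => simp only [map_add, LinearMap.add_apply, hx, hy]

theorem form_contract_assoc (t : 𝔭 ⊗[ℂ] 𝔭) (z a b c : 𝔭) :
    β (contract β b c (TensorProduct.assoc ℂ 𝔭 𝔭 𝔭 (t ⊗ₜ z))) a =
      β z c * LinearMap.BilinForm.tmul β β t (a ⊗ₜ b) := by
  induction t with
  | zero => simp
  | tmul x y => simp [LinearMap.BilinForm.tmul, mul_comm, mul_left_comm]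
  | add x y hx hy => simp only [map_add, TensorProduct.add_tmul, LinearMap.add_apply, hx, hy, mul_add]

theorem form_contract_tmul (t : 𝔭 ⊗[ℂ] 𝔭) (y a b c : 𝔭) :
    β (contract β b c (y ⊗ₜ t)) a = β y a * LinearMap.BilinForm.tmul β β t (b ⊗ₜ c) := by
  induction t with
  | zero => simp
  | tmul x y => simp [LinearMap.BilinForm.tmul, mul_comm]
  | add x y hx hy => simp only [map_add, TensorProduct.tmul_add, LinearMap.add_apply, hx, hy, mul_add]

theorem form_contract_leftComm (t : 𝔭 ⊗[ℂ] (𝔭 ⊗[ℂ] 𝔭)) (a b c : 𝔭) :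
    β (contract β b c (TensorProduct.leftComm ℂ 𝔭 𝔭 𝔭 t)) a = β (contract β a c t) b := by
  induction t with
  | zero => simp
  | tmul x t =>
    induction t with
    | zero => simp
    | tmul y z => simp [mul_comm, mul_left_comm]
    | add x y hx hy => simp only [map_add, TensorProduct.tmul_add, LinearMap.add_apply, hx, hy]
  | add x y hx hy => simp only [map_add, LinearMap.add_apply, hx, hy]

theorem coeffTwo_flipSer (s : Ser 2 ⊗[ℂ] (𝔭 ⊗[ℂ] 𝔭)) (m k : ℕ) :
    coeffTwo _ m k (flipSer s) = TensorProduct.comm ℂ 𝔭 𝔭 (coeffTwo _ k m s) := by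
  induction s with
  | zero => simp
  | tmul f t =>
    have : MvPowerSeries.coeff (Finsupp.single 0 m + Finsupp.single 1 k)
        (MvPowerSeries.rename (pair (n := 2) 1 0 (by decide)) f) =
        MvPowerSeries.coeff (Finsupp.single 0 k + Finsupp.single 1 m) f := by
      rw [← MvPowerSeries.coeff_embDomain_rename (pair (n := 2) 1 0 (by decide)) f]
      congr 2
      rw [Finsupp.embDomain_eq_mapDomain, Finsupp.mapDomain_add, Finsupp.mapDomain_single,
        Finsupp.mapDomain_single, add_comm]
      rfl
    rw [flipSer, LinearMap.comp_apply, coef_tmul, LinearMap.lTensor_tmul, coeffTwo_eq, evalCoef_tmul,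
      coeffTwo_eq, evalCoef_tmul, this, map_smul]
    rfl
  | add x y hx hy => simp only [map_add, hx, hy]

variable [FiniteDimensional ℂ 𝔭] (hβ : β.Nondegenerate)

include hβ in
theorem eq_of_tmul {s t : 𝔭 ⊗[ℂ] 𝔭} (h : ∀ a b, LinearMap.BilinForm.tmul β β s (a ⊗ₜ b) =
    LinearMap.BilinForm.tmul β β t (a ⊗ₜ b)) : s = t :=
  op_injective hβ (LinearMap.ext fun b => form_ext_left hβ fun a => by
    rw [← tmul_tmul, h, tmul_tmul])

/-- Both sides are sums over the coefficients of `x`: the divided difference of C matches pole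
against pole, the first leg matches the pole of `u`, and the second leg the pole of `v`. Only the
coefficients of `X` matter, so the formula serves ℂ((t)) and ℂ((t⁻¹)) alike. -/
theorem tmul_coeffTwo_cobracket (hs : β.IsSymm) (hi : β.lieInvariant 𝔭) (hσ : σ * σ = 1)
    {h : Ser 2 ⊗[ℂ] (𝔭 ⊗[ℂ] 𝔭)} (hG : IsSkewSystem β (opCoeff β h)) {m k : ℕ} {a b : 𝔭}
    {u v : K ⊗[ℂ] 𝔭} (hu : IsBasic σ (opCoeff β h) m a u) (hv : IsBasic σ (opCoeff β h) k b v)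
    {X : K ⊗[ℂ] 𝔭} (hX : X ∈ posPart 𝔭 σ) (x : O ⊗[ℂ] 𝔭)
    (hx : ∀ n : ℕ, tcoeff 𝔭 σ n X = powCoeff 𝔭 n x) :
    LinearMap.BilinForm.tmul β β (coeffTwo _ m k (cobracket hβ h x)) (a ⊗ₜ b) =
      resForm (tres σ) β X ⁅u, v⁆ := by
  rw [resForm_lie_isBasic_of_posPart hσ hu hv hX (m + k + 2) le_rfl, tmul_tmul,
    coeffTwo_cobracket]
  simp only [lie_isBasic_neg hσ hu hv, hx, map_add, Finset.sum_add_distrib, apply_ite (β _),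
    map_zero]
  rw [Finset.sum_ite_eq_of_mem' _ _ _ (by simp), ← Finset.sum_filter, ← Finset.sum_filter]
  have e1 : (Finset.range (m + k + 2)).filter (· ≤ m) = Finset.range (m + 1) := by
    ext n; simp; omega
  have e2 : (Finset.range (m + k + 2)).filter (· ≤ k) = Finset.range (k + 1) := by
    ext n; simp; omega
  rw [e1, e2, Finset.Nat.sum_antidiagonal_eq_sum_range_succ
      (fun p q => legOne 𝔭 (powCoeff 𝔭 p x) (coeffTwo _ q k h)),
    Finset.Nat.sum_antidiagonal_eq_sum_range_succ
      (fun p q => legTwo 𝔭 (powCoeff 𝔭 p x) (coeffTwo _ m q h))]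
  have h1 : ∀ y c : 𝔭, β ⁅y, c⁆ a = -β y ⁅a, c⁆ := fun y c => by
    rw [form_lie_assoc hi, ← lie_skew, map_neg]
  -- Skewness carries the operator of the second leg over to `a`, where it is a regular coefficient
  -- of `u`.
  have h2 : ∀ (y : 𝔭) (q : ℕ), β (op β (coeffTwo _ m q h) ⁅b, y⁆) a =
      -β y ⁅opCoeff β h q m a, b⁆ := fun y q => by
    refine (hG m q _ _).trans ?_
    rw [form_lie_assoc hi, ← form_lie_assoc hi y, hs.eq b]
  simp only [map_sub, map_add, map_neg, map_sum, LinearMap.sub_apply, LinearMap.add_apply,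
    LinearMap.neg_apply, LinearMap.sum_apply, op_legOne, op_legTwo hi, op_casimir,
    LinearMap.id_apply, h1, h2, Finset.sum_neg_distrib, neg_neg]
  simp only [opCoeff]
  ring

/-- The cobracket is dual to the bracket of the Lagrangian complement. -/
theorem resTwo_cobracket (hs : β.IsSymm) (hi : β.lieInvariant 𝔭)
    {h : Ser 2 ⊗[ℂ] (𝔭 ⊗[ℂ] 𝔭)} (hG : IsSkewSystem β (opCoeff β h)) (x : O ⊗[ℂ] 𝔭)
    {w₁ w₂ : K ⊗[ℂ] 𝔭} (h₁ : w₁ ∈ lagr 1 β (opCoeff β h)) (h₂ : w₂ ∈ lagr 1 β (opCoeff β h)) :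
    resTwo β (cobracket hβ h x) w₁ w₂ =
      resForm (tres 1) β (coef 𝔭 powToLaurent x) ⁅w₁, w₂⁆ := by
  have hadm : Admissible 1 (opCoeff β h) := Or.inl rfl
  obtain ⟨A, hA⟩ := exists_lt_tcoeff_eq_zero (σ := 1) w₁
  obtain ⟨B, hB⟩ := exists_lt_tcoeff_eq_zero (σ := 1) w₂
  choose w hw using fun m : ℕ => exists_isBasic hadm m (tcoeff 𝔭 1 (-(m : ℤ) - 1) w₁)
  choose w' hw' using fun m : ℕ => exists_isBasic hadm m (tcoeff 𝔭 1 (-(m : ℤ) - 1) w₂)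
  -- The lower bound makes both truncations exceed the pole orders of `w₁` and `w₂`, as
  -- `resTwo_eq_sum` requires.
  obtain ⟨N, N', hN, hN', e⟩ := resForm_lie_lagr_eq_sum hβ hs hi hadm hG h₁ h₂
    (coef 𝔭 powToLaurent x) w w' hw hw' (max (-A).toNat (-B).toNat)
  rw [e, resTwo_eq_sum _ w₁ w₂ N N' (fun k hk => hA _ (by omega)) (fun k hk => hB _ (by omega))]
  refine Finset.sum_congr rfl fun m _ => Finset.sum_congr rfl fun k _ => ?_
  exact tmul_coeffTwo_cobracket hβ hs hi rfl hG (hw m) (hw' k) (powToLaurent_mem_posPart x) x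
    fun n => tcoeff_powToLaurent n x

/-- Dual to antisymmetry of the bracket of two basic series. -/
theorem flipSer_cobracket (hs : β.IsSymm) (hi : β.lieInvariant 𝔭)
    {h : Ser 2 ⊗[ℂ] (𝔭 ⊗[ℂ] 𝔭)} (hG : IsSkewSystem β (opCoeff β h)) (x : O ⊗[ℂ] 𝔭) :
    flipSer (cobracket hβ h x) = -cobracket hβ h x := by
  refine ext_coeffTwo fun m k => eq_of_tmul hβ fun a b => ?_
  obtain ⟨u, hu⟩ := exists_isBasic (σ := 1) (G := opCoeff β h) (Or.inl rfl) m a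
  obtain ⟨v, hv⟩ := exists_isBasic (σ := 1) (G := opCoeff β h) (Or.inl rfl) k b
  rw [coeffTwo_flipSer, tmul_comm, map_neg, map_neg, LinearMap.neg_apply,
    tmul_coeffTwo_cobracket hβ hs hi rfl hG hv hu (powToLaurent_mem_posPart x) x
      fun n => tcoeff_powToLaurent n x,
    tmul_coeffTwo_cobracket hβ hs hi rfl hG hu hv (powToLaurent_mem_posPart x) x
      fun n => tcoeff_powToLaurent n x, ← lie_skew, map_neg]

/-! ### The co-Jacobi identity -/

/-- Transposing δ ⊗ 1 gives the bracket on the first two arguments. The only pole of `w` has index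
`l`, so just that column of `s` enters. -/
theorem form_contract_tensorOne (hs : β.IsSymm) (hi : β.lieInvariant 𝔭)
    {h : Ser 2 ⊗[ℂ] (𝔭 ⊗[ℂ] 𝔭)} (hG : IsSkewSystem β (opCoeff β h)) {m k l : ℕ} {a b c : 𝔭}
    {u v w : K ⊗[ℂ] 𝔭} (hu : IsBasic 1 (opCoeff β h) m a u) (hv : IsBasic 1 (opCoeff β h) k b v)
    (hw : IsBasic 1 (opCoeff β h) l c w) (s : Ser 2 ⊗[ℂ] (𝔭 ⊗[ℂ] 𝔭)) :
    β (contract β b c (tensorOne (cobracket hβ h) m k l s)) a = resTwo β s ⁅u, v⁆ w := by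
  have hz : ∀ n : ℕ, m + k + 2 ≤ n → tcoeff 𝔭 1 (-(n : ℤ) - 1) ⁅u, v⁆ = 0 := fun n hn => by
    rw [lie_isBasic_neg rfl hu hv, if_neg (by omega), if_neg (by omega), if_neg (by omega)]
    simp
  rw [resTwo_eq_sum s _ _ (m + k + 2) (l + 1) hz fun n hn => by rw [hw.neg, if_neg (by omega)]]
  rw [Finset.sum_congr rfl fun n _ => Finset.sum_eq_single (a := l) (fun k' _ hk' => by
    rw [hw.neg, if_neg hk']; simp) (by simp)]
  simp only [hw.neg, if_pos]
  induction s with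
  | zero => simp
  | tmul f t =>
    induction t with
    | zero => simp
    | tmul y z =>
      have : tensorOne (cobracket hβ h) m k l (f ⊗ₜ (y ⊗ₜ z)) = TensorProduct.assoc ℂ 𝔭 𝔭 𝔭
          (coeffTwo _ m k (cobracket hβ h (col l f ⊗ₜ y)) ⊗ₜ z) := rfl
      rw [this, form_contract_assoc, tmul_coeffTwo_cobracket hβ hs hi rfl hG hu hv
        (powToLaurent_mem_posPart _) _ (fun n => tcoeff_powToLaurent n _),
        resForm_lie_isBasic_of_posPart rfl hu hv (powToLaurent_mem_posPart _) _ le_rfl,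
        Finset.mul_sum]
      refine Finset.sum_congr rfl fun n _ => ?_
      have hcol : PowerSeries.coeff n (col l f) =
        MvPowerSeries.coeff (Finsupp.single 0 n + Finsupp.single 1 l) f := by simp [col]
      rw [tcoeff_powToLaurent, powCoeff_tmul, coeffTwo_eq, evalCoef_tmul, hcol]
      simp [LinearMap.BilinForm.tmul]
      ring
    | add x y hx hy =>
      simp only [map_add, TensorProduct.tmul_add, LinearMap.add_apply, hx, hy,
        Finset.sum_add_distrib]
  | add x y hx hy => simp only [map_add, LinearMap.add_apply, hx, hy, Finset.sum_add_distrib]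

theorem form_contract_oneTensor (hs : β.IsSymm) (hi : β.lieInvariant 𝔭)
    {h : Ser 2 ⊗[ℂ] (𝔭 ⊗[ℂ] 𝔭)} (hG : IsSkewSystem β (opCoeff β h)) {m k l : ℕ} {a b c : 𝔭}
    {u v w : K ⊗[ℂ] 𝔭} (hu : IsBasic 1 (opCoeff β h) m a u) (hv : IsBasic 1 (opCoeff β h) k b v)
    (hw : IsBasic 1 (opCoeff β h) l c w) (s : Ser 2 ⊗[ℂ] (𝔭 ⊗[ℂ] 𝔭)) :
    β (contract β b c (oneTensor (cobracket hβ h) m k l s)) a = resTwo β s u ⁅v, w⁆ := by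
  have hz : ∀ n : ℕ, k + l + 2 ≤ n → tcoeff 𝔭 1 (-(n : ℤ) - 1) ⁅v, w⁆ = 0 := fun n hn => by
    rw [lie_isBasic_neg rfl hv hw, if_neg (by omega), if_neg (by omega), if_neg (by omega)]
    simp
  rw [resTwo_eq_sum s _ _ (m + 1) (k + l + 2)
      (fun n hn => by rw [hu.neg, if_neg (by omega)]) hz,
    Finset.sum_eq_single (a := m) (fun k' _ hk' => by rw [hu.neg, if_neg hk']; simp) (by simp)]
  simp only [hu.neg, if_pos]
  induction s with
  | zero => simp
  | tmul f t =>
    induction t with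
    | zero => simp
    | tmul y z =>
      have : oneTensor (cobracket hβ h) m k l (f ⊗ₜ (y ⊗ₜ z)) =
          y ⊗ₜ coeffTwo _ k l (cobracket hβ h (row m f ⊗ₜ z)) := rfl
      rw [this, form_contract_tmul, tmul_coeffTwo_cobracket hβ hs hi rfl hG hv hw
        (powToLaurent_mem_posPart _) _ (fun n => tcoeff_powToLaurent n _),
        resForm_lie_isBasic_of_posPart rfl hv hw (powToLaurent_mem_posPart _) _ le_rfl,
        Finset.mul_sum]
      refine Finset.sum_congr rfl fun n _ => ?_
      have hrow : PowerSeries.coeff n (row m f) =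
        MvPowerSeries.coeff (Finsupp.single 0 m + Finsupp.single 1 n) f := by simp [row]
      rw [tcoeff_powToLaurent, powCoeff_tmul, coeffTwo_eq, evalCoef_tmul, hrow]
      simp [LinearMap.BilinForm.tmul]
      ring
    | add x y hx hy =>
      simp only [map_add, TensorProduct.tmul_add, LinearMap.add_apply, hx, hy,
        Finset.sum_add_distrib]
  | add x y hx hy => simp only [map_add, LinearMap.add_apply, hx, hy, Finset.sum_add_distrib]

theorem isTopLieBialgebra_cobracket (hs : β.IsSymm) (hi : β.lieInvariant 𝔭)
    {h : Ser 2 ⊗[ℂ] (𝔭 ⊗[ℂ] 𝔭)} (hG : IsSkewSystem β (opCoeff β h))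
    (hE : ∀ i j l a b, yangBaxterCoeff (opCoeff β h) i j l a b = 0) :
    IsTopLieBialgebra (cobracket hβ h) where
  skew := flipSer_cobracket hβ hs hi hG
  cocycle := cobracket_lie hβ hi h
  coJacobi x m k l := by
    have hadm : Admissible 1 (opCoeff β h) := Or.inl rfl
    refine eq_of_contract hβ fun b c => form_ext_left hβ fun a => ?_
    obtain ⟨u, hu⟩ := exists_isBasic hadm m a
    obtain ⟨v, hv⟩ := exists_isBasic hadm k b
    obtain ⟨w, hw⟩ := exists_isBasic hadm l c
    have hu' := isBasic_mem_lagr rfl hG hu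
    have hv' := isBasic_mem_lagr rfl hG hv
    have hw' := isBasic_mem_lagr rfl hG hw
    -- Here the Yang-Baxter equation is used: duality applies a second time only if brackets of
    -- basic series stay in `lagr`. The three terms then become the Jacobi identity for `u`, `v`,
    -- `w`.
    have hlie : ∀ {p q : K ⊗[ℂ] 𝔭}, p ∈ lagr 1 β (opCoeff β h) → q ∈ lagr 1 β (opCoeff β h) →
        ⁅p, q⁆ ∈ lagr 1 β (opCoeff β h) := fun hp hq => lie_mem_lagr hβ hs hi hadm hG hE hp hq
    rw [map_add, map_sub, map_add, map_sub, LinearMap.add_apply, LinearMap.sub_apply,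
      form_contract_leftComm, form_contract_tensorOne hβ hs hi hG hu hv hw,
      form_contract_oneTensor hβ hs hi hG hu hv hw, form_contract_oneTensor hβ hs hi hG hv hu hw,
      resTwo_cobracket hβ hs hi hG x (hlie hu' hv') hw',
      resTwo_cobracket hβ hs hi hG x hu' (hlie hv' hw'),
      resTwo_cobracket hβ hs hi hG x hv' (hlie hu' hw'), leibniz_lie u v w]
    simp

end Duality

/-! ### Skew-symmetric series -/

section Skew

variable {𝔭 : Type*} [LieRing 𝔭] [LieAlgebra ℂ 𝔭]

theorem inv_var_sub {n : ℕ} (i j : Fin n) :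
    (var i - var j : Fld n)⁻¹ = -(var j - var i)⁻¹ := by
  rw [← inv_neg, neg_sub]

theorem flip_coef (h : Ser 2 ⊗[ℂ] (𝔭 ⊗[ℂ] 𝔭)) :
    flip (coef _ (serToFld 2) h) = coef _ (serToFld 2) (flipSer h) := by
  rw [flip, LinearMap.comp_apply, argsAt_coef, lTensor_coef]
  rfl

/-- The third term of the generalized equation becomes that of the classical one as soon as flipping
`s` changes its sign. -/
theorem ext_br3213 {A : Type*} [CommRing A] [Algebra ℂ A] (s t : A ⊗[ℂ] (𝔭 ⊗[ℂ] 𝔭)) :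
    ext A (br3213 𝔭) s t = -ext A (br1323 𝔭) t
      ((TensorProduct.comm ℂ 𝔭 𝔭).toLinearMap.lTensor A s) := by
  have h : ∀ s t : 𝔭 ⊗[ℂ] 𝔭, br3213 𝔭 s t = -br1323 𝔭 t (TensorProduct.comm ℂ 𝔭 𝔭 s) := by
    intro s t
    induction s with
    | zero => simp
    | tmul x y =>
      induction t with
      | zero => simp
      | tmul z w =>
        rw [TensorProduct.comm_tmul, br3213_apply, br1323_apply, ← lie_skew, TensorProduct.tmul_neg,
          TensorProduct.tmul_neg]
      | add x y hx hy => simp only [map_add, LinearMap.add_apply, hx, hy]; abel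
    | add x y hx hy => simp only [map_add, LinearMap.add_apply, hx, hy]; abel
  induction s with
  | zero => simp
  | tmul f x =>
    induction t with
    | zero => simp
    | tmul g y =>
      rw [LinearMap.lTensor_tmul, ext_tmul, ext_tmul, h, TensorProduct.tmul_neg, mul_comm]
      rfl
    | add x y hx hy => simp only [map_add, LinearMap.add_apply, hx, hy]; abel
  | add x y hx hy => simp only [map_add, LinearMap.add_apply, hx, hy]; abel

variable [FiniteDimensional ℂ 𝔭] {β : LinearMap.BilinForm ℂ 𝔭} (hβ : β.Nondegenerate)

theorem argsSer_flipSer {i j k : Fin 3} (hij : i ≠ j) (hik : i ≠ k) (hjk : j ≠ k)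
    (h : Ser 2 ⊗[ℂ] (𝔭 ⊗[ℂ] 𝔭)) : argsSer i j hij (flipSer h) =
      (TensorProduct.comm ℂ 𝔭 𝔭).toLinearMap.lTensor (Ser 3) (argsSer j i hij.symm h) := by
  refine ext_serCoeff fun d => ?_
  rw [serCoeff_argsSer hij hik hjk, serCoeff, evalCoef_lTensor, ← serCoeff,
    serCoeff_argsSer hij.symm hjk hik, coeffTwo_flipSer]
  split_ifs
  · rfl
  · simp

include hβ in
theorem flipSer_eq_neg (hs : β.IsSymm) {h : Ser 2 ⊗[ℂ] (𝔭 ⊗[ℂ] 𝔭)}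
    (hG : IsSkewSystem β (opCoeff β h)) : flipSer h = -h := by
  refine ext_coeffTwo fun m k => op_injective hβ (LinearMap.ext fun a => form_ext_left hβ fun b => ?_)
  rw [coeffTwo_flipSer, form_op_comm hs, map_neg, map_neg, LinearMap.neg_apply, map_neg,
    LinearMap.neg_apply]
  have := hG m k a b
  rw [opCoeff, opCoeff] at this
  rw [this, neg_neg]

theorem flip_yang (hs : β.IsSymm) : flip (yang β hβ) = -yang β hβ := by
  rw [flip, LinearMap.comp_apply, argsAt_yang, LinearMap.lTensor_tmul, LinearEquiv.coe_coe,
    comm_casimir hβ hs, inv_var_sub, TensorProduct.neg_tmul, yang]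

/-- Skew-symmetric solutions of the generalized classical Yang-Baxter equation are `r`-matrices. -/
theorem isRMatrix_of_isSkewSystem (hs : β.IsSymm) (hi : β.lieInvariant 𝔭)
    {h : Ser 2 ⊗[ℂ] (𝔭 ⊗[ℂ] 𝔭)} (hG : IsSkewSystem β (opCoeff β h))
    (hE : ∀ i j l a b, yangBaxterCoeff (opCoeff β h) i j l a b = 0) :
    IsRMatrix β hβ (yang β hβ + coef _ (serToFld 2) h) := by
  have hg : GCYBE (yang β hβ + coef _ (serToFld 2) h) := (gcybe_yang_add_iff hβ hi h).2 hE
  have hflip := flipSer_eq_neg hβ hs hG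
  refine ⟨⟨⟨h, rfl⟩, hg⟩, ?_, ?_⟩
  · rw [map_add, flip_yang hβ hs, flip_coef, hflip, map_neg]
    abel
  · rw [GCYBE, ext_br3213] at hg
    have : (TensorProduct.comm ℂ 𝔭 𝔭).toLinearMap.lTensor (Fld 3)
        (argsAt 2 1 (by decide) (yang β hβ + coef _ (serToFld 2) h)) =
        -argsAt 1 2 (by decide) (yang β hβ + coef _ (serToFld 2) h) := by
      have e := argsSer_flipSer (i := 1) (j := 2) (k := 0) (by decide) (by decide) (by decide) h
      rw [hflip, map_neg] at e
      rw [map_add, map_add, map_add, argsAt_yang, argsAt_yang, argsAt_coef, argsAt_coef,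
        LinearMap.lTensor_tmul, LinearEquiv.coe_coe, comm_casimir hβ hs, lTensor_coef, ← e, map_neg,
        inv_var_sub 2 1, TensorProduct.neg_tmul]
      abel
    rw [this, map_neg, neg_neg] at hg
    exact hg

end Skew

/-! ### The series attached to a series with coefficients in `𝔤` -/

section Graded

open Cotangent

variable {𝔤 : Type*} [LieRing 𝔤] [LieAlgebra ℂ 𝔤] {κ₀ : LinearMap.BilinForm ℂ 𝔤}

theorem form_isSymm (hs : κ₀.IsSymm) : (form κ₀).IsSymm :=
  ⟨fun x y => by rw [form_apply, form_apply, hs.eq, hs.eq x.2, add_comm]⟩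

theorem form_lieInvariant (hi : κ₀.lieInvariant 𝔤) : (form κ₀).lieInvariant (Cotangent 𝔤) := by
  intro x y z
  simp only [form_apply, fst_lie, snd_lie, map_add, LinearMap.add_apply]
  rw [hi x.1 y.1, hi x.1 y.2, hi x.2 y.1]
  ring

theorem incl_fst_add_eps_snd (x : Cotangent 𝔤) : incl 𝔤 x.1 + eps 𝔤 x.2 = x := by
  ext <;> simp

/-- `(1 ⊗ ε) g - (ε ⊗ 1) τ(g(t₂, t₁))`. -/
def rhoSer (g : Ser 2 ⊗[ℂ] (𝔤 ⊗[ℂ] 𝔤)) : Ser 2 ⊗[ℂ] (Cotangent 𝔤 ⊗[ℂ] Cotangent 𝔤) :=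
  (TensorProduct.map (incl 𝔤) (eps 𝔤)).lTensor (Ser 2) g -
    (TensorProduct.map (eps 𝔤) (incl 𝔤)).lTensor (Ser 2) (flipSer g)

theorem op_map_incl_eps (s : 𝔤 ⊗[ℂ] 𝔤) (x : Cotangent 𝔤) :
    op (form κ₀) (TensorProduct.map (incl 𝔤) (eps 𝔤) s) x = incl 𝔤 (op κ₀ s x.1) := by
  induction s with
  | zero => simp
  | tmul a b => simp [form_apply]
  | add x y hx hy => simp only [map_add, LinearMap.add_apply, hx, hy]

theorem op_map_eps_incl (s : 𝔤 ⊗[ℂ] 𝔤) (x : Cotangent 𝔤) :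
    op (form κ₀) (TensorProduct.map (eps 𝔤) (incl 𝔤) s) x = eps 𝔤 (op κ₀ s x.2) := by
  induction s with
  | zero => simp
  | tmul a b => simp [form_apply]
  | add x y hx hy => simp only [map_add, LinearMap.add_apply, hx, hy]

/-- Block diagonal: on 𝔤 the operators of `g`, on ε𝔤 minus the adjoints with the two indices
exchanged. Skewness below therefore needs no condition on `g`. -/
theorem opCoeff_rhoSer (g : Ser 2 ⊗[ℂ] (𝔤 ⊗[ℂ] 𝔤)) (m k : ℕ) (x : Cotangent 𝔤) :
    opCoeff (form κ₀) (rhoSer g) m k x = incl 𝔤 (opCoeff κ₀ g m k x.1) -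
      eps 𝔤 (op κ₀ (TensorProduct.comm ℂ 𝔤 𝔤 (coeffTwo _ k m g)) x.2) := by
  rw [opCoeff, rhoSer, map_sub, coeffTwo_eq, evalCoef_lTensor, evalCoef_lTensor, ← coeffTwo_eq,
    coeffTwo_flipSer, map_sub, LinearMap.sub_apply, op_map_incl_eps, op_map_eps_incl]
  rfl

theorem isSkewSystem_rhoSer (hs : κ₀.IsSymm) (g : Ser 2 ⊗[ℂ] (𝔤 ⊗[ℂ] 𝔤)) :
    IsSkewSystem (form κ₀) (opCoeff (form κ₀) (rhoSer g)) := by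
  intro m k x y
  have h : ∀ (m k : ℕ) (a b : 𝔤), κ₀ (op κ₀ (TensorProduct.comm ℂ 𝔤 𝔤 (coeffTwo _ k m g)) a) b =
      κ₀ a (opCoeff κ₀ g k m b) := fun m k a b => form_op_comm hs _ a b
  rw [(form_isSymm hs).eq x]
  simp only [opCoeff_rhoSer, form_apply, Cotangent.fst_incl, Cotangent.snd_incl,
    Cotangent.fst_eps, Cotangent.snd_eps, map_sub, LinearMap.sub_apply]
  simp only [map_zero, LinearMap.zero_apply, h]
  rw [hs.eq (opCoeff κ₀ g m k x.1), hs.eq (opCoeff κ₀ g k m y.1)]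
  ring

/-- Systems of operators that preserve the `ε`-degree. -/
def IsGradedSystem (G : ℕ → ℕ → Module.End ℂ (Cotangent 𝔤)) : Prop :=
  ∀ m k, (∀ a, (G m k (incl 𝔤 a)).2 = 0) ∧ ∀ a, (G m k (eps 𝔤 a)).1 = 0

theorem isGradedSystem_rhoSer (g : Ser 2 ⊗[ℂ] (𝔤 ⊗[ℂ] 𝔤)) :
    IsGradedSystem (opCoeff (form κ₀) (rhoSer g)) := fun m k => by
  have e : ∀ a b : Cotangent 𝔤, (a - b).1 = a.1 - b.1 ∧ (a - b).2 = a.2 - b.2 :=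
    fun a b => ⟨rfl, rfl⟩
  constructor <;> intro a <;> rw [opCoeff_rhoSer]
  · rw [(e _ _).2]
    simp
  · rw [(e _ _).1]
    simp

/-! ### The components of the Yang-Baxter coefficients by ε-degree. -/

section Components

variable {G : ℕ → ℕ → Module.End ℂ (Cotangent 𝔤)}

theorem IsGradedSystem.apply_incl (hG : IsGradedSystem G) (m k : ℕ) (a : 𝔤) :
    G m k (incl 𝔤 a) = incl 𝔤 (G m k (incl 𝔤 a)).1 :=
  Cotangent.ext rfl ((hG m k).1 a)

theorem IsGradedSystem.apply_eps (hG : IsGradedSystem G) (m k : ℕ) (a : 𝔤) :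
    G m k (eps 𝔤 a) = eps 𝔤 (G m k (eps 𝔤 a)).2 :=
  Cotangent.ext ((hG m k).2 a) rfl

theorem lie_incl_incl (a b : 𝔤) : ⁅incl 𝔤 a, incl 𝔤 b⁆ = incl 𝔤 ⁅a, b⁆ := by
  ext <;> simp

theorem lie_eps_eps (a b : 𝔤) : ⁅eps 𝔤 a, eps 𝔤 b⁆ = 0 := by
  ext <;> simp

theorem yangBaxterCoeff_add_left {𝔭 : Type*} [LieRing 𝔭] [LieAlgebra ℂ 𝔭]
    (G : ℕ → ℕ → Module.End ℂ 𝔭) (i j l : ℕ) (a a' b : 𝔭) :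
    yangBaxterCoeff G i j l (a + a') b =
      yangBaxterCoeff G i j l a b + yangBaxterCoeff G i j l a' b := by
  simp only [yangBaxterCoeff, map_add, add_lie, Finset.sum_add_distrib]
  abel

theorem yangBaxterCoeff_add_right {𝔭 : Type*} [LieRing 𝔭] [LieAlgebra ℂ 𝔭]
    (G : ℕ → ℕ → Module.End ℂ 𝔭) (i j l : ℕ) (a b b' : 𝔭) :
    yangBaxterCoeff G i j l a (b + b') =
      yangBaxterCoeff G i j l a b + yangBaxterCoeff G i j l a b' := by
  simp only [yangBaxterCoeff, map_add, lie_add, Finset.sum_add_distrib]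
  abel

theorem yangBaxterCoeff_incl_incl {A : ℕ → ℕ → Module.End ℂ 𝔤}
    (hA : ∀ m k a, G m k (incl 𝔤 a) = incl 𝔤 (A m k a)) (i j l : ℕ) (a b : 𝔤) :
    yangBaxterCoeff G i j l (incl 𝔤 a) (incl 𝔤 b) = incl 𝔤 (yangBaxterCoeff A i j l a b) := by
  simp only [yangBaxterCoeff, hA, lie_incl_incl, map_sub, map_add, map_sum]

theorem yangBaxterCoeff_eps_eps (hG : IsGradedSystem G) (i j l : ℕ) (a b : 𝔤) :
    yangBaxterCoeff G i j l (eps 𝔤 a) (eps 𝔤 b) = 0 := by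
  have h : ∀ m k a b, ⁅G m k (eps 𝔤 a), eps 𝔤 b⁆ = 0 := fun m k a b => by
    rw [hG.apply_eps, lie_eps_eps]
  have h' : ∀ m k a b, ⁅eps 𝔤 b, G m k (eps 𝔤 a)⁆ = 0 := fun m k a b => by
    rw [hG.apply_eps, lie_eps_eps]
  have h'' : ∀ m k m' k' a b, ⁅G m k (eps 𝔤 a), G m' k' (eps 𝔤 b)⁆ = 0 := fun m k m' k' a b => by
    rw [hG.apply_eps m k, h']
  simp only [yangBaxterCoeff, h, h', h'', lie_eps_eps, map_zero, Finset.sum_const_zero, add_zero,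
    sub_zero]

theorem fst_yangBaxterCoeff_incl_eps (hG : IsGradedSystem G) (i j l : ℕ) (a b : 𝔤) :
    (yangBaxterCoeff G i j l (incl 𝔤 a) (eps 𝔤 b)).1 = 0 := by
  have hsub : ∀ a b : Cotangent 𝔤, (a - b).1 = a.1 - b.1 := fun a b => rfl
  have hsum : ∀ (s : Finset (ℕ × ℕ)) (f : ℕ × ℕ → Cotangent 𝔤), (∀ p, (f p).1 = 0) →
      (∑ p ∈ s, f p).1 = 0 := fun s f hf => by
    have : (∑ p ∈ s, f p).1 = ∑ p ∈ s, (f p).1 := map_sum (LinearMap.fst ℂ 𝔤 𝔤) f s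
    rw [this]
    exact Finset.sum_eq_zero fun p _ => hf p
  have hop : ∀ m k (x : Cotangent 𝔤), x.1 = 0 → (G m k x).1 = 0 := fun m k x hx => by
    rw [← incl_fst_add_eps_snd x, hx, map_zero, zero_add, (hG m k).2]
  rw [yangBaxterCoeff, hsub, hsub, hsub, fst_add, fst_add, hsum, hsum, hsum, hop] <;>
    first | (intro p; try apply hop) | skip
  all_goals simp [(hG _ _).2]

variable [FiniteDimensional ℂ 𝔤]

/-- For graded skew-symmetric systems the Yang-Baxter equation reduces to its component of
`ε`-degree `0`. -/
theorem yangBaxterCoeff_eq_zero_of_incl (hs : κ₀.IsSymm) (hκ : κ₀.Nondegenerate)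
    (hi : κ₀.lieInvariant 𝔤) (hG : IsGradedSystem G) (hskew : IsSkewSystem (form κ₀) G)
    (hE : ∀ i j l a b, yangBaxterCoeff G i j l (incl 𝔤 a) (incl 𝔤 b) = 0) (i j l : ℕ)
    (a b : Cotangent 𝔤) : yangBaxterCoeff G i j l a b = 0 := by
  have hsd := form_isSymm hs
  have hid := form_lieInvariant hi
  have hnd := form_nondegenerate hκ
  -- Both sides are pairings of the same three basic series, and ⟨[u, v], w⟩ = ⟨[w, u], v⟩ by
  -- invariance.
  have hcyc : ∀ (i j l : ℕ) (a b c : Cotangent 𝔤), form κ₀ (yangBaxterCoeff G i j l a b) c =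
      form κ₀ (yangBaxterCoeff G l i j c a) b := fun i j l a b c => by
    have hadm : Admissible 1 G := Or.inl rfl
    obtain ⟨u, hu⟩ := exists_isBasic hadm j a
    obtain ⟨v, hv⟩ := exists_isBasic hadm l b
    obtain ⟨w, hw⟩ := exists_isBasic hadm i c
    rw [← resForm_lie_isBasic rfl hskew hu hv hw, ← resForm_lie_isBasic rfl hskew hw hu hv,
      resForm_comm hsd, resForm_lie_assoc hid]
  -- Against 𝔤, a rotation brings both arguments into 𝔤; against ε𝔤, the pairing vanishes because
  -- the coefficient itself lies in ε𝔤.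
  have hIE : ∀ i j l a b, yangBaxterCoeff G i j l (incl 𝔤 a) (eps 𝔤 b) = 0 := fun i j l a b => by
    refine hnd.1 _ fun c => ?_
    rw [← incl_fst_add_eps_snd c, map_add, hcyc, hE, map_zero, LinearMap.zero_apply, zero_add,
      form_apply, fst_yangBaxterCoeff_incl_eps hG]
    simp
  have hEI : ∀ i j l a b, yangBaxterCoeff G i j l (eps 𝔤 a) (incl 𝔤 b) = 0 := fun i j l a b => by
    refine hnd.1 _ fun c => ?_
    rw [hcyc, hcyc, ← incl_fst_add_eps_snd c, yangBaxterCoeff_add_right, hE, hIE, add_zero,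
      map_zero, LinearMap.zero_apply]
  rw [← incl_fst_add_eps_snd a, ← incl_fst_add_eps_snd b, yangBaxterCoeff_add_left,
    yangBaxterCoeff_add_right, yangBaxterCoeff_add_right, hE, hIE, hEI, yangBaxterCoeff_eps_eps hG]
  simp

end Components

theorem opCoeff_rhoSer_incl (g : Ser 2 ⊗[ℂ] (𝔤 ⊗[ℂ] 𝔤)) (m k : ℕ) (a : 𝔤) :
    opCoeff (form κ₀) (rhoSer g) m k (incl 𝔤 a) = incl 𝔤 (opCoeff κ₀ g m k a) := by
  rw [opCoeff_rhoSer]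
  simp

variable [FiniteDimensional ℂ 𝔤]

theorem casimir_form (hκ : κ₀.Nondegenerate) :
    casimir (form κ₀) (form_nondegenerate hκ) =
      TensorProduct.map (incl 𝔤) (eps 𝔤) (casimir κ₀ hκ) +
        TensorProduct.map (eps 𝔤) (incl 𝔤) (casimir κ₀ hκ) := by
  refine op_injective (form_nondegenerate hκ) (LinearMap.ext fun x => ?_)
  rw [op_casimir, map_add, LinearMap.add_apply, op_map_incl_eps, op_map_eps_incl, op_casimir]
  exact (incl_fst_add_eps_snd x).symm

/-- The flip changes the sign of C / (t₁ - t₂), so the two terms of ρ contribute the two halves of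
the Casimir element of 𝔡 with the same sign. -/
theorem rho_yang_add (hs : κ₀.IsSymm) (hκ : κ₀.Nondegenerate) (g : Ser 2 ⊗[ℂ] (𝔤 ⊗[ℂ] 𝔤)) :
    rho (yang κ₀ hκ + coef _ (serToFld 2) g) =
      yang (form κ₀) (form_nondegenerate hκ) + coef _ (serToFld 2) (rhoSer g) := by
  rw [rho, map_add, map_add, map_add, flip_yang hκ hs, flip_coef, rhoSer, map_sub, lTensor_coef,
    lTensor_coef, map_neg, yang, yang, casimir_form hκ, TensorProduct.tmul_add, LinearMap.lTensor_tmul,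
    LinearMap.lTensor_tmul]
  abel

theorem yangBaxterCoeff_rhoSer (hs : κ₀.IsSymm) (hκ : κ₀.Nondegenerate)
    (hi : κ₀.lieInvariant 𝔤) {g : Ser 2 ⊗[ℂ] (𝔤 ⊗[ℂ] 𝔤)}
    (hE : ∀ i j l a b, yangBaxterCoeff (opCoeff κ₀ g) i j l a b = 0) (i j l : ℕ)
    (a b : Cotangent 𝔤) : yangBaxterCoeff (opCoeff (form κ₀) (rhoSer g)) i j l a b = 0 :=
  yangBaxterCoeff_eq_zero_of_incl hs hκ hi (isGradedSystem_rhoSer g) (isSkewSystem_rhoSer hs g)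
    (fun i j l a b => by
      rw [yangBaxterCoeff_incl_incl (opCoeff_rhoSer_incl g), hE, map_zero]) i j l a b

theorem isRMatrix_rho (hs : κ₀.IsSymm) (hκ : κ₀.Nondegenerate) (hi : κ₀.lieInvariant 𝔤)
    {r : Fld 2 ⊗[ℂ] (𝔤 ⊗[ℂ] 𝔤)} (hr : IsGeneralizedRMatrix κ₀ hκ r) :
    IsRMatrix (form κ₀) (form_nondegenerate hκ) (rho r) := by
  obtain ⟨⟨g, rfl⟩, h⟩ := hr
  rw [rho_yang_add hs]
  exact isRMatrix_of_isSkewSystem _ (form_isSymm hs) (form_lieInvariant hi)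
    (isSkewSystem_rhoSer hs g)
    (yangBaxterCoeff_rhoSer hs hκ hi ((gcybe_yang_add_iff hκ hi g).1 h))

/-- Graded skew-symmetric systems come from series with coefficients in `𝔤`. -/
theorem exists_opCoeff_rhoSer_eq (hs : κ₀.IsSymm) (hκ : κ₀.Nondegenerate)
    {G : ℕ → ℕ → Module.End ℂ (Cotangent 𝔤)} (hG : IsGradedSystem G)
    (hskew : IsSkewSystem (form κ₀) G) :
    ∃ g : Ser 2 ⊗[ℂ] (𝔤 ⊗[ℂ] 𝔤), opCoeff (form κ₀) (rhoSer g) = G := by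
  -- Applying an operator to the first leg of C gives the tensor of that operator, so `g` is read
  -- off from the block on 𝔤.
  obtain ⟨g, hg⟩ := exists_coeffTwo (V := 𝔤 ⊗[ℂ] 𝔤) fun m k =>
    (LinearMap.fst ℂ 𝔤 𝔤 ∘ₗ G m k ∘ₗ incl 𝔤).rTensor 𝔤 (casimir κ₀ hκ)
  refine ⟨g, ?_⟩
  have hincl : ∀ m k a, opCoeff (form κ₀) (rhoSer g) m k (incl 𝔤 a) = G m k (incl 𝔤 a) := by
    intro m k a
    rw [opCoeff_rhoSer_incl, opCoeff, hg, op_rTensor_casimir, hG.apply_incl]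
    rfl
  -- Skewness leaves no choice for the block on ε𝔤: it is determined by the one on 𝔤.
  have heps : ∀ m k a, opCoeff (form κ₀) (rhoSer g) m k (eps 𝔤 a) = G m k (eps 𝔤 a) := by
    intro m k a
    refine form_ext_left (form_nondegenerate hκ) fun y => ?_
    rw [isSkewSystem_rhoSer hs g, hskew, ← incl_fst_add_eps_snd y, map_add, map_add, hincl,
      map_add, map_add, form_apply _ _ (G k m (eps 𝔤 y.2)), (hG k m).2,
      form_apply _ _ (opCoeff (form κ₀) (rhoSer g) k m (eps 𝔤 y.2)),
      (isGradedSystem_rhoSer g k m).2]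
    simp
  funext m k
  refine LinearMap.ext fun x => ?_
  rw [← incl_fst_add_eps_snd x, map_add, map_add, hincl, heps]

end Graded

/-! ### Graded Lagrangian complements -/

section GradedComplements

open Cotangent

theorem tcoeff_lTensor {V W : Type*} [AddCommGroup V] [Module ℂ V] [AddCommGroup W] [Module ℂ W]
    (σ n : ℤ) (f : V →ₗ[ℂ] W) (x : K ⊗[ℂ] V) : tcoeff W σ n (f.lTensor K x) = f (tcoeff V σ n x) :=
  evalCoef_lTensor _ f x

theorem resForm_lTensor {A 𝔭 : Type*} [CommRing A] [Algebra ℂ A] [LieRing 𝔭] [LieAlgebra ℂ 𝔭]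
    (ρ : A →ₗ[ℂ] ℂ) {β : LinearMap.BilinForm ℂ 𝔭} {S T : Module.End ℂ 𝔭}
    (h : ∀ a b, β (T a) b = β a (S b)) (x y : A ⊗[ℂ] 𝔭) :
    resForm ρ β (T.lTensor A x) y = resForm ρ β x (S.lTensor A y) := by
  induction x with
  | zero => simp
  | tmul f a =>
    induction y with
    | zero => simp
    | tmul g b => rw [LinearMap.lTensor_tmul, LinearMap.lTensor_tmul, resForm_apply, resForm_apply, h]
    | add x y hx hy => simp only [map_add, hx, hy]
  | add x y hx hy => simp only [map_add, LinearMap.add_apply, hx, hy]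

variable {𝔤 : Type*} [LieRing 𝔤] [LieAlgebra ℂ 𝔤] {κ₀ : LinearMap.BilinForm ℂ 𝔤} {σ : ℤ}
  {G : ℕ → ℕ → Module.End ℂ (Cotangent 𝔤)}

theorem degZero_apply (x : Cotangent 𝔤) : degZero 𝔤 x = incl 𝔤 x.1 := rfl

theorem degTwo_apply (x : Cotangent 𝔤) : degTwo 𝔤 x = eps 𝔤 x.2 := rfl

/-- The form pairs 𝔤 with ε𝔤, so the two projections are adjoint to each other. An array commuting
with one of them thus makes `lagr` stable under the other. -/
theorem form_degZero (x y : Cotangent 𝔤) : form κ₀ (degZero 𝔤 x) y = form κ₀ x (degTwo 𝔤 y) := by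
  simp [form_apply, degZero_apply, degTwo_apply]

theorem form_degTwo (x y : Cotangent 𝔤) : form κ₀ (degTwo 𝔤 x) y = form κ₀ x (degZero 𝔤 y) := by
  simp [form_apply, degZero_apply, degTwo_apply]

theorem IsGradedSystem.apply_degZero (hG : IsGradedSystem G) (m k : ℕ) (x : Cotangent 𝔤) :
    G m k (degZero 𝔤 x) = degZero 𝔤 (G m k x) := by
  conv_rhs => rw [← incl_fst_add_eps_snd x, map_add, map_add, hG.apply_incl, hG.apply_eps]
  rw [degZero_apply, hG.apply_incl]
  ext <;> simp [degZero_apply]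

theorem IsGradedSystem.apply_degTwo (hG : IsGradedSystem G) (m k : ℕ) (x : Cotangent 𝔤) :
    G m k (degTwo 𝔤 x) = degTwo 𝔤 (G m k x) := by
  conv_rhs => rw [← incl_fst_add_eps_snd x, map_add, map_add, hG.apply_incl, hG.apply_eps]
  rw [degTwo_apply, hG.apply_eps]
  ext <;> simp [degTwo_apply]

theorem IsBasic.lTensor {𝔭 : Type*} [LieRing 𝔭] [LieAlgebra ℂ 𝔭]
    {G : ℕ → ℕ → Module.End ℂ 𝔭} {m : ℕ} {a : 𝔭} {u : K ⊗[ℂ] 𝔭} (hu : IsBasic σ G m a u)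
    {T : Module.End ℂ 𝔭} (hT : ∀ m k a, G m k (T a) = T (G m k a)) :
    IsBasic σ G m (T a) (T.lTensor K u) := by
  refine ⟨fun i => ?_, fun k => ?_⟩
  · rw [tcoeff_lTensor, hu.nonneg, hT]
  · rw [tcoeff_lTensor, hu.neg]
    split_ifs
    · rfl
    · exact map_zero _

theorem lTensor_mem_lagr {𝔭 : Type*} [LieRing 𝔭] [LieAlgebra ℂ 𝔭] {β : LinearMap.BilinForm ℂ 𝔭}
    {G : ℕ → ℕ → Module.End ℂ 𝔭} {S T : Module.End ℂ 𝔭}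
    (h : ∀ a b, β (T a) b = β a (S b)) (hS : ∀ m k a, G m k (S a) = S (G m k a)) {x : K ⊗[ℂ] 𝔭}
    (hx : x ∈ lagr σ β G) : T.lTensor K x ∈ lagr σ β G := fun m a u hu => by
  rw [resForm_lTensor _ h]
  exact hx _ _ _ (hu.lTensor hS)

variable [FiniteDimensional ℂ 𝔤]

theorem isGradedLagrangianComplement_lagr (hs : κ₀.IsSymm) (hκ : κ₀.Nondegenerate)
    (hi : κ₀.lieInvariant 𝔤) (hadm : Admissible σ G) (hskew : IsSkewSystem (form κ₀) G)
    (hG : IsGradedSystem G) (hE : ∀ i j l a b, yangBaxterCoeff G i j l a b = 0) :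
    IsGradedLagrangianComplement (tres σ) κ₀ (posPart _ σ) (lagr σ (form κ₀) G) where
  lie_mem _ hv _ hw := lie_mem_lagr (form_nondegenerate hκ) (form_isSymm hs)
    (form_lieInvariant hi) hadm hskew hE hv hw
  lagrangian := mem_lagr_iff (form_nondegenerate hκ) (form_isSymm hs) hadm hskew
  isCompl := isCompl_posPart_lagr (form_nondegenerate hκ) hadm hskew
  graded _ hv := ⟨lTensor_mem_lagr form_degZero hG.apply_degTwo hv,
    lTensor_mem_lagr form_degTwo hG.apply_degZero hv⟩

/-- If a projection kills the pole of a basic series, its image is regular and still in the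
complement, hence zero; so the projection kills the regular coefficients too. -/
theorem isGradedSystem_of_graded (hκ : κ₀.Nondegenerate) (hadm : Admissible σ G)
    (hskew : IsSkewSystem (form κ₀) G)
    (hV : ∀ v ∈ lagr σ (form κ₀) G, (degZero 𝔤).lTensor K v ∈ lagr σ (form κ₀) G ∧
      (degTwo 𝔤).lTensor K v ∈ lagr σ (form κ₀) G) : IsGradedSystem G := by
  have hσ := hadm.mul_self
  have key : ∀ (T : Module.End ℂ (Cotangent 𝔤)), (∀ v ∈ lagr σ (form κ₀) G,
      T.lTensor K v ∈ lagr σ (form κ₀) G) → ∀ m k a, T a = 0 → T (G m k a) = 0 := by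
    intro T hT m k a ha
    obtain ⟨u, hu⟩ := exists_isBasic hadm k a
    have hu' := hT u (isBasic_mem_lagr hσ hskew hu)
    have hp : T.lTensor K u ∈ posPart _ σ := fun n => by
      rw [tcoeff_lTensor, hu.neg]
      split_ifs
      · exact ha
      · exact map_zero _
    have h0 := eq_zero_of_mem_posPart_of_mem_lagr (form_nondegenerate hκ) hσ
      (fun m a => exists_isBasic hadm m a) hp hu'
    rw [← hu.nonneg, ← tcoeff_lTensor, h0, map_zero]
  refine fun m k => ⟨fun a => ?_, fun a => ?_⟩
  · exact congrArg Prod.snd (key (degTwo 𝔤) (fun v hv => (hV v hv).2) m k (incl 𝔤 a)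
      (map_zero (eps 𝔤)))
  · exact congrArg Prod.fst (key (degZero 𝔤) (fun v hv => (hV v hv).1) m k (eps 𝔤 a)
      (map_zero (incl 𝔤)))

/-- Graded Lagrangian complements come from solutions of the Yang-Baxter equation in `𝔤`. -/
theorem IsGradedLagrangianComplement.exists_rhoSer (hs : κ₀.IsSymm) (hκ : κ₀.Nondegenerate)
    (hσ : σ = 1 ∨ σ = -1) {V : Submodule ℂ (K ⊗[ℂ] Cotangent 𝔤)}
    (hV : IsGradedLagrangianComplement (tres σ) κ₀ (posPart _ σ) V) :
    ∃ g : Ser 2 ⊗[ℂ] (𝔤 ⊗[ℂ] 𝔤), (∀ i j l a b, yangBaxterCoeff (opCoeff κ₀ g) i j l a b = 0) ∧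
      Admissible σ (opCoeff (form κ₀) (rhoSer g)) ∧
      V = lagr σ (form κ₀) (opCoeff (form κ₀) (rhoSer g)) := by
  obtain ⟨G, hskew, hadm, rfl⟩ :=
    exists_eq_lagr (form_nondegenerate hκ) hσ V hV.lagrangian hV.isCompl
  have hG := isGradedSystem_of_graded hκ hadm hskew hV.graded
  obtain ⟨g, rfl⟩ := exists_opCoeff_rhoSer_eq hs hκ hG hskew
  refine ⟨g, fun i j l a b => ?_, hadm, rfl⟩
  have h := yangBaxterCoeff_eq_zero_of_lie_mem_lagr (form_nondegenerate hκ) hadm hskew hV.lie_mem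
    i j l (incl 𝔤 a) (incl 𝔤 b)
  rw [yangBaxterCoeff_incl_incl (opCoeff_rhoSer_incl g)] at h
  exact congrArg Prod.fst h

theorem rhoSer_injective (hκ : κ₀.Nondegenerate) : Function.Injective (rhoSer (𝔤 := 𝔤)) := by
  intro g g' h
  refine ext_coeffTwo fun m k => op_injective hκ (LinearMap.ext fun a => ?_)
  have e : incl 𝔤 (opCoeff κ₀ g m k a) = incl 𝔤 (opCoeff κ₀ g' m k a) := by
    rw [← opCoeff_rhoSer_incl, ← opCoeff_rhoSer_incl, h]
  exact congrArg Prod.fst e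

-- Both components of a central element of 𝔡 are central in 𝔤. This is the only use of simplicity.
omit [FiniteDimensional ℂ 𝔤] in
theorem eq_zero_of_forall_lie_eq_zero [LieAlgebra.IsSimple ℂ 𝔤] (z : Cotangent 𝔤)
    (hz : ∀ x : Cotangent 𝔤, ⁅x, z⁆ = 0) : z = 0 := by
  have h : ∀ y : 𝔤, (∀ x : 𝔤, ⁅x, y⁆ = 0) → y = 0 := fun y hy => by
    have : y ∈ LieAlgebra.center ℂ 𝔤 := hy
    rwa [LieAlgebra.center_eq_bot, LieSubmodule.mem_bot] at this
  refine Cotangent.ext (h _ fun x => ?_) (h _ fun x => ?_)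
  · exact congrArg Prod.fst (hz (incl 𝔤 x))
  · have := congrArg Prod.snd (hz (incl 𝔤 x))
    simpa using this

end GradedComplements

/-! ### The topological case -/

section Topological

variable {𝔭 : Type*} [LieRing 𝔭] [LieAlgebra ℂ 𝔭] {β : LinearMap.BilinForm ℂ 𝔭}

theorem resTwo_isBasic {G : ℕ → ℕ → Module.End ℂ 𝔭} {m k : ℕ} {a b : 𝔭} {u v : K ⊗[ℂ] 𝔭}
    (hu : IsBasic 1 G m a u) (hv : IsBasic 1 G k b v) (s : Ser 2 ⊗[ℂ] (𝔭 ⊗[ℂ] 𝔭)) :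
    resTwo β s u v = LinearMap.BilinForm.tmul β β (coeffTwo _ m k s) (a ⊗ₜ b) := by
  rw [resTwo_eq_sum s u v (m + 1) (k + 1)
    (fun n hn => by rw [hu.neg, if_neg (by omega)])
    (fun n hn => by rw [hv.neg, if_neg (by omega)]), Finset.sum_eq_single m,
    Finset.sum_eq_single k, hu.neg, hv.neg, if_pos rfl, if_pos rfl]
  · intro n _ hn
    rw [hv.neg, if_neg hn, TensorProduct.tmul_zero, map_zero]
  · simp
  · intro n _ hn
    refine Finset.sum_eq_zero fun p _ => ?_
    rw [hu.neg, if_neg hn, TensorProduct.zero_tmul, map_zero]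
  · simp

theorem powCoeff_polyToPow (n j : ℕ) (a : 𝔭) :
    powCoeff 𝔭 n (coef 𝔭 polyToPow ((Polynomial.X ^ j : Polynomial ℂ) ⊗ₜ a)) =
      if n = j then a else 0 := by
  rw [coef_tmul, powCoeff_tmul]
  change PowerSeries.coeff n ((Polynomial.X ^ j : Polynomial ℂ) : PowerSeries ℂ) • a = _
  rw [Polynomial.coeff_coe, Polynomial.coeff_X_pow]
  split_ifs <;> simp

theorem sum_antidiagonal_ite {X Y Z : Type*} [AddCommGroup X] [Module ℂ X] [AddCommGroup Y]
    [Module ℂ Y] [AddCommGroup Z] [Module ℂ Z] (B : X →ₗ[ℂ] Y →ₗ[ℂ] Z) (x : X) (F : ℕ → Y)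
    (j m : ℕ) : ∑ p ∈ antidiagonal (m + j), B (if p.1 = j then x else 0) (F p.2) = B x (F m) := by
  rw [Finset.sum_eq_single (j, m), if_pos rfl]
  · rintro ⟨p, q⟩ hp hne
    rw [mem_antidiagonal] at hp
    rw [if_neg, map_zero, LinearMap.zero_apply]
    rintro rfl
    exact hne (Prod.ext rfl (by simp only at hp ⊢; omega))
  · intro h
    exact (h (mem_antidiagonal.2 (add_comm _ _))).elim

theorem sum_antidiagonal_ite_eq_zero {X Y Z : Type*} [AddCommGroup X] [Module ℂ X]
    [AddCommGroup Y] [Module ℂ Y] [AddCommGroup Z] [Module ℂ Z] (B : X →ₗ[ℂ] Y →ₗ[ℂ] Z) (x : X)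
    (F : ℕ → Y) {j m : ℕ} (h : m < j) :
    ∑ p ∈ antidiagonal m, B (if p.1 = j then x else 0) (F p.2) = 0 := by
  refine Finset.sum_eq_zero fun p hp => ?_
  rw [mem_antidiagonal] at hp
  rw [if_neg (by omega), map_zero, LinearMap.zero_apply]

variable [FiniteDimensional ℂ 𝔭] (hβ : β.Nondegenerate)

/-- The cobracket is determined by its restriction to polynomials. -/
theorem eq_of_cobracket_eq (hz : ∀ z : 𝔭, (∀ x : 𝔭, ⁅x, z⁆ = 0) → z = 0)
    {h h' : Ser 2 ⊗[ℂ] (𝔭 ⊗[ℂ] 𝔭)}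
    (heq : ∀ x, cobracket hβ h (coef 𝔭 polyToPow x) = cobracket hβ h' (coef 𝔭 polyToPow x)) :
    h = h' := by
  set d : ℕ → ℕ → 𝔭 ⊗[ℂ] 𝔭 := fun m k => coeffTwo _ m k h - coeffTwo _ m k h' with hd
  -- The two cobrackets are compared on tʲ a, where the Casimir terms cancel. Only `j = 0` and `j =
  -- 1` are used.
  have key : ∀ j a m k, ∑ p ∈ antidiagonal m, legOne 𝔭 (if p.1 = j then a else 0) (d p.2 k) +
      ∑ p ∈ antidiagonal k, legTwo 𝔭 (if p.1 = j then a else 0) (d m p.2) = 0 := by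
    intro j a m k
    have e := congrArg (coeffTwo _ m k) (heq ((Polynomial.X ^ j : Polynomial ℂ) ⊗ₜ a))
    simp only [coeffTwo_cobracket, powCoeff_polyToPow] at e
    simp only [hd, map_sub, Finset.sum_sub_distrib]
    rw [sub_right_inj] at e
    rw [sub_add_sub_comm, e, sub_self]
  have h0 : ∀ a m k, legOne 𝔭 a (d m k) = -legTwo 𝔭 a (d m k) := by
    intro a m k
    have e := key 0 a m k
    have e₁ := sum_antidiagonal_ite (legOne 𝔭) a (fun n => d n k) 0 m
    have e₂ := sum_antidiagonal_ite (legTwo 𝔭) a (fun n => d m n) 0 k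
    simp only [add_zero] at e₁ e₂
    rw [e₁, e₂] at e
    exact eq_neg_of_add_eq_zero_left e
  -- Constants make each coefficient invariant; t a relates the indices (m, k + 1) and (m + 1, k).
  -- Descending in `k` ends at the edge, where the second sum is empty.
  have h1 : ∀ k a m, legOne 𝔭 a (d m k) = 0 := by
    intro k
    induction k with
    | zero =>
      intro a m
      have e := key 1 a (m + 1) 0
      rwa [sum_antidiagonal_ite (legOne 𝔭) a (fun n => d n 0),
        sum_antidiagonal_ite_eq_zero (legTwo 𝔭) a (fun n => d (m + 1) n) Nat.zero_lt_one,
        add_zero] at e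
    | succ k ih =>
      intro a m
      have e := key 1 a (m + 1) (k + 1)
      rw [sum_antidiagonal_ite (legOne 𝔭) a (fun n => d n (k + 1)),
        sum_antidiagonal_ite (legTwo 𝔭) a (fun n => d (m + 1) n)] at e
      have e' := h0 a (m + 1) k
      rw [ih] at e'
      rwa [neg_eq_zero.1 e'.symm, add_zero] at e
  refine ext_coeffTwo fun m k => sub_eq_zero.1 ?_
  refine op_injective hβ (LinearMap.ext fun b => ?_)
  rw [map_zero, LinearMap.zero_apply]
  refine hz _ fun x => ?_
  change ⁅x, op β (d m k) b⁆ = 0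
  rw [← op_legOne, h1, map_zero, LinearMap.zero_apply]

end Topological

/-! ### Graded topological structures and series with coefficients in 𝔤. -/

section TopologicalGraded

open Cotangent

variable {𝔤 : Type*} [LieRing 𝔤] [LieAlgebra ℂ 𝔤] [FiniteDimensional ℂ 𝔤]
  {κ₀ : LinearMap.BilinForm ℂ 𝔤}

theorem isGradedTopLieBialgebra_cobracket (hs : κ₀.IsSymm) (hκ : κ₀.Nondegenerate)
    (hi : κ₀.lieInvariant 𝔤) {g : Ser 2 ⊗[ℂ] (𝔤 ⊗[ℂ] 𝔤)}
    (hE : ∀ i j l a b, yangBaxterCoeff (opCoeff κ₀ g) i j l a b = 0) :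
    IsGradedTopLieBialgebra κ₀ (cobracket (form_nondegenerate hκ) (rhoSer g)) := by
  have hskew := isSkewSystem_rhoSer hs g
  have hE' := yangBaxterCoeff_rhoSer hs hκ hi hE
  refine ⟨isTopLieBialgebra_cobracket _ (form_isSymm hs) (form_lieInvariant hi) hskew hE',
    lagr 1 (form κ₀) (opCoeff (form κ₀) (rhoSer g)), ?_, fun x w₁ h₁ w₂ h₂ =>
      resTwo_cobracket _ (form_isSymm hs) (form_lieInvariant hi) hskew x h₁ h₂⟩
  rw [range_powToLaurent]
  exact isGradedLagrangianComplement_lagr hs hκ hi (Or.inl rfl) hskew (isGradedSystem_rhoSer g) hE'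

/-- The complement yields `g`. Pairing with its basic series reads off every coefficient of δ(x),
and the cobracket of `rhoSer g` satisfies the same duality. -/
theorem IsGradedTopLieBialgebra.exists_eq_cobracket (hs : κ₀.IsSymm) (hκ : κ₀.Nondegenerate)
    (hi : κ₀.lieInvariant 𝔤)
    {δ : O ⊗[ℂ] Cotangent 𝔤 →ₗ[ℂ] Ser 2 ⊗[ℂ] (Cotangent 𝔤 ⊗[ℂ] Cotangent 𝔤)}
    (hδ : IsGradedTopLieBialgebra κ₀ δ) :
    ∃ g : Ser 2 ⊗[ℂ] (𝔤 ⊗[ℂ] 𝔤), (∀ i j l a b, yangBaxterCoeff (opCoeff κ₀ g) i j l a b = 0) ∧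
      δ = cobracket (form_nondegenerate hκ) (rhoSer g) := by
  obtain ⟨V, hV, hdual⟩ := hδ.double
  rw [range_powToLaurent] at hV
  obtain ⟨g, hE, hadm, rfl⟩ :=
    IsGradedLagrangianComplement.exists_rhoSer (σ := 1) hs hκ (Or.inl rfl) hV
  have hskew := isSkewSystem_rhoSer hs g
  refine ⟨g, hE, LinearMap.ext fun x => ext_coeffTwo fun m k =>
    eq_of_tmul (form_nondegenerate hκ) fun a b => ?_⟩
  obtain ⟨u, hu⟩ := exists_isBasic hadm m a
  obtain ⟨v, hv⟩ := exists_isBasic hadm k b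
  have hu' := isBasic_mem_lagr rfl hskew hu
  have hv' := isBasic_mem_lagr rfl hskew hv
  rw [← resTwo_isBasic hu hv, ← resTwo_isBasic hu hv, hdual x u hu' v hv',
    resTwo_cobracket _ (form_isSymm hs) (form_lieInvariant hi) hskew x hu' hv']
  rfl

end TopologicalGraded

/-! ### Coefficients of polynomials -/

section PolynomialCoefficients

variable {V W : Type*} [AddCommGroup V] [Module ℂ V] [AddCommGroup W] [Module ℂ W]

/-- The coefficient of `tⁿ` of an element of `V[t]`. -/
def polyCoeff (V : Type*) [AddCommGroup V] [Module ℂ V] (n : ℕ) : Polynomial ℂ ⊗[ℂ] V →ₗ[ℂ] V :=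
  evalCoef V (Polynomial.lcoeff ℂ n)

theorem polyCoeff_tmul (n : ℕ) (f : Polynomial ℂ) (v : V) :
    polyCoeff V n (f ⊗ₜ v) = f.coeff n • v := evalCoef_tmul _ _ _

theorem polyToPow_apply (f : Polynomial ℂ) : polyToPow f = (f : PowerSeries ℂ) := rfl

theorem powCoeff_coef_polyToPow (n : ℕ) (x : Polynomial ℂ ⊗[ℂ] V) :
    powCoeff V n (coef V polyToPow x) = polyCoeff V n x := by
  induction x with
  | zero => simp
  | tmul f v => rw [coef_tmul, powCoeff_tmul, polyCoeff_tmul, polyToPow_apply, Polynomial.coeff_coe]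
  | add x y hx hy => rw [map_add, map_add, map_add, hx, hy]

theorem laurentCoeff_polyToLaurentInv (k : ℤ) (f : Polynomial ℂ) :
    laurentCoeff (-1 * k) (polyToLaurentInv f) = if 0 ≤ k then f.coeff k.toNat else 0 := by
  induction f using Polynomial.induction_on' with
  | add f g hf hg =>
    rw [map_add, map_add, hf, hg]
    split_ifs <;> simp
  | monomial n r =>
    rw [polyToLaurentInv, Polynomial.aeval_monomial, ← Algebra.smul_def, map_smul]
    have : laurentPow (-1) ^ n = laurentPow (-(n : ℤ)) := by
      refine (HahnSeries.single_pow (R := ℂ) (-1 : ℤ) n 1).trans ?_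
      rw [one_pow]
      simp [laurentPow]
    rw [this, laurentCoeff_apply, laurentPow, HahnSeries.coeff_single, Polynomial.coeff_monomial]
    by_cases h : k = n
    · rw [if_pos (by omega), if_pos (by omega), if_pos (by omega), smul_eq_mul, mul_one]
    · rw [if_neg (by omega), smul_zero]
      split_ifs
      · omega
      · rfl
      · rfl

theorem tcoeff_polyToLaurentInv (n : ℕ) (x : Polynomial ℂ ⊗[ℂ] V) :
    tcoeff V (-1) n (coef V polyToLaurentInv x) = polyCoeff V n x := by
  induction x with
  | zero => simp
  | tmul f v =>
    rw [coef_tmul, tcoeff_tmul, polyCoeff_tmul, laurentCoeff_polyToLaurentInv, if_pos (by omega),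
      Int.toNat_natCast]
  | add x y hx hy => rw [map_add, map_add, map_add, hx, hy]

theorem polyToLaurentInv_mem_posPart (x : Polynomial ℂ ⊗[ℂ] V) :
    coef V polyToLaurentInv x ∈ posPart V (-1) := fun k => by
  induction x with
  | zero => simp
  | tmul f v => rw [coef_tmul, tcoeff_tmul, laurentCoeff_polyToLaurentInv, if_neg (by omega),
      zero_smul]
  | add x y hx hy => rw [map_add, map_add, hx, hy, add_zero]

/-- `v ↦ tⁿ v`. -/
def polyMonomial (V : Type*) [AddCommGroup V] [Module ℂ V] (n : ℕ) : V →ₗ[ℂ] Polynomial ℂ ⊗[ℂ] V :=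
  TensorProduct.mk ℂ (Polynomial ℂ) V (Polynomial.X ^ n)

theorem polyCoeff_polyMonomial (m n : ℕ) (v : V) :
    polyCoeff V m (polyMonomial V n v) = if m = n then v else 0 := by
  rw [polyMonomial, TensorProduct.mk_apply, polyCoeff_tmul, Polynomial.coeff_X_pow]
  split_ifs <;> simp

theorem exists_polyCoeff_eq_zero (x : Polynomial ℂ ⊗[ℂ] V) :
    ∃ N, ∀ n, N ≤ n → polyCoeff V n x = 0 := by
  induction x with
  | zero => exact ⟨0, fun n _ => map_zero _⟩
  | tmul f v =>
    refine ⟨f.natDegree + 1, fun n hn => ?_⟩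
    rw [polyCoeff_tmul, Polynomial.coeff_eq_zero_of_natDegree_lt (by omega), zero_smul]
  | add x y hx hy =>
    obtain ⟨N, hN⟩ := hx
    obtain ⟨M, hM⟩ := hy
    exact ⟨max N M, fun n hn => by rw [map_add, hN n (by omega), hM n (by omega), add_zero]⟩

theorem exists_sum_polyMonomial (x : Polynomial ℂ ⊗[ℂ] V) : ∃ N, ∀ n, N ≤ n →
    ∑ m ∈ Finset.range n, polyMonomial V m (polyCoeff V m x) = x := by
  induction x with
  | zero => exact ⟨0, fun n _ => by simp⟩
  | tmul f v =>
    refine ⟨f.natDegree + 1, fun n hn => ?_⟩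
    conv_rhs => rw [f.as_sum_range' n (by omega), TensorProduct.sum_tmul]
    refine Finset.sum_congr rfl fun m _ => ?_
    rw [polyCoeff_tmul, polyMonomial, TensorProduct.mk_apply, ← TensorProduct.smul_tmul,
      ← Polynomial.smul_X_eq_monomial]
  | add x y hx hy =>
    obtain ⟨N, hN⟩ := hx
    obtain ⟨M, hM⟩ := hy
    refine ⟨max N M, fun n hn => ?_⟩
    simp only [map_add, Finset.sum_add_distrib]
    rw [hN n (by omega), hM n (by omega)]

theorem range_polyToLaurentInv [FiniteDimensional ℂ V] :
    LinearMap.range (coef V polyToLaurentInv) = posPart V (-1) := by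
  refine le_antisymm ?_ fun x hx => ?_
  · rintro _ ⟨x, rfl⟩
    exact polyToLaurentInv_mem_posPart x
  · obtain ⟨A, hA⟩ := exists_lt_tcoeff_eq_zero (σ := -1) x
    -- In t⁻¹ the bound `A` says that no power of t above -A occurs; the extra 1 keeps the top one.
    refine ⟨∑ n ∈ Finset.range ((-A).toNat + 1), polyMonomial V n (tcoeff V (-1) n x),
      ext_tcoeff (σ := -1) rfl fun n => ?_⟩
    obtain ⟨i, rfl⟩ | ⟨k, rfl⟩ := nonneg_or_neg n
    · rw [tcoeff_polyToLaurentInv, map_sum]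
      simp only [polyCoeff_polyMonomial]
      rw [Finset.sum_ite_eq]
      split_ifs with h
      · rfl
      · rw [Finset.mem_range] at h
        exact (hA _ (by omega)).symm
    · rw [hx k]
      exact polyToLaurentInv_mem_posPart _ k

/-- A tensor is a finite sum rebuilt from its coefficients. No basis is chosen, because the second
factor `W` is itself infinite-dimensional in the applications. -/
theorem eq_of_rTensor_polyCoeff {s t : (Polynomial ℂ ⊗[ℂ] V) ⊗[ℂ] W}
    (h : ∀ m, (polyCoeff V m).rTensor W s = (polyCoeff V m).rTensor W t) : s = t := by
  have key : ∀ s : (Polynomial ℂ ⊗[ℂ] V) ⊗[ℂ] W, ∃ N, ∀ n, N ≤ n → ∑ m ∈ Finset.range n,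
      (polyMonomial V m).rTensor W ((polyCoeff V m).rTensor W s) = s := by
    intro s
    induction s with
    | zero => exact ⟨0, fun n _ => by simp⟩
    | tmul x w =>
      obtain ⟨N, hN⟩ := exists_sum_polyMonomial x
      refine ⟨N, fun n hn => ?_⟩
      conv_rhs => rw [← hN n hn, TensorProduct.sum_tmul]
      rfl
    | add x y hx hy =>
      obtain ⟨N, hN⟩ := hx
      obtain ⟨M, hM⟩ := hy
      refine ⟨max N M, fun n hn => ?_⟩
      simp only [map_add, Finset.sum_add_distrib]
      rw [hN n (by omega), hM n (by omega)]
  obtain ⟨N, hN⟩ := key s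
  obtain ⟨M, hM⟩ := key t
  rw [← hN (max N M) (by omega), ← hM (max N M) (by omega)]
  exact Finset.sum_congr rfl fun m _ => by rw [h]

theorem eq_of_lTensor_polyCoeff {s t : W ⊗[ℂ] (Polynomial ℂ ⊗[ℂ] V)}
    (h : ∀ m, (polyCoeff V m).lTensor W s = (polyCoeff V m).lTensor W t) : s = t := by
  refine (TensorProduct.comm ℂ W _).injective (eq_of_rTensor_polyCoeff fun m => ?_)
  have e : ∀ s : W ⊗[ℂ] (Polynomial ℂ ⊗[ℂ] V), (polyCoeff V m).rTensor W
      (TensorProduct.comm ℂ W _ s) = TensorProduct.comm ℂ W V ((polyCoeff V m).lTensor W s) :=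
    fun s => TensorProduct.map_comm _ _ s
  rw [e, e, h]

theorem eq_of_map_polyCoeff {s t : (Polynomial ℂ ⊗[ℂ] V) ⊗[ℂ] (Polynomial ℂ ⊗[ℂ] W)}
    (h : ∀ m k, TensorProduct.map (polyCoeff V m) (polyCoeff W k) s =
      TensorProduct.map (polyCoeff V m) (polyCoeff W k) t) : s = t := by
  refine eq_of_rTensor_polyCoeff fun m => eq_of_lTensor_polyCoeff fun k => ?_
  rw [← LinearMap.comp_apply, ← LinearMap.comp_apply, LinearMap.lTensor_comp_rTensor]
  exact h m k

theorem eq_of_map_map_polyCoeff {V' : Type*} [AddCommGroup V'] [Module ℂ V']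
    {s t : (Polynomial ℂ ⊗[ℂ] V) ⊗[ℂ] ((Polynomial ℂ ⊗[ℂ] W) ⊗[ℂ] (Polynomial ℂ ⊗[ℂ] V'))}
    (h : ∀ m k l, TensorProduct.map (polyCoeff V m)
        (TensorProduct.map (polyCoeff W k) (polyCoeff V' l)) s =
      TensorProduct.map (polyCoeff V m) (TensorProduct.map (polyCoeff W k) (polyCoeff V' l)) t) :
    s = t := by
  refine eq_of_rTensor_polyCoeff (W := (Polynomial ℂ ⊗[ℂ] W) ⊗[ℂ] (Polynomial ℂ ⊗[ℂ] V'))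
    fun m => ?_
  refine (TensorProduct.leftComm ℂ V (Polynomial ℂ ⊗[ℂ] W) (Polynomial ℂ ⊗[ℂ] V')).injective
    (eq_of_rTensor_polyCoeff (W := V ⊗[ℂ] (Polynomial ℂ ⊗[ℂ] V')) fun k => ?_)
  refine (TensorProduct.assoc ℂ W V (Polynomial ℂ ⊗[ℂ] V')).symm.injective
    (eq_of_lTensor_polyCoeff fun l => ?_)
  have e : ∀ s : (Polynomial ℂ ⊗[ℂ] V) ⊗[ℂ] ((Polynomial ℂ ⊗[ℂ] W) ⊗[ℂ] (Polynomial ℂ ⊗[ℂ] V')),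
      (polyCoeff V' l).lTensor (W ⊗[ℂ] V) ((TensorProduct.assoc ℂ W V _).symm
        ((polyCoeff W k).rTensor _ (TensorProduct.leftComm ℂ V _ _
          ((polyCoeff V m).rTensor _ s)))) =
      (TensorProduct.assoc ℂ W V V').symm (TensorProduct.leftComm ℂ V W V'
        (TensorProduct.map (polyCoeff V m)
          (TensorProduct.map (polyCoeff W k) (polyCoeff V' l)) s)) := by
    intro s
    induction s with
    | zero => simp
    | tmul x t =>
      induction t with
      | zero => simp
      | tmul y z => rfl
      | add s t hs ht => simp only [TensorProduct.tmul_add, map_add, hs, ht]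
    | add s t hs ht => simp only [map_add, hs, ht]
  rw [e, e, h]

end PolynomialCoefficients

/-! ### Polynomials in two variables -/

section PolynomialTensors

variable {𝔭 : Type*} [LieRing 𝔭] [LieAlgebra ℂ 𝔭]

theorem coeff_toMvPowerSeries_mul (f g : O) (m k : ℕ) :
    MvPowerSeries.coeff (Finsupp.single 0 m + Finsupp.single 1 k)
      (PowerSeries.toMvPowerSeries (0 : Fin 2) f * PowerSeries.toMvPowerSeries (1 : Fin 2) g) =
      PowerSeries.coeff m f * PowerSeries.coeff k g := by
  have h := coeffTwo_ext_atVar_zero (LinearMap.mul ℂ ℂ) m k (f ⊗ₜ[ℂ] (1 : ℂ))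
    (PowerSeries.toMvPowerSeries (1 : Fin 2) g ⊗ₜ[ℂ] (1 : ℂ))
  rw [coef_tmul, ext_tmul, coeffTwo_eq, evalCoef_tmul, Finset.sum_eq_single (m, 0), powCoeff_tmul,
    coeffTwo_eq, evalCoef_tmul, coeff_toMvPowerSeries, if_pos] at h
  · simpa using h
  · ext i
    fin_cases i <;> simp
  · rintro ⟨p, q⟩ hp hne
    rw [mem_antidiagonal] at hp
    rw [coeffTwo_eq, evalCoef_tmul, coeff_toMvPowerSeries, if_neg, zero_smul, map_zero]
    intro hq
    have := DFunLike.congr_fun hq 0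
    simp at this
    exact hne (Prod.ext (by simp only at hp ⊢; omega) this)
  · simp

theorem polyTensorToSer_tmul (f g : Polynomial ℂ) (a b : 𝔭) :
    polyTensorToSer 𝔭 ((f ⊗ₜ a) ⊗ₜ (g ⊗ₜ b)) =
      (PowerSeries.toMvPowerSeries (0 : Fin 2) (polyToPow f) *
        PowerSeries.toMvPowerSeries (1 : Fin 2) (polyToPow g)) ⊗ₜ (a ⊗ₜ b) := rfl

theorem tensor_induction {A B : Type*} [AddCommGroup A] [Module ℂ A] [AddCommGroup B] [Module ℂ B]
    {V W : Type*} [AddCommGroup V] [Module ℂ V] [AddCommGroup W] [Module ℂ W]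
    {motive : (A ⊗[ℂ] V) ⊗[ℂ] (B ⊗[ℂ] W) → Prop} (zero : motive 0)
    (tmul : ∀ f a g b, motive ((f ⊗ₜ a) ⊗ₜ (g ⊗ₜ b)))
    (add : ∀ s t, motive s → motive t → motive (s + t)) (t : (A ⊗[ℂ] V) ⊗[ℂ] (B ⊗[ℂ] W)) :
    motive t := by
  induction t with
  | zero => exact zero
  | tmul x y =>
    induction x with
    | zero => rwa [TensorProduct.zero_tmul]
    | tmul f a =>
      induction y with
      | zero => rwa [TensorProduct.tmul_zero]
      | tmul g b => exact tmul f a g b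
      | add y y' hy hy' =>
        rw [TensorProduct.tmul_add]
        exact add _ _ hy hy'
    | add x x' hx hx' =>
      rw [TensorProduct.add_tmul]
      exact add _ _ hx hx'
  | add x y hx hy => exact add _ _ hx hy

theorem coeffTwo_polyTensorToSer (m k : ℕ)
    (t : (Polynomial ℂ ⊗[ℂ] 𝔭) ⊗[ℂ] (Polynomial ℂ ⊗[ℂ] 𝔭)) :
    coeffTwo _ m k (polyTensorToSer 𝔭 t) =
      TensorProduct.map (polyCoeff 𝔭 m) (polyCoeff 𝔭 k) t := by
  induction t using tensor_induction with
  | zero => simp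
  | tmul f a g b =>
    rw [polyTensorToSer_tmul, coeffTwo_eq, evalCoef_tmul, coeff_toMvPowerSeries_mul,
      TensorProduct.map_tmul, polyCoeff_tmul, polyCoeff_tmul, polyToPow_apply, polyToPow_apply,
      Polynomial.coeff_coe, Polynomial.coeff_coe, TensorProduct.smul_tmul_smul]
  | add s t hs ht => simp only [map_add, hs, ht]

theorem polyTensorToSer_injective : Function.Injective (polyTensorToSer 𝔭) := fun s t h =>
  eq_of_map_polyCoeff fun m k => by
    rw [← coeffTwo_polyTensorToSer, ← coeffTwo_polyTensorToSer, h]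

theorem mem_range_polyTensorToSer [FiniteDimensional ℂ 𝔭] {s : Ser 2 ⊗[ℂ] (𝔭 ⊗[ℂ] 𝔭)} {N : ℕ}
    (hN : ∀ m k, N ≤ m ∨ N ≤ k → coeffTwo _ m k s = 0) :
    s ∈ LinearMap.range (polyTensorToSer 𝔭) := by
  refine ⟨∑ m ∈ Finset.range N, ∑ k ∈ Finset.range N,
    TensorProduct.map (polyMonomial 𝔭 m) (polyMonomial 𝔭 k) (coeffTwo _ m k s),
    ext_coeffTwo fun i j => ?_⟩
  have h : ∀ m k (t : 𝔭 ⊗[ℂ] 𝔭), TensorProduct.map (polyCoeff 𝔭 i) (polyCoeff 𝔭 j)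
      (TensorProduct.map (polyMonomial 𝔭 m) (polyMonomial 𝔭 k) t) =
      if i = m then if j = k then t else 0 else 0 := by
    intro m k t
    induction t with
    | zero => simp
    | tmul a b =>
      rw [TensorProduct.map_tmul, TensorProduct.map_tmul, polyCoeff_polyMonomial,
        polyCoeff_polyMonomial]
      split_ifs <;> simp
    | add x y hx hy =>
      rw [map_add, map_add, hx, hy]
      split_ifs <;> simp
  simp only [coeffTwo_polyTensorToSer, map_sum, h]
  rw [Finset.sum_comm]
  simp only [Finset.sum_ite_eq, Finset.mem_range]
  split_ifs with h₁
  · rw [Finset.sum_ite_eq]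
    split_ifs with h₂
    · rfl
    · exact (hN i j (Or.inr (by simpa using h₂))).symm
  · rw [Finset.sum_const_zero]
    exact (hN i j (Or.inl (not_lt.1 h₁))).symm

theorem exists_lift_polyTensorToSer [FiniteDimensional ℂ 𝔭]
    (δ : O ⊗[ℂ] 𝔭 →ₗ[ℂ] Ser 2 ⊗[ℂ] (𝔭 ⊗[ℂ] 𝔭))
    (h : ∀ x, ∃ N, ∀ m k, N ≤ m ∨ N ≤ k → coeffTwo _ m k (δ (coef 𝔭 polyToPow x)) = 0) :
    ∃ δ' : Polynomial ℂ ⊗[ℂ] 𝔭 →ₗ[ℂ] (Polynomial ℂ ⊗[ℂ] 𝔭) ⊗[ℂ] (Polynomial ℂ ⊗[ℂ] 𝔭),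
      ∀ x, δ (coef 𝔭 polyToPow x) = polyTensorToSer 𝔭 (δ' x) := by
  -- A linear left inverse produces all preimages at once and so keeps the lift linear.
  obtain ⟨L, hL⟩ := (polyTensorToSer 𝔭).exists_leftInverse_of_injective
    (LinearMap.ker_eq_bot'.2 fun t ht => polyTensorToSer_injective (ht.trans (map_zero _).symm))
  refine ⟨L ∘ₗ δ ∘ₗ coef 𝔭 polyToPow, fun x => ?_⟩
  obtain ⟨N, hN⟩ := h x
  obtain ⟨t, ht⟩ := mem_range_polyTensorToSer hN
  rw [LinearMap.comp_apply, LinearMap.comp_apply, ← ht, ← LinearMap.comp_apply L, hL,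
    LinearMap.id_apply]

theorem polyTensorToSer_legOne (x : Polynomial ℂ ⊗[ℂ] 𝔭)
    (t : (Polynomial ℂ ⊗[ℂ] 𝔭) ⊗[ℂ] (Polynomial ℂ ⊗[ℂ] 𝔭)) :
    polyTensorToSer 𝔭 (legOne _ x t) =
      ext (Ser 2) (legOne 𝔭) (atVar 0 (coef 𝔭 polyToPow x)) (polyTensorToSer 𝔭 t) := by
  induction t using tensor_induction with
  | zero => simp
  | tmul g b g' b' =>
    induction x with
    | zero => simp
    | tmul f a =>
      rw [legOne_apply, LieAlgebra.ExtendScalars.bracket_tmul, polyTensorToSer_tmul,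
        polyTensorToSer_tmul, atVar, coef_tmul, coef_tmul, ext_tmul, legOne_apply, map_mul, map_mul,
        mul_assoc]
    | add x y hx hy => simp only [map_add, LinearMap.add_apply, hx, hy]
  | add s t hs ht => simp only [map_add, hs, ht]

theorem polyTensorToSer_legTwo (x : Polynomial ℂ ⊗[ℂ] 𝔭)
    (t : (Polynomial ℂ ⊗[ℂ] 𝔭) ⊗[ℂ] (Polynomial ℂ ⊗[ℂ] 𝔭)) :
    polyTensorToSer 𝔭 (legTwo _ x t) =
      ext (Ser 2) (legTwo 𝔭) (atVar 1 (coef 𝔭 polyToPow x)) (polyTensorToSer 𝔭 t) := by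
  induction t using tensor_induction with
  | zero => simp
  | tmul g b g' b' =>
    induction x with
    | zero => simp
    | tmul f a =>
      rw [legTwo_apply, LieAlgebra.ExtendScalars.bracket_tmul, polyTensorToSer_tmul,
        polyTensorToSer_tmul, atVar, coef_tmul, coef_tmul, ext_tmul, legTwo_apply, map_mul, map_mul,
        mul_left_comm]
    | add x y hx hy => simp only [map_add, LinearMap.add_apply, hx, hy]
  | add s t hs ht => simp only [map_add, hs, ht]

/-! ### Restriction of a topological structure to 𝔭[t]. -/

section Restriction

variable {δ : O ⊗[ℂ] 𝔭 →ₗ[ℂ] Ser 2 ⊗[ℂ] (𝔭 ⊗[ℂ] 𝔭)}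
  {δ' : Polynomial ℂ ⊗[ℂ] 𝔭 →ₗ[ℂ] (Polynomial ℂ ⊗[ℂ] 𝔭) ⊗[ℂ] (Polynomial ℂ ⊗[ℂ] 𝔭)}
  (h : ∀ x, δ (coef 𝔭 polyToPow x) = polyTensorToSer 𝔭 (δ' x))

theorem row_mul (m : ℕ) (f g : O) :
    row m (PowerSeries.toMvPowerSeries (0 : Fin 2) f * PowerSeries.toMvPowerSeries (1 : Fin 2) g) =
      PowerSeries.coeff m f • g := by
  refine PowerSeries.ext fun n => ?_
  have e : PowerSeries.coeff n (PowerSeries.coeff m f • g) =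
      PowerSeries.coeff m f * PowerSeries.coeff n g := map_smul (PowerSeries.coeff n) _ _
  rw [e, ← coeff_toMvPowerSeries_mul]
  exact PowerSeries.coeff_mk n fun n => MvPowerSeries.coeff (Finsupp.single 0 m + Finsupp.single 1 n)
    (PowerSeries.toMvPowerSeries (0 : Fin 2) f * PowerSeries.toMvPowerSeries (1 : Fin 2) g)

theorem col_mul (n : ℕ) (f g : O) :
    col n (PowerSeries.toMvPowerSeries (0 : Fin 2) f * PowerSeries.toMvPowerSeries (1 : Fin 2) g) =
      PowerSeries.coeff n g • f := by
  refine PowerSeries.ext fun m => ?_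
  have e : PowerSeries.coeff m (PowerSeries.coeff n g • f) =
      PowerSeries.coeff n g * PowerSeries.coeff m f := map_smul (PowerSeries.coeff m) _ _
  rw [e, mul_comm (PowerSeries.coeff n g), ← coeff_toMvPowerSeries_mul]
  exact PowerSeries.coeff_mk m fun m => MvPowerSeries.coeff (Finsupp.single 0 m + Finsupp.single 1 n)
    (PowerSeries.toMvPowerSeries (0 : Fin 2) f * PowerSeries.toMvPowerSeries (1 : Fin 2) g)

include h

theorem oneTensor_polyTensorToSer (m k l : ℕ)
    (t : (Polynomial ℂ ⊗[ℂ] 𝔭) ⊗[ℂ] (Polynomial ℂ ⊗[ℂ] 𝔭)) :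
    oneTensor δ m k l (polyTensorToSer 𝔭 t) =
      TensorProduct.map (polyCoeff 𝔭 m) (TensorProduct.map (polyCoeff 𝔭 k) (polyCoeff 𝔭 l))
        (δ'.lTensor _ t) := by
  induction t using tensor_induction with
  | zero => simp
  | tmul f a g b =>
    rw [polyTensorToSer_tmul, oneTensor, LinearMap.comp_apply, LinearMap.comp_apply,
      LinearMap.rTensor_tmul, row_mul, LinearEquiv.coe_coe, TensorProduct.leftComm_tmul,
      LinearMap.lTensor_tmul, LinearMap.lTensor_tmul, TensorProduct.map_tmul,
      ← TensorProduct.smul_tmul', map_smul, LinearMap.comp_apply, ← coef_tmul, h,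
      coeffTwo_polyTensorToSer, polyCoeff_tmul, TensorProduct.smul_tmul, polyToPow_apply,
      Polynomial.coeff_coe]
  | add s t hs ht => simp only [map_add, hs, ht]

theorem tensorOne_polyTensorToSer (m k l : ℕ)
    (t : (Polynomial ℂ ⊗[ℂ] 𝔭) ⊗[ℂ] (Polynomial ℂ ⊗[ℂ] 𝔭)) :
    tensorOne δ m k l (polyTensorToSer 𝔭 t) =
      TensorProduct.map (polyCoeff 𝔭 m) (TensorProduct.map (polyCoeff 𝔭 k) (polyCoeff 𝔭 l))
        (TensorProduct.assoc ℂ _ _ _ (δ'.rTensor _ t)) := by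
  induction t using tensor_induction with
  | zero => simp
  | tmul f a g b =>
    rw [polyTensorToSer_tmul, tensorOne, LinearMap.comp_apply, LinearMap.comp_apply,
      LinearMap.comp_apply, LinearMap.rTensor_tmul, col_mul, LinearEquiv.coe_coe,
      LinearEquiv.coe_coe, TensorProduct.assoc_symm_tmul,
      LinearMap.rTensor_tmul, LinearMap.rTensor_tmul, TensorProduct.map_map_assoc,
      TensorProduct.map_tmul, ← TensorProduct.smul_tmul', map_smul, LinearMap.comp_apply,
      ← coef_tmul, h, coeffTwo_polyTensorToSer, polyCoeff_tmul, TensorProduct.smul_tmul,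
      polyToPow_apply, Polynomial.coeff_coe]
  | add s t hs ht => simp only [map_add, hs, ht]

theorem IsTopLieBialgebra.isLieBialgebra (hδ : IsTopLieBialgebra δ) : IsLieBialgebra δ' where
  skew x := eq_neg_of_add_eq_zero_left (eq_of_map_polyCoeff fun m k => by
    rw [map_add, TensorProduct.map_comm, ← coeffTwo_polyTensorToSer, ← coeffTwo_polyTensorToSer,
      ← h, ← coeffTwo_flipSer, hδ.skew, map_neg, neg_add_cancel, map_zero])
  cocycle x y := polyTensorToSer_injective (by
    rw [← h, coef_lie, hδ.cocycle, h, h, map_sub, map_add, map_add, polyTensorToSer_legOne,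
      polyTensorToSer_legOne, polyTensorToSer_legTwo, polyTensorToSer_legTwo]
    rfl)
  coJacobi x := eq_of_map_map_polyCoeff fun m k l => by
    have e : ∀ t, TensorProduct.map (polyCoeff 𝔭 m)
        (TensorProduct.map (polyCoeff 𝔭 k) (polyCoeff 𝔭 l)) (TensorProduct.leftComm ℂ _ _ _ t) =
        TensorProduct.leftComm ℂ _ _ _ (TensorProduct.map (polyCoeff 𝔭 k)
        (TensorProduct.map (polyCoeff 𝔭 m) (polyCoeff 𝔭 l)) t) := by
      intro t
      induction t with
      | zero => simp
      | tmul x t =>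
        induction t with
        | zero => simp
        | tmul y z => rfl
        | add s t hs ht => simp only [TensorProduct.tmul_add, map_add, hs, ht]
      | add s t hs ht => simp only [map_add, hs, ht]
    rw [map_add, map_sub, e, ← oneTensor_polyTensorToSer h, ← oneTensor_polyTensorToSer h,
      ← tensorOne_polyTensorToSer h, ← h, hδ.coJacobi, map_zero]

end Restriction

end PolynomialTensors

/-! ### Series with finitely many coefficients -/

section FiniteSeries

/-- Series in two variables that are polynomials. -/
def IsPolynomialSer {V : Type*} [AddCommGroup V] [Module ℂ V] (s : Ser 2 ⊗[ℂ] V) : Prop :=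
  ∃ N, ∀ m k, N ≤ m ∨ N ≤ k → coeffTwo V m k s = 0

theorem isPolynomialSer_coe {V : Type*} [AddCommGroup V] [Module ℂ V]
    (p : MvPolynomial (Fin 2) ℂ ⊗[ℂ] V) :
    IsPolynomialSer (coef V (MvPolynomial.coeToMvPowerSeries.algHom ℂ) p) := by
  induction p with
  | zero => exact ⟨0, fun m k _ => by rw [map_zero, map_zero]⟩
  | tmul f v =>
    refine ⟨f.support.sup (fun d => d 0 + d 1) + 1, fun m k hmk => ?_⟩
    rw [coef_tmul, coeffTwo_eq, evalCoef_tmul]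
    have : MvPowerSeries.coeff (Finsupp.single 0 m + Finsupp.single 1 k)
        (f : MvPowerSeries (Fin 2) ℂ) = 0 := by
      rw [MvPolynomial.coeff_coe]
      by_contra hne
      have hle := Finset.le_sup (f := fun d : Fin 2 →₀ ℕ => d 0 + d 1)
        (MvPolynomial.mem_support_iff.2 hne)
      simp at hle
      omega
    refine Eq.trans (congrArg (· • v) ?_) (zero_smul ℂ v)
    exact this
  | add x y hx hy =>
    obtain ⟨N, hN⟩ := hx
    obtain ⟨M, hM⟩ := hy
    exact ⟨max N M, fun m k h => by
      rw [map_add, map_add, hN m k (by omega), hM m k (by omega), add_zero]⟩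

theorem IsPolynomialSer.exists_eq_coe {V : Type*} [AddCommGroup V] [Module ℂ V]
    [FiniteDimensional ℂ V] {s : Ser 2 ⊗[ℂ] V} (hs : IsPolynomialSer s) :
    ∃ p : MvPolynomial (Fin 2) ℂ ⊗[ℂ] V,
      s = coef V (MvPolynomial.coeToMvPowerSeries.algHom ℂ) p := by
  obtain ⟨N, hN⟩ := hs
  refine ⟨∑ m ∈ Finset.range N, ∑ k ∈ Finset.range N,
    MvPolynomial.monomial (Finsupp.single 0 m + Finsupp.single 1 k) (1 : ℂ) ⊗ₜ coeffTwo V m k s,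
    ext_coeffTwo fun i j => ?_⟩
  have h : ∀ m k (v : V), coeffTwo V i j (coef V (MvPolynomial.coeToMvPowerSeries.algHom ℂ)
      (MvPolynomial.monomial (Finsupp.single (0 : Fin 2) m + Finsupp.single 1 k) (1 : ℂ) ⊗ₜ v)) =
      if i = m then if j = k then v else 0 else 0 := by
    intro m k v
    rw [coef_tmul, coeffTwo_eq, evalCoef_tmul]
    have : MvPowerSeries.coeff (Finsupp.single 0 i + Finsupp.single 1 j)
        ((MvPolynomial.monomial (Finsupp.single (0 : Fin 2) m + Finsupp.single 1 k) (1 : ℂ) :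
          MvPolynomial (Fin 2) ℂ) : MvPowerSeries (Fin 2) ℂ) =
        if i = m then if j = k then 1 else 0 else 0 := by
      rw [MvPolynomial.coeff_coe, MvPolynomial.coeff_monomial, ← ite_and]
      refine if_congr ⟨fun e => ⟨?_, ?_⟩, ?_⟩ rfl rfl
      · simpa using (DFunLike.congr_fun e 0).symm
      · simpa using (DFunLike.congr_fun e 1).symm
      · rintro ⟨rfl, rfl⟩
        rfl
    refine (congrArg (· • v) this).trans ?_
    split_ifs <;> simp
  simp only [map_sum, h]
  rw [Finset.sum_comm]
  simp only [Finset.sum_ite_eq, Finset.mem_range]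
  by_cases h₁ : i < N
  · by_cases h₂ : j < N
    · simp [h₁, h₂]
    · simp [h₁, h₂, hN i j (Or.inr (not_lt.1 h₂))]
  · simp [h₁, hN i j (Or.inl (not_lt.1 h₁))]

variable {𝔭 : Type*} [LieRing 𝔭] [LieAlgebra ℂ 𝔭] [FiniteDimensional ℂ 𝔭]
  {β : LinearMap.BilinForm ℂ 𝔭} (hβ : β.Nondegenerate)

theorem isRational_yang_add_iff (g : Ser 2 ⊗[ℂ] (𝔭 ⊗[ℂ] 𝔭)) :
    IsRational β hβ (yang β hβ + coef _ (serToFld 2) g) ↔ IsPolynomialSer g := by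
  constructor
  · rintro ⟨p, hp⟩
    rw [← coef_comp] at hp
    rw [coef_injective (serToFld_injective 2) (add_left_cancel hp)]
    exact isPolynomialSer_coe p
  · intro h
    obtain ⟨p, rfl⟩ := h.exists_eq_coe
    exact ⟨p, by rw [← coef_comp]⟩

theorem IsPolynomialSer.cobracket {h : Ser 2 ⊗[ℂ] (𝔭 ⊗[ℂ] 𝔭)} (hh : IsPolynomialSer h)
    (x : Polynomial ℂ ⊗[ℂ] 𝔭) :
    IsPolynomialSer (cobracket hβ h (coef 𝔭 polyToPow x)) := by
  obtain ⟨N, hN⟩ := hh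
  obtain ⟨M, hM⟩ := exists_polyCoeff_eq_zero x
  -- In each convolution either the coefficient of `x` has index at least `M`, or the remaining
  -- index of `h` is at least `N`.
  refine ⟨N + M, fun m k hmk => ?_⟩
  simp only [coeffTwo_cobracket, powCoeff_coef_polyToPow]
  rw [hM (m + k + 1) (by omega), Finset.sum_eq_zero, Finset.sum_eq_zero]
  · simp
  · intro p hp
    rw [mem_antidiagonal] at hp
    rcases le_or_gt M p.1 with h₁ | h₁
    · rw [hM _ h₁, map_zero, LinearMap.zero_apply]
    · rw [hN _ _ (by omega), map_zero]
  · intro p hp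
    rw [mem_antidiagonal] at hp
    rcases le_or_gt M p.1 with h₁ | h₁
    · rw [hM _ h₁, map_zero, LinearMap.zero_apply]
    · rw [hN _ _ (by omega), map_zero]

end FiniteSeries

/-! ### Duality at infinity -/

section PolynomialDuality

variable {𝔭 : Type*} [LieRing 𝔭] [LieAlgebra ℂ 𝔭] {β : LinearMap.BilinForm ℂ 𝔭}

/-- Finiteness now comes from the polynomial, not from the poles of `w`, so the truncation is
uniform in `w`. -/
theorem exists_resForm_polyToLaurentInv (x : Polynomial ℂ ⊗[ℂ] 𝔭) : ∃ N₀, ∀ N, N₀ ≤ N →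
    ∀ w : K ⊗[ℂ] 𝔭, resForm (tres (-1)) β (coef 𝔭 polyToLaurentInv x) w =
      ∑ m ∈ Finset.range N, β (polyCoeff 𝔭 m x) (tcoeff 𝔭 (-1) (-(m : ℤ) - 1) w) := by
  obtain ⟨N₀, hN₀⟩ := exists_polyCoeff_eq_zero x
  refine ⟨N₀, fun N hN w => ?_⟩
  rw [resForm_eq_sum (σ := -1) rfl _ _ ((Finset.range N).map Nat.castEmbedding), Finset.sum_map]
  · refine Finset.sum_congr rfl fun m _ => ?_
    rw [Nat.castEmbedding_apply, tcoeff_polyToLaurentInv, neg_sub_comm]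
  · intro p hp
    obtain ⟨i, rfl⟩ | ⟨k, rfl⟩ := nonneg_or_neg p
    · have : N ≤ i := by
        by_contra hlt
        exact hp (Finset.mem_map.2 ⟨i, Finset.mem_range.2 (not_le.1 hlt), rfl⟩)
      rw [tcoeff_polyToLaurentInv, hN₀ _ (hN.trans this), map_zero, LinearMap.zero_apply]
    · rw [polyToLaurentInv_mem_posPart x k, map_zero, LinearMap.zero_apply]

theorem exists_tmul_resForm (t : (Polynomial ℂ ⊗[ℂ] 𝔭) ⊗[ℂ] (Polynomial ℂ ⊗[ℂ] 𝔭)) :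
    ∃ N₀, ∀ N N', N₀ ≤ N → N₀ ≤ N' → ∀ w₁ w₂ : K ⊗[ℂ] 𝔭,
      (LinearMap.BilinForm.tmul (resForm (tres (-1)) β) (resForm (tres (-1)) β))
        (TensorProduct.map (coef 𝔭 polyToLaurentInv) (coef 𝔭 polyToLaurentInv) t) (w₁ ⊗ₜ w₂) =
      ∑ m ∈ Finset.range N, ∑ k ∈ Finset.range N', LinearMap.BilinForm.tmul β β
        (TensorProduct.map (polyCoeff 𝔭 m) (polyCoeff 𝔭 k) t)
        (tcoeff 𝔭 (-1) (-(m : ℤ) - 1) w₁ ⊗ₜ tcoeff 𝔭 (-1) (-(k : ℤ) - 1) w₂) := by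
  induction t with
  | zero => exact ⟨0, fun N N' _ _ w₁ w₂ => by simp⟩
  | tmul x y =>
    obtain ⟨N, hN⟩ := exists_resForm_polyToLaurentInv (β := β) x
    obtain ⟨M, hM⟩ := exists_resForm_polyToLaurentInv (β := β) y
    refine ⟨max N M, fun n n' hn hn' w₁ w₂ => ?_⟩
    have h : ∀ {W : Type _} [AddCommGroup W] [Module ℂ W] (F : LinearMap.BilinForm ℂ W)
        (a b c d : W), LinearMap.BilinForm.tmul F F (a ⊗ₜ b) (c ⊗ₜ d) = F a c * F b d :=
      fun F a b c d => by simp [LinearMap.BilinForm.tmul, mul_comm]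
    simp only [TensorProduct.map_tmul]
    rw [h, hN n (by omega), hM n' (by omega), Finset.sum_mul_sum]
    simp only [h]
  | add s t hs ht =>
    obtain ⟨N, hN⟩ := hs
    obtain ⟨M, hM⟩ := ht
    refine ⟨max N M, fun n n' hn hn' w₁ w₂ => ?_⟩
    simp only [map_add, LinearMap.add_apply, Finset.sum_add_distrib]
    rw [hN n n' (by omega) (by omega), hM n n' (by omega) (by omega)]

theorem tmul_resForm_isBasic {G : ℕ → ℕ → Module.End ℂ 𝔭} {m k : ℕ} {a b : 𝔭} {u v : K ⊗[ℂ] 𝔭}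
    (hu : IsBasic (-1) G m a u) (hv : IsBasic (-1) G k b v)
    (t : (Polynomial ℂ ⊗[ℂ] 𝔭) ⊗[ℂ] (Polynomial ℂ ⊗[ℂ] 𝔭)) :
    (LinearMap.BilinForm.tmul (resForm (tres (-1)) β) (resForm (tres (-1)) β))
        (TensorProduct.map (coef 𝔭 polyToLaurentInv) (coef 𝔭 polyToLaurentInv) t) (u ⊗ₜ v) =
      LinearMap.BilinForm.tmul β β (TensorProduct.map (polyCoeff 𝔭 m) (polyCoeff 𝔭 k) t)
        (a ⊗ₜ b) := by
  obtain ⟨N, hN⟩ := exists_tmul_resForm (β := β) t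
  rw [hN (N + m + 1) (N + k + 1) (by omega) (by omega), Finset.sum_eq_single m,
    Finset.sum_eq_single k, hu.neg, hv.neg, if_pos rfl, if_pos rfl]
  · intro n _ hn
    rw [hv.neg, if_neg hn, TensorProduct.tmul_zero, map_zero]
  · intro h
    exact (h (Finset.mem_range.2 (by omega))).elim
  · intro n _ hn
    refine Finset.sum_eq_zero fun p _ => ?_
    rw [hu.neg, if_neg hn, TensorProduct.zero_tmul, map_zero]
  · intro h
    exact (h (Finset.mem_range.2 (by omega))).elim

variable [FiniteDimensional ℂ 𝔭] (hβ : β.Nondegenerate)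

/-- The counterpart at infinity of `resTwo_cobracket`: the same identity between coefficients, with
the sum truncated by `t`. -/
theorem tmul_resForm_cobracket (hs : β.IsSymm) (hi : β.lieInvariant 𝔭)
    {h : Ser 2 ⊗[ℂ] (𝔭 ⊗[ℂ] 𝔭)} (hadm : Admissible (-1) (opCoeff β h))
    (hG : IsSkewSystem β (opCoeff β h)) {x : Polynomial ℂ ⊗[ℂ] 𝔭}
    {t : (Polynomial ℂ ⊗[ℂ] 𝔭) ⊗[ℂ] (Polynomial ℂ ⊗[ℂ] 𝔭)}
    (ht : cobracket hβ h (coef 𝔭 polyToPow x) = polyTensorToSer 𝔭 t) {w₁ w₂ : K ⊗[ℂ] 𝔭}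
    (h₁ : w₁ ∈ lagr (-1) β (opCoeff β h)) (h₂ : w₂ ∈ lagr (-1) β (opCoeff β h)) :
    (LinearMap.BilinForm.tmul (resForm (tres (-1)) β) (resForm (tres (-1)) β))
        (TensorProduct.map (coef 𝔭 polyToLaurentInv) (coef 𝔭 polyToLaurentInv) t) (w₁ ⊗ₜ w₂) =
      resForm (tres (-1)) β (coef 𝔭 polyToLaurentInv x) ⁅w₁, w₂⁆ := by
  obtain ⟨N₀, hN₀⟩ := exists_tmul_resForm (β := β) t
  choose w hw using fun m : ℕ => exists_isBasic hadm m (tcoeff 𝔭 (-1) (-(m : ℤ) - 1) w₁)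
  choose w' hw' using fun m : ℕ => exists_isBasic hadm m (tcoeff 𝔭 (-1) (-(m : ℤ) - 1) w₂)
  obtain ⟨N, N', hN, hN', e⟩ := resForm_lie_lagr_eq_sum hβ hs hi hadm hG h₁ h₂
    (coef 𝔭 polyToLaurentInv x) w w' hw hw' N₀
  rw [hN₀ N N' hN hN', e]
  refine Finset.sum_congr rfl fun m _ => Finset.sum_congr rfl fun k _ => ?_
  rw [← tmul_coeffTwo_cobracket hβ hs hi rfl hG (hw m) (hw' k) (polyToLaurentInv_mem_posPart x)
    (coef 𝔭 polyToPow x) fun n => by rw [tcoeff_polyToLaurentInv, powCoeff_coef_polyToPow], ht,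
    coeffTwo_polyTensorToSer]

end PolynomialDuality

/-! ### Graded structures on 𝔡[t] and polynomial regular parts. -/

section PolynomialGraded

open Cotangent

variable {𝔤 : Type*} [LieRing 𝔤] [LieAlgebra ℂ 𝔤] [FiniteDimensional ℂ 𝔤]
  {κ₀ : LinearMap.BilinForm ℂ 𝔤}

omit [FiniteDimensional ℂ 𝔤] in
theorem isPolynomialSer_rhoSer {g : Ser 2 ⊗[ℂ] (𝔤 ⊗[ℂ] 𝔤)} (hg : IsPolynomialSer g) :
    IsPolynomialSer (rhoSer g) := by
  obtain ⟨N, hN⟩ := hg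
  refine ⟨N, fun m k h => ?_⟩
  rw [rhoSer, map_sub, coeffTwo_eq, evalCoef_lTensor, evalCoef_lTensor, ← coeffTwo_eq,
    coeffTwo_flipSer, hN m k h, hN k m h.symm]
  simp

theorem admissible_of_isPolynomialSer {𝔭 : Type*} [LieRing 𝔭] [LieAlgebra ℂ 𝔭]
    {β : LinearMap.BilinForm ℂ 𝔭} {h : Ser 2 ⊗[ℂ] (𝔭 ⊗[ℂ] 𝔭)} (hh : IsPolynomialSer h) :
    Admissible (-1) (opCoeff β h) := by
  obtain ⟨N, hN⟩ := hh
  exact Or.inr ⟨rfl, N, fun i k hik => by rw [opCoeff, hN i k hik, map_zero]⟩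

theorem isPolynomialSer_of_admissible (hκ : κ₀.Nondegenerate) {g : Ser 2 ⊗[ℂ] (𝔤 ⊗[ℂ] 𝔤)}
    (h : Admissible (-1) (opCoeff (form κ₀) (rhoSer g))) : IsPolynomialSer g := by
  obtain h | ⟨-, N, hN⟩ := h
  · omega
  · refine ⟨N, fun m k hmk => op_injective hκ (LinearMap.ext fun a => ?_)⟩
    have e := opCoeff_rhoSer_incl (κ₀ := κ₀) g m k a
    rw [hN m k hmk] at e
    rw [map_zero, LinearMap.zero_apply]
    exact (congrArg Prod.fst e).symm

/-- The same `g` is used at both ends: the Lie bialgebra axioms are inherited from the topological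
structure over 𝒪, while the Manin triple is the complement built from `g` in 𝔡((t⁻¹)). -/
theorem isGradedPolyLieBialgebra_of_cobracket (hs : κ₀.IsSymm) (hκ : κ₀.Nondegenerate)
    (hi : κ₀.lieInvariant 𝔤) {g : Ser 2 ⊗[ℂ] (𝔤 ⊗[ℂ] 𝔤)}
    (hE : ∀ i j l a b, yangBaxterCoeff (opCoeff κ₀ g) i j l a b = 0) (hg : IsPolynomialSer g)
    {δ : Polynomial ℂ ⊗[ℂ] Cotangent 𝔤 →ₗ[ℂ]
      (Polynomial ℂ ⊗[ℂ] Cotangent 𝔤) ⊗[ℂ] (Polynomial ℂ ⊗[ℂ] Cotangent 𝔤)}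
    (hδ : ∀ x, cobracket (form_nondegenerate hκ) (rhoSer g) (coef _ polyToPow x) =
      polyTensorToSer _ (δ x)) : IsGradedPolyLieBialgebra κ₀ δ := by
  have hskew := isSkewSystem_rhoSer hs g
  have hE' := yangBaxterCoeff_rhoSer hs hκ hi hE
  have hadm := admissible_of_isPolynomialSer (β := form κ₀) (isPolynomialSer_rhoSer hg)
  refine ⟨IsTopLieBialgebra.isLieBialgebra hδ (isTopLieBialgebra_cobracket _ (form_isSymm hs)
    (form_lieInvariant hi) hskew hE'), lagr (-1) (form κ₀) (opCoeff (form κ₀) (rhoSer g)), ?_,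
    fun x w₁ h₁ w₂ h₂ => tmul_resForm_cobracket _ (form_isSymm hs) (form_lieInvariant hi) hadm
      hskew (hδ x) h₁ h₂⟩
  rw [range_polyToLaurentInv]
  exact isGradedLagrangianComplement_lagr hs hκ hi hadm hskew (isGradedSystem_rhoSer g) hE'

theorem IsGradedPolyLieBialgebra.exists_cobracket (hs : κ₀.IsSymm) (hκ : κ₀.Nondegenerate)
    (hi : κ₀.lieInvariant 𝔤)
    {δ : Polynomial ℂ ⊗[ℂ] Cotangent 𝔤 →ₗ[ℂ]
      (Polynomial ℂ ⊗[ℂ] Cotangent 𝔤) ⊗[ℂ] (Polynomial ℂ ⊗[ℂ] Cotangent 𝔤)}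
    (hδ : IsGradedPolyLieBialgebra κ₀ δ) :
    ∃ g : Ser 2 ⊗[ℂ] (𝔤 ⊗[ℂ] 𝔤), (∀ i j l a b, yangBaxterCoeff (opCoeff κ₀ g) i j l a b = 0) ∧
      IsPolynomialSer g ∧ ∀ x, cobracket (form_nondegenerate hκ) (rhoSer g) (coef _ polyToPow x) =
        polyTensorToSer _ (δ x) := by
  obtain ⟨V, hV, hdual⟩ := hδ.double
  rw [range_polyToLaurentInv] at hV
  obtain ⟨g, hE, hadm, rfl⟩ :=
    IsGradedLagrangianComplement.exists_rhoSer (σ := -1) hs hκ (Or.inr rfl) hV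
  have hskew := isSkewSystem_rhoSer hs g
  have hg := isPolynomialSer_of_admissible hκ hadm
  obtain ⟨δ', hδ'⟩ := exists_lift_polyTensorToSer (cobracket (form_nondegenerate hκ) (rhoSer g))
    (IsPolynomialSer.cobracket (form_nondegenerate hκ) (isPolynomialSer_rhoSer hg))
  refine ⟨g, hE, hg, fun x => ?_⟩
  rw [hδ']
  -- The given structure and the restricted cobracket are both dual to the bracket of V, and the
  -- basic series test every coefficient.
  refine congrArg _ (eq_of_map_polyCoeff fun m k => eq_of_tmul (form_nondegenerate hκ)
    fun a b => ?_)
  obtain ⟨u, hu⟩ := exists_isBasic hadm m a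
  obtain ⟨v, hv⟩ := exists_isBasic hadm k b
  have hu' := isBasic_mem_lagr rfl hskew hu
  have hv' := isBasic_mem_lagr rfl hskew hv
  rw [← tmul_resForm_isBasic hu hv, ← tmul_resForm_isBasic hu hv,
    tmul_resForm_cobracket _ (form_isSymm hs) (form_lieInvariant hi) hadm hskew (hδ' x) hu' hv']
  exact (hdual x u hu' v hv').symm

end PolynomialGraded

/-! ### The correspondence -/

section Correspondence

open Cotangent

variable {𝔤 : Type*} [LieRing 𝔤] [LieAlgebra ℂ 𝔤] [FiniteDimensional ℂ 𝔤]
  {κ₀ : LinearMap.BilinForm ℂ 𝔤} (hκ : κ₀.Nondegenerate)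

/-- Regular parts of generalized `r`-matrices. -/
def IsRegularPart (κ₀ : LinearMap.BilinForm ℂ 𝔤) (g : Ser 2 ⊗[ℂ] (𝔤 ⊗[ℂ] 𝔤)) : Prop :=
  ∀ i j l a b, yangBaxterCoeff (opCoeff κ₀ g) i j l a b = 0

theorem yang_add_injective :
    Function.Injective fun g => yang κ₀ hκ + coef (𝔤 ⊗[ℂ] 𝔤) (serToFld 2) g :=
  fun _ _ h => coef_injective (serToFld_injective 2) (add_left_cancel h)

theorem isGeneralizedRMatrix_yang_add_iff (hi : κ₀.lieInvariant 𝔤) (g : Ser 2 ⊗[ℂ] (𝔤 ⊗[ℂ] 𝔤)) :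
    IsGeneralizedRMatrix κ₀ hκ (yang κ₀ hκ + coef (𝔤 ⊗[ℂ] 𝔤) (serToFld 2) g) ↔
      IsRegularPart κ₀ g :=
  ⟨fun h => (gcybe_yang_add_iff hκ hi g).1 h.gcybe,
    fun h => ⟨⟨g, rfl⟩, (gcybe_yang_add_iff hκ hi g).2 h⟩⟩

/-- Generalized `r`-matrices are determined by their regular part. -/
def regularPartEquiv (hi : κ₀.lieInvariant 𝔤) :
    {g // IsRegularPart κ₀ g} ≃ {r // IsGeneralizedRMatrix κ₀ hκ r} :=
  Equiv.ofBijective (fun g => ⟨yang κ₀ hκ + coef (𝔤 ⊗[ℂ] 𝔤) (serToFld 2) g.1,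
    (isGeneralizedRMatrix_yang_add_iff hκ hi g.1).2 g.2⟩)
    ⟨fun _ _ h => Subtype.ext (yang_add_injective hκ (congrArg Subtype.val h)), by
      rintro ⟨_, hr⟩
      obtain ⟨g, rfl⟩ := hr.normal_form
      exact ⟨⟨g, (isGeneralizedRMatrix_yang_add_iff hκ hi g).1 hr⟩, rfl⟩⟩

/-- Rational generalized `r`-matrices are determined by their regular part. -/
def rationalRegularPartEquiv (hi : κ₀.lieInvariant 𝔤) :
    {g // IsRegularPart κ₀ g ∧ IsPolynomialSer g} ≃
      {r // IsGeneralizedRMatrix κ₀ hκ r ∧ IsRational κ₀ hκ r} :=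
  Equiv.ofBijective (fun g => ⟨yang κ₀ hκ + coef (𝔤 ⊗[ℂ] 𝔤) (serToFld 2) g.1,
    (isGeneralizedRMatrix_yang_add_iff hκ hi g.1).2 g.2.1,
    (isRational_yang_add_iff hκ g.1).2 g.2.2⟩)
    ⟨fun _ _ h => Subtype.ext (yang_add_injective hκ (congrArg Subtype.val h)), by
      rintro ⟨_, hr, hr'⟩
      obtain ⟨g, rfl⟩ := hr.normal_form
      exact ⟨⟨g, (isGeneralizedRMatrix_yang_add_iff hκ hi g).1 hr,
        (isRational_yang_add_iff hκ g).1 hr'⟩, rfl⟩⟩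

theorem exists_polynomial_cobracket (g : {g // IsRegularPart κ₀ g ∧ IsPolynomialSer g}) :
    ∃ δ : Polynomial ℂ ⊗[ℂ] Cotangent 𝔤 →ₗ[ℂ]
        (Polynomial ℂ ⊗[ℂ] Cotangent 𝔤) ⊗[ℂ] (Polynomial ℂ ⊗[ℂ] Cotangent 𝔤),
      ∀ x, cobracket (form_nondegenerate hκ) (rhoSer g.1) (coef _ polyToPow x) =
        polyTensorToSer _ (δ x) :=
  exists_lift_polyTensorToSer _
    (IsPolynomialSer.cobracket (form_nondegenerate hκ) (isPolynomialSer_rhoSer g.2.2))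

variable [LieAlgebra.IsSimple ℂ 𝔤]

/-- The topological Lie bialgebra structure with a given regular part. -/
def topBialgebraEquiv (hs : κ₀.IsSymm) (hi : κ₀.lieInvariant 𝔤) :
    {g // IsRegularPart κ₀ g} ≃ {δ // IsGradedTopLieBialgebra κ₀ δ} :=
  Equiv.ofBijective (fun g => ⟨cobracket (form_nondegenerate hκ) (rhoSer g.1),
    isGradedTopLieBialgebra_cobracket hs hκ hi g.2⟩)
    ⟨fun _ _ h => Subtype.ext (rhoSer_injective hκ (eq_of_cobracket_eq (form_nondegenerate hκ)
      eq_zero_of_forall_lie_eq_zero fun _ => DFunLike.congr_fun (congrArg Subtype.val h) _)), by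
      rintro ⟨δ, hδ⟩
      obtain ⟨g, hg, rfl⟩ := hδ.exists_eq_cobracket hs hκ hi
      exact ⟨⟨g, hg⟩, rfl⟩⟩

/-- The Lie bialgebra structure with a given polynomial regular part. -/
def polyBialgebraEquiv (hs : κ₀.IsSymm) (hi : κ₀.lieInvariant 𝔤) :
    {g // IsRegularPart κ₀ g ∧ IsPolynomialSer g} ≃ {δ // IsGradedPolyLieBialgebra κ₀ δ} :=
  Equiv.ofBijective (fun g => ⟨(exists_polynomial_cobracket hκ g).choose,
    isGradedPolyLieBialgebra_of_cobracket hs hκ hi g.2.1 g.2.2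
      (exists_polynomial_cobracket hκ g).choose_spec⟩)
    ⟨fun g g' h => Subtype.ext (rhoSer_injective hκ (eq_of_cobracket_eq (form_nondegenerate hκ)
      eq_zero_of_forall_lie_eq_zero fun x => by
        rw [(exists_polynomial_cobracket hκ g).choose_spec,
          (exists_polynomial_cobracket hκ g').choose_spec]
        exact congrArg _ (DFunLike.congr_fun (congrArg Subtype.val h) x))), by
      rintro ⟨δ, hδ⟩
      obtain ⟨g, hg, hg', h⟩ := hδ.exists_cobracket hs hκ hi
      refine ⟨⟨g, hg, hg'⟩, Subtype.ext (LinearMap.ext fun x => polyTensorToSer_injective ?_)⟩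
      rw [← h]
      exact ((exists_polynomial_cobracket hκ ⟨g, hg, hg'⟩).choose_spec x).symm⟩

end Correspondence

end LoopBialgebra

end

theorem proposition2p1 {𝔤 : Type*} [LieRing 𝔤] [LieAlgebra ℂ 𝔤] [FiniteDimensional ℂ 𝔤]
    [LieAlgebra.IsSimple ℂ 𝔤] (κ₀ : LinearMap.BilinForm ℂ 𝔤) (hsymm : κ₀.IsSymm)
    (hκ₀ : κ₀.Nondegenerate) (hinv : κ₀.lieInvariant 𝔤) :
    ∃ (Φ : {r // LoopBialgebra.IsGeneralizedRMatrix κ₀ hκ₀ r} ≃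
          {δ // LoopBialgebra.IsGradedTopLieBialgebra κ₀ δ})
      (Ψ : {r // LoopBialgebra.IsGeneralizedRMatrix κ₀ hκ₀ r ∧
            LoopBialgebra.IsRational κ₀ hκ₀ r} ≃
          {δ // LoopBialgebra.IsGradedPolyLieBialgebra κ₀ δ}),
      -- `ρ` is an `r`-matrix with coefficients in `𝔡`
      (∀ r, LoopBialgebra.IsGeneralizedRMatrix κ₀ hκ₀ r →
        LoopBialgebra.IsRMatrix (LoopBialgebra.Cotangent.form κ₀)
          (LoopBialgebra.Cotangent.form_nondegenerate hκ₀) (LoopBialgebra.rho r)) ∧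
      -- `δ(x) = [ρ, x(t₁) ⊗ 1 + 1 ⊗ x(t₂)] = -[x(t₁) ⊗ 1 + 1 ⊗ x(t₂), ρ]` for `δ = Φ r`
      (∀ r x, LoopBialgebra.coef _ (LoopBialgebra.serToFld 2) ((Φ r).1 x) =
        -LoopBialgebra.act
          (LoopBialgebra.coef _ (LoopBialgebra.serToFld 2) (LoopBialgebra.atVar 0 x))
          (LoopBialgebra.coef _ (LoopBialgebra.serToFld 2) (LoopBialgebra.atVar 1 x))
          (LoopBialgebra.rho r.1)) ∧
      -- `Ψ r` is the restriction of `Φ r` to `𝔡[t]`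
      (∀ r x, (Φ ⟨r.1, r.2.1⟩).1 (LoopBialgebra.coef _ LoopBialgebra.polyToPow x) =
        LoopBialgebra.polyTensorToSer _ ((Ψ r).1 x)) := by
  open LoopBialgebra in
  -- Both bijections factor through the regular part `g`, so the compatibility claims need checking
  -- only for r = C / (t₁ - t₂) + g.
  refine ⟨(regularPartEquiv hκ₀ hinv).symm.trans (topBialgebraEquiv hκ₀ hsymm hinv),
    (rationalRegularPartEquiv hκ₀ hinv).symm.trans (polyBialgebraEquiv hκ₀ hsymm hinv),
    fun r hr => isRMatrix_rho hsymm hκ₀ hinv hr, fun r x => ?_, fun r x => ?_⟩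
  · obtain ⟨g, rfl⟩ := (regularPartEquiv hκ₀ hinv).surjective r
    rw [Equiv.trans_apply, Equiv.symm_apply_apply]
    refine (coef_cobracket _ (form_lieInvariant hinv) _ x).trans ?_
    rw [← rho_yang_add hsymm hκ₀]
    rfl
  · obtain ⟨g, rfl⟩ := (rationalRegularPartEquiv hκ₀ hinv).surjective r
    have h : (⟨(rationalRegularPartEquiv hκ₀ hinv g).1, (rationalRegularPartEquiv hκ₀ hinv g).2.1⟩ :
        {r // IsGeneralizedRMatrix κ₀ hκ₀ r}) = regularPartEquiv hκ₀ hinv ⟨g.1, g.2.1⟩ := rfl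
    rw [h, Equiv.trans_apply, Equiv.trans_apply, Equiv.symm_apply_apply, Equiv.symm_apply_apply]
    exact (exists_polynomial_cobracket hκ₀ g).choose_spec x
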